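/- All matrices are over $\mathbb F_2$, entropies are Shannon entropies in bits, $h$ is the binary entropy function. A function $g(k)$ is exponentially small in $k$ if $|g(k)|\le Ce^{-ck}$ for some constants $C,c>0$ and all $k$. **Protocol $P_0$** (parameters $n_0,k_0,m$, crossover probability $0<\varphi<1/2$, a parity check matrix $\mathbf H_0$ of rank $n_0-k_0$ of an $(n_0,k_0)$ linear code, $R_0=k_0/n_0$, $\epsilon_\varphi=2\varphi(1-\varphi)$). Alice has two secrets in $\mathbb F_2^m$. A public $m\times n_0$ matrix $\mathbf H_1$ is drawn uniformly among those for which $\mathbf H'=\begin{bmatrix}\mathbf H_0\\ \mathbf H_1\end{bmatrix}$ has full row rank. Alice sends each of $2n_0$ uniform random bits $r_i$ twice over the binary symmetric channel; position $i$ is an erasure if Bob receives two different bits. Bob splits the $2n_0$ positions in any way he likes (depending on $\mathbf H_1$ and on what he received in this run) into two sets of size $n_0$, one for each secret, and sends them to Alice, who permutes each of them uniformly at random and tells Bob the permutations. For each secret $z$, Alice draws $\mathbf c_z$ uniformly with $\mathbf H_0\mathbf c_z=0$, $\mathbf H_1\mathbf c_z=z$, and sends $\mathbf c_z+\mathbf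 r_{I_z}$, where $I_z$ is the permuted set for $z$. Bob *asks for* a secret if its set never contains more erasures than the other set. **Protocol $P_1'$**, with possibly cheating Bob. Let $\mathbf H$ be an $r\times n$ matrix with $\mathbf H\mathbf H^{\mathsf T}=\mathrm{Id}$, let $\delta>0$ be such that $k=r(\frac12-\delta)$ is a non-negative integer. Alice's matrices $M_s,M_t$ are independent and uniform, either among all $k\times r$ matrices, or among those of rank $k$ (so that every pair of secrets $\tilde{\mathbf s},\tilde{\mathbf t}$ can occur); $\mathbf s,\mathbf t\in(\mathbb F_2^m)^r$ are independent and uniform, and her secrets are $\tilde{\mathbf s}=M_s\mathbf s$, $\tilde{\mathbf t}=M_t\mathbf t$ (in the second case $\tilde{\mathbf s},\tilde{\mathbf t}$ are independent and uniform). She draws $\mathbf x\in(\mathbb F_2^m)^n$ uniformly with $\mathbf H\mathbf x^{\mathsf T}=\mathbf s$ and sets $\mathbf y=\mathbf x+\sum_j(s_j+t_j)H_j$, where $H_j$ is the $j$th row of $\mathbf H$. For $\ell=1,\dots,n$ they run $P_0$ independently with secrets $x_\ell,y_\ell$, and finally Alice sends $M_s,M_t$ to Bob. Bob chooses any vector $\mathbf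 u\in\mathbb F_2^n$ beforehand and in the $\ell$th run he asks for $v_\ell=x_\ell$ if $u_\ell=0$ and for $v_\ell=y_\ell$ if $u_\ell=1$. Let $V=\mathbf H(\mathbf H*\mathbf u)^{\mathsf T}$, where $\mathbf H*\mathbf u$ is $\mathbf H$ with its $\ell$th column multiplied by $u_\ell$, and $U=\mathrm{Id}+V$. Let $\mathcal O$ consist of everything Bob sees in the $n$ runs of $P_0$, of $M_s,M_t$, and of $\mathbf v=(v_1,\dots,v_n)$ (which is given to him exactly). Let $\tilde S,\tilde T$ be $\tilde{\mathbf s},\tilde{\mathbf t}$ viewed as random variables. **Proposition.** There is a function $f_1(r,\delta)$, exponentially small in $r$ for every $\delta>0$, and for every $0<\varphi<1/2$ a function $f_0(\varepsilon,m)$, exponentially small in $m$ for every $\varepsilon>0$, such that the following holds. 1. In the protocol above, if $\varepsilon>0$ and $m\le n_0\bigl[R_0-(1-\epsilon_\varphi)\bigl(1-h(\tfrac{\varphi^2}{1-\epsilon_\varphi})\bigr)-\varepsilon\bigr]$, then for every $\mathbf u$ and every such behaviour of Bob we have $\mathbf H\mathbf v^{\mathsf T}=U\mathbf s+V\mathbf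 t$, and - if $\operatorname{rank}V\le r/2$, then $H(\tilde T\mid\tilde S,\mathcal O)\ge rm\left(\tfrac12-\delta\right)-m f_1(r,\delta)-n f_0(\varepsilon,m)$; - if $\operatorname{rank}V>r/2$, then $H(\tilde S\mid\tilde T,\mathcal O)\ge rm\left(\tfrac12-\delta\right)-m f_1(r,\delta)-n f_0(\varepsilon,m)$. 2. If Bob's observation is just $\mathcal O=(U\mathbf s+V\mathbf t,M_s,M_t)$, with $m\geq 0$ any integer, $U,V$ arbitrary $r\times r$ matrices and $M_s,M_t,\mathbf s,\mathbf t$ distributed as above, then the same two implications hold without the term $n f_0(\varepsilon,m)$. -/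

import Mathlib

namespace OT

/-! ### Finite probability and entropy -/

/-- `a × b` binary matrices. A column of `a` strings of `m` bits is a matrix in `Mat a m`,
whose `i`-th row is the `i`-th string. -/
abbrev Mat (a b : ℕ) : Type := Matrix (Fin a) (Fin b) (ZMod 2)

/-- The mass function of the uniform distribution on a finite set `S`. -/
noncomputable def unif {α : Type} (S : Set α) (a : α) : ℝ :=
  S.indicator (fun _ => (S.ncard : ℝ)⁻¹) a

/-- Probability of the event `A` under the mass function `p`. -/
noncomputable def pr {Ω : Type} [Fintype Ω] (p : Ω → ℝ) (A : Set Ω) : ℝ :=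
  ∑ ω, A.indicator p ω

/-- Shannon's conditional entropy `H(X | Y) = E[-log₂ P(X | Y)]`, in bits, of two random variables
on a finite probability space with mass function `p`. -/
noncomputable def condEntropy {Ω α β : Type} [Fintype Ω] (p : Ω → ℝ) (X : Ω → α) (Y : Ω → β) : ℝ :=
  -∑ ω, p ω * Real.logb 2 (pr p {ω' | X ω' = X ω ∧ Y ω' = Y ω} / pr p {ω' | Y ω' = Y ω})

/-- The binary entropy function, in bits. -/
noncomputable def binEnt (p : ℝ) : ℝ := Real.binEntropy p / Real.log 2

/-- `g k` is exponentially small in `k`. -/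
def ExpSmall (g : ℕ → ℝ) : Prop :=
  ∃ C c : ℝ, 0 < C ∧ 0 < c ∧ ∀ k : ℕ, |g k| ≤ C * Real.exp (-(c * k))

/-! ### Protocol `P₀`: the string oblivious transfer over a binary symmetric channel

The two secrets of `m` bits are `sec 0` and `sec 1`. -/

/-- The random choices in one run of `P₀`: Alice's `2 n₀` bits, the noise of the channel on the two
transmissions of each bit, Alice's permutations of the two index sets, the hash matrix `H₁`,
and the codewords that carry the two secrets. -/
@[ext] structure P0Run (n₀ m : ℕ) : Type where
  bits : Fin (2 * n₀) → ZMod 2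
  noise : Fin (2 * n₀) → Fin 2 → ZMod 2
  perm : ZMod 2 → Equiv.Perm (Fin n₀)
  hash : Mat m n₀
  codeword : ZMod 2 → Fin n₀ → ZMod 2

noncomputable instance (n₀ m : ℕ) : Fintype (P0Run n₀ m) :=
  Fintype.ofInjective
    (fun ρ : P0Run n₀ m => (ρ.bits, ρ.noise, ρ.perm, ρ.hash, ρ.codeword)) (by
      intro ρ ρ' h
      simp only [Prod.mk.injEq] at h
      exact P0Run.ext h.1 h.2.1 h.2.2.1 h.2.2.2.1 h.2.2.2.2)

/-- The pairs of bits that Bob receives when every bit of Alice is sent twice. -/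
def P0Run.received {n₀ m : ℕ} (ρ : P0Run n₀ m) : Fin (2 * n₀) → Fin 2 → ZMod 2 :=
  fun i b => ρ.bits i + ρ.noise i b

/-- Position `i` is an erasure if the two received bits differ. -/
def Erased {n₀ : ℕ} (w : Fin (2 * n₀) → Fin 2 → ZMod 2) (i : Fin (2 * n₀)) : Prop :=
  w i 0 ≠ w i 1

/-- Bob's behaviour in one run of `P₀`. Knowing `H₁` and the received pairs `w`, he splits the
`2 n₀` positions into two sets of size `n₀`, here given by a listing: the set for the secret `a` is
`{π (a, j) | j}`. A cheating Bob may split in any way. -/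
abbrev P0Strategy (n₀ m : ℕ) : Type :=
  Mat m n₀ → (Fin (2 * n₀) → Fin 2 → ZMod 2) → (ZMod 2 × Fin n₀ ≃ Fin (2 * n₀))

/-- Bob asks for the secret `b`: the set he announces for the secret `b` is never noisier,
i.e. contains no more erasures, than the set he announces for the other secret. -/
def P0Strategy.AsksFor {n₀ m : ℕ} (π : P0Strategy n₀ m) (b : ZMod 2) : Prop :=
  ∀ h w, {j | Erased w (π h w (b, j))}.ncard ≤ {j | Erased w (π h w (b + 1, j))}.ncard

/-- Alice's last message: for each secret `a`, the codeword `c_a` plus the string of her bits at the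
positions of Bob's set for `a`, in the order that results from Alice's permutation of that set. -/
def P0Run.message {n₀ m : ℕ} (π : P0Strategy n₀ m) (ρ : P0Run n₀ m) :
    ZMod 2 → Fin n₀ → ZMod 2 :=
  fun a j => ρ.codeword a j + ρ.bits (π ρ.hash ρ.received (a, ρ.perm a j))

/-- Everything Bob sees in one run of `P₀`: the hash matrix, the received pairs, Alice's
permutations and her last message. -/
def P0Run.view {n₀ m : ℕ} (π : P0Strategy n₀ m) (ρ : P0Run n₀ m) :
    Mat m n₀ × (Fin (2 * n₀) → Fin 2 → ZMod 2) × (ZMod 2 → Equiv.Perm (Fin n₀)) ×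
      (ZMod 2 → Fin n₀ → ZMod 2) :=
  (ρ.hash, ρ.received, ρ.perm, ρ.message π)

/-- The law of one run of `P₀` with secrets `sec 0`, `sec 1`, crossover probability `φ` and a code
with parity check matrix `H₀`. The hash matrix `H₁` is uniform among those for which the matrix
with blocks `H₀`, `H₁` has full row rank, and the codeword `c_a` is uniform among the solutions of
`H₀ c_a = 0`, `H₁ c_a = sec a`. -/
noncomputable def p0Prob {n₀ m q : ℕ} (φ : ℝ) (H₀ : Mat q n₀) (sec : ZMod 2 → Fin m → ZMod 2)
    (ρ : P0Run n₀ m) : ℝ :=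
  unif Set.univ ρ.bits * (∏ i, ∏ b, if ρ.noise i b = 0 then 1 - φ else φ) *
    unif Set.univ ρ.perm *
    unif {H₁ : Mat m n₀ | (Matrix.fromRows H₀ H₁).rank = q + m} ρ.hash *
    ∏ a, unif {c : Fin n₀ → ZMod 2 | H₀.mulVec c = 0 ∧ ρ.hash.mulVec c = sec a} (ρ.codeword a)

/-! ### Protocol `P₁'`: compressed secrets, transferred by `n` runs of `P₀` -/

/-- The random choices in an execution: the compression matrices `M_s`, `M_t`, the uncompressed
secrets `s`, `t`, the `n` strings `x`, and the `n` runs of `P₀`. -/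
@[ext] structure Execution (r k m n n₀ : ℕ) : Type where
  Ms : Mat k r
  Mt : Mat k r
  s : Mat r m
  t : Mat r m
  x : Mat n m
  run : Fin n → P0Run n₀ m

noncomputable instance (r k m n n₀ : ℕ) : Fintype (Execution r k m n n₀) :=
  Fintype.ofInjective
    (fun ω : Execution r k m n n₀ => (ω.Ms, ω.Mt, ω.s, ω.t, ω.x, ω.run)) (by
      intro ω ω' h
      simp only [Prod.mk.injEq] at h
      exact Execution.ext h.1 h.2.1 h.2.2.1 h.2.2.2.1 h.2.2.2.2.1 h.2.2.2.2.2)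

namespace Execution

variable {r k m n n₀ : ℕ}

/-- The secret `s̃ = M_s s`. -/
def sTilde (ω : Execution r k m n n₀) : Mat k m := ω.Ms * ω.s

/-- The secret `t̃ = M_t t`. -/
def tTilde (ω : Execution r k m n n₀) : Mat k m := ω.Mt * ω.t

/-- The strings `y_ℓ = x_ℓ + ∑ j, H j ℓ • (s_j + t_j)`. -/
def y (H : Mat r n) (ω : Execution r k m n n₀) : Mat n m :=
  ω.x + H.transpose * (ω.s + ω.t)

/-- The two secrets of the `ℓ`-th run of `P₀`: `x_ℓ` has index `0` and `y_ℓ` has index `1`. -/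
def secret (H : Mat r n) (ω : Execution r k m n n₀) (l : Fin n) : ZMod 2 → Fin m → ZMod 2 :=
  fun a => if a = 0 then ω.x l else ω.y H l

/-- The strings requested by Bob: `v_ℓ = x_ℓ` if `u_ℓ = 0` and `v_ℓ = y_ℓ` if `u_ℓ = 1`. -/
def requested (H : Mat r n) (u : Fin n → ZMod 2) (ω : Execution r k m n n₀) : Mat n m :=
  Matrix.of fun l => ω.secret H l (u l)

/-- Bob's observation `𝒪`: his views of the `n` runs of `P₀`, the strings `v_ℓ` that he requested
(which he is given exactly, even if he could not decode them), and `M_s`, `M_t`. -/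
def view (H : Mat r n) (u : Fin n → ZMod 2) (π : Fin n → P0Strategy n₀ m)
    (ω : Execution r k m n n₀) :
    (Fin n → Mat m n₀ × (Fin (2 * n₀) → Fin 2 → ZMod 2) × (ZMod 2 → Equiv.Perm (Fin n₀)) ×
      (ZMod 2 → Fin n₀ → ZMod 2)) × Mat n m × Mat k r × Mat k r :=
  (fun l => (ω.run l).view (π l), ω.requested H u, ω.Ms, ω.Mt)

/-- The law of an execution: `M_s`, `M_t` uniform in `𝓜`, `s`, `t` uniform, `x` uniform
subject to `H x = s`, and `n` independent runs of `P₀` on the secrets `x_ℓ`, `y_ℓ`. If `𝓜` is the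
set of matrices of full row rank, then `s̃`, `t̃` are uniform and independent, and `s`, `t` are
uniform subject to `M_s s = s̃`, `M_t t = t̃`. -/
noncomputable def prob {q : ℕ} (φ : ℝ) (H₀ : Mat q n₀) (H : Mat r n) (𝓜 : Set (Mat k r))
    (ω : Execution r k m n n₀) : ℝ :=
  unif 𝓜 ω.Ms * unif 𝓜 ω.Mt * unif Set.univ ω.s * unif Set.univ ω.t *
    unif {x : Mat n m | H * x = ω.s} ω.x *
    ∏ l, p0Prob φ H₀ (ω.secret H l) (ω.run l)

end Execution

/-- The matrix `V = H (H * u)ᵀ`, where the `ℓ`-th column of `H * u` is `u_ℓ` times that of `H`. -/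
def queryMatrix {r n : ℕ} (H : Mat r n) (u : Fin n → ZMod 2) : Mat r r :=
  H * (Matrix.of fun j l => H j l * u l).transpose

/-- The law of `(M_s, M_t, s, t)` alone. -/
noncomputable def idealProb {r k m : ℕ} (𝓜 : Set (Mat k r))
    (ω : Mat k r × Mat k r × Mat r m × Mat r m) : ℝ :=
  unif 𝓜 ω.1 * unif 𝓜 ω.2.1 * unif Set.univ ω.2.2.1 * unif Set.univ ω.2.2.2

/-- What Bob sees in the idealised situation where he learns `U s + V t` and nothing else about
`s`, `t`, and is then told `M_s`, `M_t`. -/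
def idealView {r k m : ℕ} (U V : Mat r r) (ω : Mat k r × Mat k r × Mat r m × Mat r m) :
    Mat r m × Mat k r × Mat k r :=
  (U * ω.2.2.1 + V * ω.2.2.2, ω.1, ω.2.1)

end OT

namespace OT

open Finset Matrix Filter Topology

/-! ### Uniform distributions, probabilities and conditional entropies -/

/-! Two independent mechanisms are combined: a linear-algebra argument bounds what the requested
strings reveal, and a privacy amplification argument bounds what the runs of `P₀` reveal beyond
them.

Linear part. Suppose that for fixed `M_s`, `M_t` every value of the hidden compressed secret can be
produced by a pair `(s, t)` that gives zero for the other compressed secret and satisfies `U s + V t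
= 0`. Translating by such pairs preserves the law and the observation, so the hidden secret is
exactly uniform on `k m` bits given what is seen. By duality (`exists_of_not_decouples`) the
property fails only if some `a M` with `a ≠ 0` equals `c U` while `b M'` equals `c V`; here `M`
compresses the hidden secret, and `U` is the matrix in front of it. A union bound makes this
unlikely if `rank U ≤ r/2`, by counting the vectors `c U`. It is also unlikely if `rank V > r/2`:
either `b = 0` and `c` lies in the small kernel of `V`, or `b ≠ 0` and two independent events must
occur. The first count, with the roles of the secrets exchanged, hides `t̃`; the second hides `s̃`.
In the protocol the translation is extended to `x` so that all requested strings stay fixed, and the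
constraint `H x = s` then becomes `U s + V t = 0` again.

Runs. The view of the runs is compared with a simulation that depends only on the requested strings.
By `condEntropy_sub_le_condEntropy_prod` the entropy drops by at most the expected logarithm of a
likelihood ratio, which adds up over the runs. For one run it is the divergence from uniform of the
hash `H₁ r`, given the syndrome `H₀ r`, of Alice's bits `r` on the set of the secret not requested:
the message reveals the syndrome and masks the secret by the hash.

Averaged over `H₁`, this divergence is controlled by the power sum `∑ L(e)^(1+s)` of the posterior
law of the bits (`sum_unif_mul_hashDivergence_le`). An erased bit is uniform and any other bit has
bias `η = φ²/(1-ε_φ)`, so erasures only help, and the set not requested holds at least half of them.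
Bob chooses the sets after seeing `H₁`, so this average is not directly available; Alice's
permutation leaves only the number of erasures relevant, and a sum over the `n₀ + 1` possible
numbers replaces Bob's choice (`sum_p0Prob_mul_logb_le`). The resulting bound is essentially
`leakageBase φ ε s ^ n₀`, whose base is `1` at `s = 0` with derivative `-ε log 2`, so some small `s`
gives exponential decay. -/

theorem unif_nonneg {α : Type} (S : Set α) (a : α) : 0 ≤ unif S a :=
  Set.indicator_nonneg (fun _ _ => by positivity) a

theorem unif_of_mem {α : Type} {S : Set α} {a : α} (h : a ∈ S) : unif S a = (S.ncard : ℝ)⁻¹ :=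
  Set.indicator_of_mem h _

theorem unif_of_notMem {α : Type} {S : Set α} {a : α} (h : a ∉ S) : unif S a = 0 :=
  Set.indicator_of_notMem h _

open Classical in
theorem sum_unif_mul {α : Type} [Fintype α] (S : Set α) (f : α → ℝ) :
    ∑ a, unif S a * f a = (S.ncard : ℝ)⁻¹ * ∑ a, if a ∈ S then f a else 0 := by
  rw [mul_sum]
  refine sum_congr rfl fun a _ => ?_
  by_cases h : a ∈ S
  · rw [unif_of_mem h, if_pos h]
  · rw [unif_of_notMem h, if_neg h]; simp

open Classical in
theorem sum_ite_mem_one {α : Type} [Fintype α] (S : Set α) :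
    (∑ a, if a ∈ S then (1 : ℝ) else 0) = S.ncard := by
  rw [sum_boole, Set.ncard_eq_toFinset_card', Set.toFinset_card]
  norm_cast
  rw [← Fintype.card_subtype]

theorem sum_unif {α : Type} [Fintype α] {S : Set α} (h : S.Nonempty) : ∑ a, unif S a = 1 := by
  classical
  have := sum_unif_mul S fun _ => 1
  simp only [mul_one] at this
  rw [this, sum_ite_mem_one, inv_mul_cancel₀]
  have := (Set.ncard_pos (Set.toFinite S)).2 h
  positivity

theorem unif_univ {α : Type} [Fintype α] (a : α) :
    unif Set.univ a = (Fintype.card α : ℝ)⁻¹ := by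
  rw [unif_of_mem (Set.mem_univ a), Set.ncard_univ, Nat.card_eq_fintype_card]

section Entropy

variable {Ω Ω' α β γ R : Type} [Fintype Ω] [Fintype Ω']

theorem pr_eq_sum (p : Ω → ℝ) (A : Set Ω) [DecidablePred (· ∈ A)] :
    pr p A = ∑ ω, if ω ∈ A then p ω else 0 :=
  sum_congr rfl fun ω _ => by
    by_cases h : ω ∈ A <;> simp [h]

theorem pr_nonneg {p : Ω → ℝ} (hp : ∀ ω, 0 ≤ p ω) (A : Set Ω) : 0 ≤ pr p A :=
  sum_nonneg fun ω _ => Set.indicator_nonneg (fun _ _ => hp _) ω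

theorem pr_mono {p : Ω → ℝ} (hp : ∀ ω, 0 ≤ p ω) {A B : Set Ω} (h : A ⊆ B) : pr p A ≤ pr p B :=
  sum_le_sum fun ω _ => Set.indicator_le_indicator_of_subset h hp ω

theorem le_pr {p : Ω → ℝ} (hp : ∀ ω, 0 ≤ p ω) {A : Set Ω} {ω : Ω} (h : ω ∈ A) :
    p ω ≤ pr p A := by
  have := single_le_sum (f := fun ω => A.indicator p ω)
    (fun ω _ => Set.indicator_nonneg (fun _ _ => hp _) ω) (mem_univ ω)
  simpa [h, pr] using this

theorem pr_add_pr_compl (p : Ω → ℝ) (A : Set Ω) : pr p A + pr p Aᶜ = ∑ ω, p ω := by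
  rw [pr, pr, ← sum_add_distrib]
  exact sum_congr rfl fun ω _ => congrFun (Set.indicator_self_add_compl A p) ω

theorem sum_pr_fiber [Fintype α] (p : Ω → ℝ) (X : Ω → α) (A : Set Ω) :
    ∑ x, pr p {ω | X ω = x ∧ ω ∈ A} = pr p A := by
  classical
  simp only [pr_eq_sum]
  rw [sum_comm]
  refine sum_congr rfl fun ω _ => ?_
  by_cases h : ω ∈ A <;> simp [h]

theorem sum_mul_comp_eq_sum_pr [Fintype α] (p : Ω → ℝ) (X : Ω → α) (f : α → ℝ) :
    ∑ ω, p ω * f (X ω) = ∑ x, pr p {ω | X ω = x} * f x := by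
  classical
  simp only [pr_eq_sum, sum_mul]
  rw [sum_comm]
  refine sum_congr rfl fun ω _ => ?_
  simp [ite_mul]

theorem pr_comp_equiv (e : Ω' ≃ Ω) (p : Ω → ℝ) (A : Set Ω) : pr (p ∘ e) (e ⁻¹' A) = pr p A := by
  rw [pr, pr, ← e.sum_comp]
  rfl

theorem condEntropy_comp_equiv (e : Ω' ≃ Ω) (p : Ω → ℝ) (X : Ω → α) (Y : Ω → β) :
    condEntropy (p ∘ e) (X ∘ e) (Y ∘ e) = condEntropy p X Y := by
  rw [condEntropy, condEntropy, ← e.sum_comp]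
  refine congrArg _ (sum_congr rfl fun ω _ => ?_)
  rw [← pr_comp_equiv e p, ← pr_comp_equiv e p]
  rfl

theorem condEntropy_congr_right {p : Ω → ℝ} {X : Ω → α} {Y : Ω → β} {Y' : Ω → γ}
    (h : ∀ ω ω', Y ω = Y ω' ↔ Y' ω = Y' ω') : condEntropy p X Y = condEntropy p X Y' := by
  simp only [condEntropy, h]

theorem logb_ratio_nonpos {p : Ω → ℝ} (hp : ∀ ω, 0 ≤ p ω) (X : Ω → α) (Y : Ω → β) (ω : Ω) :
    Real.logb 2 (pr p {ω' | X ω' = X ω ∧ Y ω' = Y ω} / pr p {ω' | Y ω' = Y ω}) ≤ 0 := by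
  have h1 : pr p {ω' | X ω' = X ω ∧ Y ω' = Y ω} ≤ pr p {ω' | Y ω' = Y ω} :=
    pr_mono hp fun _ h => h.2
  exact Real.logb_nonpos (by norm_num) (div_nonneg (pr_nonneg hp _) (pr_nonneg hp _))
    (div_le_one_of_le₀ h1 (pr_nonneg hp _))

theorem condEntropy_nonneg {p : Ω → ℝ} (hp : ∀ ω, 0 ≤ p ω) (X : Ω → α) (Y : Ω → β) :
    0 ≤ condEntropy p X Y := by
  rw [condEntropy, neg_nonneg]
  exact sum_nonpos fun ω _ => mul_nonpos_of_nonneg_of_nonpos (hp ω) (logb_ratio_nonpos hp X Y ω)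

/-- On `A` the integrand of the entropy is at least `c`, and elsewhere it is nonnegative. Points of
mass zero contribute nothing, so the hypothesis is harmless there. -/
theorem mul_pr_le_condEntropy {p : Ω → ℝ} (hp : ∀ ω, 0 ≤ p ω) (X : Ω → α) (Y : Ω → β)
    (A : Set Ω) (c : ℕ)
    (h : ∀ ω ∈ A, 2 ^ c * pr p {ω' | X ω' = X ω ∧ Y ω' = Y ω} ≤ pr p {ω' | Y ω' = Y ω}) :
    c * pr p A ≤ condEntropy p X Y := by
  classical
  rw [condEntropy, pr_eq_sum, mul_sum, ← sum_neg_distrib]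
  refine sum_le_sum fun ω _ => ?_
  have h0 := logb_ratio_nonpos hp X Y ω
  by_cases hA : ω ∈ A
  · rw [if_pos hA]
    rcases (hp ω).eq_or_lt with h1 | h1
    · simp [← h1]
    have hX : 0 < pr p {ω' | X ω' = X ω ∧ Y ω' = Y ω} := h1.trans_le (le_pr hp (by simp))
    have hY : 0 < pr p {ω' | Y ω' = Y ω} := h1.trans_le (le_pr hp (by simp))
    have h2 : Real.logb 2 (pr p {ω' | X ω' = X ω ∧ Y ω' = Y ω} / pr p {ω' | Y ω' = Y ω})
        ≤ -(c : ℝ) := by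
      rw [Real.logb_le_iff_le_rpow (by norm_num) (by positivity), div_le_iff₀ hY, Real.rpow_neg
        (by norm_num), Real.rpow_natCast, inv_mul_eq_div, le_div_iff₀' (by positivity)]
      exact h ω hA
    nlinarith
  · rw [if_neg hA]
    nlinarith [hp ω]

/-- If an observer of `Y` also sees `W`, drawn from the kernel `K`, then the uncertainty about `X`
decreases by at most the expected logarithm of the likelihood ratio `g` between `K` and a law
whose image under `W` is a function of `Y`. -/
theorem condEntropy_sub_le_condEntropy_prod [Fintype R] [Fintype α] [Fintype β] [Fintype γ]
    {p : Ω → ℝ} {K : Ω → R → ℝ} (X : Ω → α) (Y : Ω → β) (W : R → γ) (g : Ω → R → ℝ)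
    (Q : β → γ → ℝ) (hp : ∀ ω, 0 ≤ p ω) (hp1 : ∑ ω, p ω = 1) (hK : ∀ ω ρ, 0 ≤ K ω ρ)
    (hK1 : ∀ ω, 0 < p ω → ∑ ρ, K ω ρ = 1) (hg : ∀ ω ρ, 0 < g ω ρ) (hQ : ∀ y w, 0 ≤ Q y w)
    (hQ1 : ∀ y, ∑ w, Q y w ≤ 1)
    (hKQ : ∀ ω, 0 < p ω → ∀ w, pr (fun ρ => K ω ρ / g ω ρ) {ρ | W ρ = w} ≤ Q (Y ω) w) :
    condEntropy p X Y - ∑ ω, p ω * ∑ ρ, K ω ρ * Real.logb 2 (g ω ρ) ≤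
      condEntropy (fun x : Ω × R => p x.1 * K x.1 x.2) (fun x => X x.1)
        (fun x => (Y x.1, W x.2)) := by
  classical
  set P : Ω × R → ℝ := fun x => p x.1 * K x.1 x.2 with hPdef
  -- `a`, `b` are the masses of `(X, Y)` and `Y` before `W` is seen; `A`, `B` are the corresponding
  -- masses afterwards.
  set a : α → β → ℝ := fun x y => pr p {ω | X ω = x ∧ Y ω = y}
  set b : β → ℝ := fun y => pr p {ω | Y ω = y}
  set A : α → β → γ → ℝ := fun x y w => pr P {z | X z.1 = x ∧ (Y z.1, W z.2) = (y, w)} with hAdef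
  set B : β → γ → ℝ := fun y w => pr P {z | (Y z.1, W z.2) = (y, w)} with hBdef
  have hP : ∀ z, 0 ≤ P z := fun z => mul_nonneg (hp _) (hK _ _)
  have ha0 : ∀ x y, 0 ≤ a x y := fun x y => pr_nonneg hp _
  have hb0 : ∀ y, 0 ≤ b y := fun y => pr_nonneg hp _
  have hA0 : ∀ x y w, 0 ≤ A x y w := fun x y w => pr_nonneg hP _
  have hB0 : ∀ y w, 0 ≤ B y w := fun y w => pr_nonneg hP _
  have hsum : ∀ f : Ω → ℝ, ∑ ω, p ω * f ω = ∑ ω, ∑ ρ, P (ω, ρ) * f ω := by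
    intro f
    refine sum_congr rfl fun ω _ => ?_
    rcases (hp ω).eq_or_lt with h | h
    · simp [hPdef, ← h]
    · simp only [hPdef]
      rw [← sum_mul, ← mul_sum, hK1 ω h, mul_one]
  have hP1 : ∑ ω, ∑ ρ, P (ω, ρ) = 1 := by
    have := hsum fun _ => 1
    simpa [hp1] using this.symm
  -- The quotient of the new and old conditional probabilities of `X`, divided by `g`, has mean at
  -- most one: the sum over `ρ` is dominated by `Q`, which no longer depends on `X`, and then the
  -- conditional probabilities of `X` sum to at most one. Quotients with zero denominator are `0`,
  -- which only decreases the sums.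
  have key : ∑ ω, ∑ ρ, P (ω, ρ) * (A (X ω) (Y ω) (W ρ) / B (Y ω) (W ρ) *
      (b (Y ω) / a (X ω) (Y ω)) / g ω ρ) ≤ 1 := by
    calc _ = ∑ ω, ∑ w, p ω * (A (X ω) (Y ω) w / B (Y ω) w * (b (Y ω) / a (X ω) (Y ω))) *
            pr (fun ρ => K ω ρ / g ω ρ) {ρ | W ρ = w} := by
          refine sum_congr rfl fun ω _ => ?_
          have := sum_mul_comp_eq_sum_pr (fun ρ => K ω ρ / g ω ρ) W
            (fun w => p ω * (A (X ω) (Y ω) w / B (Y ω) w * (b (Y ω) / a (X ω) (Y ω))))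
          simp only [mul_comm _ (pr _ _)]
          rw [← this]
          refine sum_congr rfl fun ρ _ => ?_
          simp only [hPdef]
          ring
      _ ≤ ∑ ω, ∑ w, p ω * (A (X ω) (Y ω) w / B (Y ω) w * (b (Y ω) / a (X ω) (Y ω))) *
            Q (Y ω) w := by
          refine sum_le_sum fun ω _ => sum_le_sum fun w _ => ?_
          rcases (hp ω).eq_or_lt with h | h
          · simp [← h]
          · refine mul_le_mul_of_nonneg_left (hKQ ω h w) ?_
            have := hp ω
            have := hA0 (X ω) (Y ω) w
            have := hB0 (Y ω) w
            have := hb0 (Y ω)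
            have := ha0 (X ω) (Y ω)
            positivity
      _ = ∑ ω, p ω * (fun xy : α × β => ∑ w, A xy.1 xy.2 w / B xy.2 w *
            (b xy.2 / a xy.1 xy.2) * Q xy.2 w) (X ω, Y ω) := by
          refine sum_congr rfl fun ω _ => ?_
          rw [mul_sum]
          exact sum_congr rfl fun w _ => by ring
      _ = ∑ y, ∑ x, a x y * ∑ w, A x y w / B y w * (b y / a x y) * Q y w := by
          refine (sum_mul_comp_eq_sum_pr p (fun ω => (X ω, Y ω)) (fun xy : α × β =>
            ∑ w, A xy.1 xy.2 w / B xy.2 w * (b xy.2 / a xy.1 xy.2) * Q xy.2 w)).trans ?_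
          rw [Fintype.sum_prod_type, sum_comm]
          simp only [Prod.mk.injEq]
          rfl
      _ ≤ ∑ y, ∑ x, ∑ w, A x y w / B y w * b y * Q y w := by
          refine sum_le_sum fun y _ => sum_le_sum fun x _ => ?_
          rw [mul_sum]
          refine sum_le_sum fun w _ => ?_
          have h1 : 0 ≤ A x y w / B y w * b y * Q y w :=
            mul_nonneg (mul_nonneg (div_nonneg (hA0 _ _ _) (hB0 _ _)) (hb0 _)) (hQ _ _)
          rcases (ha0 x y).eq_or_lt with h | h
          · simpa [← h] using h1
          · refine le_of_eq ?_
            field_simp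
      _ = ∑ y, b y * ∑ w, B y w / B y w * Q y w := by
          refine sum_congr rfl fun y _ => ?_
          rw [sum_comm, mul_sum]
          refine sum_congr rfl fun w _ => ?_
          have : ∑ x, A x y w = B y w := sum_pr_fiber P (fun z => X z.1) _
          rw [← this]
          simp only [div_eq_mul_inv, sum_mul, mul_sum]
          exact sum_congr rfl fun x _ => by ring
      _ ≤ ∑ y, b y * 1 := by
          refine sum_le_sum fun y _ => mul_le_mul_of_nonneg_left ?_ (hb0 y)
          refine (sum_le_sum fun w _ => ?_).trans (hQ1 y)
          exact mul_le_of_le_one_left (hQ y w) (div_self_le_one _)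
      _ = 1 := by
          have := sum_mul_comp_eq_sum_pr p Y fun _ => 1
          rw [← this]
          simpa using hp1
  -- Gibbs' inequality: `log x ≤ x - 1` applied to the quotient in `key`.
  have hlog : ∑ ω, ∑ ρ, P (ω, ρ) * (Real.log (A (X ω) (Y ω) (W ρ) / B (Y ω) (W ρ)) -
      Real.log (a (X ω) (Y ω) / b (Y ω)) - Real.log (g ω ρ)) ≤ 0 := by
    have : ∑ ω, ∑ ρ, P (ω, ρ) * (Real.log (A (X ω) (Y ω) (W ρ) / B (Y ω) (W ρ)) -
      Real.log (a (X ω) (Y ω) / b (Y ω)) - Real.log (g ω ρ)) ≤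
      ∑ ω, ∑ ρ, (P (ω, ρ) * (A (X ω) (Y ω) (W ρ) / B (Y ω) (W ρ) *
      (b (Y ω) / a (X ω) (Y ω)) / g ω ρ) - P (ω, ρ)) := by
      refine sum_le_sum fun ω _ => sum_le_sum fun ρ _ => ?_
      rcases (hP (ω, ρ)).eq_or_lt with h | h
      · simp [← h]
      have hpω : 0 < p ω := by
        refine (hp ω).lt_of_ne fun h0 => h.ne ?_
        simp [hPdef, ← h0]
      have h1 : 0 < A (X ω) (Y ω) (W ρ) := h.trans_le (le_pr hP (by simp))
      have h2 : 0 < B (Y ω) (W ρ) := h.trans_le (le_pr hP (by simp))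
      have h3 : 0 < a (X ω) (Y ω) := hpω.trans_le (le_pr hp (by simp))
      have h4 : 0 < b (Y ω) := hpω.trans_le (le_pr hp (by simp))
      have h5 := hg ω ρ
      rw [← mul_sub_one]
      refine mul_le_mul_of_nonneg_left ?_ h.le
      refine le_trans (le_of_eq ?_) (Real.log_le_sub_one_of_pos (by positivity))
      rw [Real.log_div (by positivity) h5.ne', Real.log_mul (by positivity) (by positivity),
        Real.log_div h4.ne' h3.ne', Real.log_div h3.ne' h4.ne']
      ring
    refine this.trans ?_
    simp only [sum_sub_distrib]
    rw [hP1]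
    linarith
  have e1 : condEntropy p X Y =
      -∑ ω, ∑ ρ, P (ω, ρ) * Real.logb 2 (a (X ω) (Y ω) / b (Y ω)) := by
    rw [condEntropy, hsum]
  have e2 : condEntropy P (fun x => X x.1) (fun x => (Y x.1, W x.2)) =
      -∑ ω, ∑ ρ, P (ω, ρ) * Real.logb 2 (A (X ω) (Y ω) (W ρ) / B (Y ω) (W ρ)) := by
    rw [condEntropy, Fintype.sum_prod_type]
  have e3 : ∑ ω, p ω * ∑ ρ, K ω ρ * Real.logb 2 (g ω ρ) =
      ∑ ω, ∑ ρ, P (ω, ρ) * Real.logb 2 (g ω ρ) := by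
    refine sum_congr rfl fun ω _ => ?_
    rw [mul_sum]
    exact sum_congr rfl fun ρ _ => by simp only [hPdef]; ring
  rw [e1, e2, e3]
  have h2 : 0 < Real.log 2 := Real.log_pos one_lt_two
  have e4 : ∑ ω, ∑ ρ, P (ω, ρ) * (Real.log (A (X ω) (Y ω) (W ρ) / B (Y ω) (W ρ)) -
      Real.log (a (X ω) (Y ω) / b (Y ω)) - Real.log (g ω ρ)) = Real.log 2 *
      (∑ ω, ∑ ρ, P (ω, ρ) * Real.logb 2 (A (X ω) (Y ω) (W ρ) / B (Y ω) (W ρ)) -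
      ∑ ω, ∑ ρ, P (ω, ρ) * Real.logb 2 (a (X ω) (Y ω) / b (Y ω)) -
      ∑ ω, ∑ ρ, P (ω, ρ) * Real.logb 2 (g ω ρ)) := by
    simp only [← sum_sub_distrib, mul_sum, Real.logb]
    refine sum_congr rfl fun ω _ => sum_congr rfl fun ρ _ => ?_
    field_simp
  rw [e4] at hlog
  have := nonpos_of_mul_nonpos_right hlog h2
  linarith

end Entropy

/-! ### Counting over `𝔽₂` and random matrices -/

section Counting

variable {Ω Ω' ι : Type} [Fintype Ω] [Fintype Ω']

theorem pr_unif_univ (S : Set Ω) :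
    pr (unif Set.univ) S = (S.ncard : ℝ) / Fintype.card Ω := by
  classical
  rw [pr_eq_sum, ← sum_ite_mem_one, sum_div]
  refine sum_congr rfl fun ω _ => ?_
  rw [unif_univ]
  split_ifs <;> simp

/-- Translation by a preimage of `b - b'` carries the fibre over `b'` to the fibre over `b`, so all
fibres have the same mass. -/
theorem pr_unif_fiber {A B : Type} [AddCommGroup A] [AddCommGroup B] [Fintype A] [Fintype B]
    (f : A →+ B) (hf : Function.Surjective f) (b : B) :
    pr (unif Set.univ) {a | f a = b} = (Fintype.card B : ℝ)⁻¹ := by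
  have h1 : ∀ b', pr (unif Set.univ) {a | f a = b'} = pr (unif Set.univ) {a | f a = b} := by
    intro b'
    obtain ⟨a₀, ha⟩ := hf (b - b')
    rw [← pr_comp_equiv (Equiv.addRight a₀) (unif Set.univ) {a | f a = b}]
    congr 1
    ext a
    simp [ha, ← eq_sub_iff_add_eq]
  have h2 := sum_pr_fiber (unif (Set.univ : Set A)) f Set.univ
  have h3 : pr (unif (Set.univ : Set A)) Set.univ = 1 := by
    simpa [pr] using sum_unif (Set.univ_nonempty (α := A))
  simp only [Set.mem_univ, and_true, h1, h3, sum_const, card_univ, nsmul_eq_mul] at h2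
  exact eq_inv_of_mul_eq_one_right h2

theorem ncard_fiber_mul {A B : Type} [AddCommGroup A] [AddCommGroup B] [Fintype A] [Fintype B]
    (f : A →+ B) (hf : Function.Surjective f) (b : B) :
    {a | f a = b}.ncard * Fintype.card B = Fintype.card A := by
  have h := pr_unif_fiber f hf b
  rw [pr_unif_univ, div_eq_iff (by simp), inv_mul_eq_div, eq_div_iff (by simp)] at h
  exact_mod_cast h

theorem pr_exists_le {p : Ω → ℝ} (hp : ∀ ω, 0 ≤ p ω) (s : Finset ι) (E : ι → Set Ω) {κ : ℝ}
    (h : ∀ i ∈ s, pr p (E i) ≤ κ) : pr p {ω | ∃ i ∈ s, ω ∈ E i} ≤ s.card * κ := by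
  classical
  rw [← nsmul_eq_mul]
  refine le_trans ?_ (sum_le_card_nsmul s (fun i => pr p (E i)) κ h)
  simp only [pr_eq_sum]
  rw [sum_comm]
  refine sum_le_sum fun ω _ => ?_
  have h0 : ∀ i ∈ s, 0 ≤ (if ω ∈ E i then p ω else 0) := fun i _ => by
    split_ifs
    exacts [hp ω, le_rfl]
  split_ifs with h1
  · obtain ⟨i, hi, hω⟩ := h1
    refine le_trans ?_ (single_le_sum h0 hi)
    rw [if_pos hω]
  · exact sum_nonneg h0

theorem pr_union_le {p : Ω → ℝ} (hp : ∀ ω, 0 ≤ p ω) (A B : Set Ω) :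
    pr p (A ∪ B) ≤ pr p A + pr p B := by
  classical
  simp only [pr_eq_sum]
  rw [← sum_add_distrib]
  refine sum_le_sum fun ω _ => ?_
  have := hp ω
  by_cases h1 : ω ∈ A <;> by_cases h2 : ω ∈ B <;> simp [h1, h2, this]

theorem pr_prod (μ : Ω → ℝ) (ν : Ω' → ℝ) (A : Set Ω) (B : Set Ω') :
    pr (fun x : Ω × Ω' => μ x.1 * ν x.2) {x | x.1 ∈ A ∧ x.2 ∈ B} = pr μ A * pr ν B := by
  classical
  simp only [pr_eq_sum]
  rw [Fintype.sum_prod_type, sum_mul_sum]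
  refine sum_congr rfl fun a _ => sum_congr rfl fun b _ => ?_
  by_cases h1 : a ∈ A <;> by_cases h2 : b ∈ B <;> simp [h1, h2]

/-- Restricting to a set of uniform mass at least `1 - θ` raises the density by at most `(1 - θ)⁻¹`.
This transfers estimates from uniform matrices to uniform matrices of full rank. -/
theorem pr_unif_le {S : Set Ω} {θ : ℝ} (hθ : θ < 1) (hS : pr (unif Set.univ) Sᶜ ≤ θ)
    (B : Set Ω) : pr (unif S) B ≤ (1 - θ)⁻¹ * pr (unif Set.univ) B := by
  classical
  rcases isEmpty_or_nonempty Ω with hΩ | hΩ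
  · simp [pr]
  have h1 : 1 - θ ≤ (S.ncard : ℝ) / Fintype.card Ω := by
    rw [← pr_unif_univ]
    have := pr_add_pr_compl (unif (Set.univ : Set Ω)) S
    rw [sum_unif Set.univ_nonempty] at this
    linarith
  have hc : (0 : ℝ) < Fintype.card Ω := by positivity
  have hn : (0 : ℝ) < S.ncard := by
    by_contra h
    have : (S.ncard : ℝ) = 0 := le_antisymm (not_lt.1 h) (by positivity)
    rw [this] at h1
    simp at h1
    linarith
  simp only [pr_eq_sum]
  rw [mul_sum]
  refine sum_le_sum fun ω _ => ?_
  split_ifs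
  · rw [unif_univ]
    have h2 : (S.ncard : ℝ)⁻¹ ≤ (1 - θ)⁻¹ * (Fintype.card Ω : ℝ)⁻¹ := by
      rw [← mul_inv]
      refine inv_anti₀ (by nlinarith) ?_
      rwa [le_div_iff₀ hc] at h1
    by_cases h : ω ∈ S
    · rwa [unif_of_mem h]
    · rw [unif_of_notMem h]
      exact le_trans (by positivity) h2
  · simp

end Counting

/-! ### Linear systems and random matrices over 𝔽₂ -/

section Linear

variable {m n q k r : ℕ}

theorem card_vec (n : ℕ) : Fintype.card (Fin n → ZMod 2) = 2 ^ n := by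
  simp [ZMod.card]

/-- The map `M ↦ b M` for a row vector `b`. -/
def leftMulHom (n : ℕ) (b : Fin m → ZMod 2) : Mat m n →+ (Fin n → ZMod 2) where
  toFun M := b ᵥ* M
  map_zero' := vecMul_zero b
  map_add' M N := vecMul_add M N b

/-- The map `M ↦ M d` for a column vector `d`. -/
def rightMulHom (m : ℕ) (d : Fin n → ZMod 2) : Mat m n →+ (Fin m → ZMod 2) where
  toFun M := M *ᵥ d
  map_zero' := zero_mulVec d
  map_add' M N := add_mulVec M N d

/-- The map `M ↦ b M` is onto: if `b i ≠ 0`, the matrix whose only nonzero row is `w / b i`, in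
position `i`, is sent to `w`. -/
theorem pr_vecMul_eq {b : Fin m → ZMod 2} (hb : b ≠ 0) (w : Fin n → ZMod 2) :
    pr (unif Set.univ) {M : Mat m n | b ᵥ* M = w} = ((2 : ℝ) ^ n)⁻¹ := by
  obtain ⟨i, hi⟩ := Function.ne_iff.1 hb
  have := pr_unif_fiber (leftMulHom n b) (fun w => ⟨vecMulVec (Pi.single i (b i)⁻¹) w, by
    change b ᵥ* vecMulVec _ w = w
    rw [vecMul_vecMulVec]
    simp [mul_inv_cancel₀ hi]⟩) w
  simpa [card_vec, leftMulHom] using this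

theorem pr_mulVec_eq {d : Fin n → ZMod 2} (hd : d ≠ 0) (w : Fin m → ZMod 2) :
    pr (unif Set.univ) {M : Mat m n | M *ᵥ d = w} = ((2 : ℝ) ^ m)⁻¹ := by
  obtain ⟨i, hi⟩ := Function.ne_iff.1 hd
  have := pr_unif_fiber (rightMulHom m d) (fun w => ⟨vecMulVec w (Pi.single i (d i)⁻¹), by
    change vecMulVec w _ *ᵥ d = w
    rw [vecMulVec_mulVec]
    ext j
    simp [inv_mul_cancel₀ hi]⟩) w
  simpa [card_vec, rightMulHom] using this

theorem rank_eq_card_iff {ι : Type} [Fintype ι] (M : Matrix ι (Fin n) (ZMod 2)) :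
    M.rank = Fintype.card ι ↔ ∀ z, z ᵥ* M = 0 → z = 0 := by
  have h := M.vecMulLinear.finrank_range_add_finrank_ker
  rw [range_vecMulLinear, ← Set.finrank, ← show M.rank = Set.finrank _ _ from
    rank_eq_finrank_span_row M, Module.finrank_fintype_fun_eq_card] at h
  have h2 : (∀ z, z ᵥ* M = 0 → z = 0) ↔ LinearMap.ker M.vecMulLinear = ⊥ := by
    rw [LinearMap.ker_eq_bot']
    rfl
  rw [h2, ← Submodule.finrank_eq_zero]
  omega

/-- The Fredholm alternative: a `y` outside the range is separated from it by a functional, which is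
the dot product with a `z` satisfying `z M = 0`. -/
theorem exists_mulVec_eq {ι : Type} [Fintype ι] [DecidableEq ι] {κ : Type} [Fintype κ]
    [DecidableEq κ] (M : Matrix ι κ (ZMod 2)) (y : ι → ZMod 2)
    (h : ∀ z, z ᵥ* M = 0 → z ⬝ᵥ y = 0) : ∃ x, M *ᵥ x = y := by
  by_contra hy
  have hy' : y ∉ LinearMap.range M.mulVecLin := by simpa using hy
  obtain ⟨f, hf, hf'⟩ := Submodule.exists_dual_map_eq_bot_of_notMem hy' inferInstance
  have hfz : ∀ x, f x = (fun i => f (Pi.single i 1)) ⬝ᵥ x := by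
    intro x
    conv_lhs => rw [pi_eq_sum_univ' x, map_sum]
    refine sum_congr rfl fun i _ => ?_
    rw [map_smul, smul_eq_mul, mul_comm]
  refine hf ((hfz y).trans (h _ ?_))
  refine dotProduct_eq_zero _ fun w => ?_
  rw [← dotProduct_mulVec, ← hfz]
  have : f (M *ᵥ w) ∈ (LinearMap.range M.mulVecLin).map f :=
    Submodule.mem_map_of_mem ⟨w, rfl⟩
  rwa [hf'] at this

theorem mulVec_surjective_of_rank {ι : Type} [Fintype ι] [DecidableEq ι]
    {M : Matrix ι (Fin n) (ZMod 2)} (h : M.rank = Fintype.card ι) :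
    Function.Surjective fun x => M *ᵥ x := fun y =>
  exists_mulVec_eq M y fun z hz => by
    rw [(rank_eq_card_iff M).1 h z hz, zero_dotProduct]

theorem ncard_mulVec_eq {ι : Type} [Fintype ι] [DecidableEq ι]
    {M : Matrix ι (Fin n) (ZMod 2)} (h : M.rank = Fintype.card ι) (y : ι → ZMod 2) :
    {x | M *ᵥ x = y}.ncard * 2 ^ Fintype.card ι = 2 ^ n := by
  have := ncard_fiber_mul M.mulVecLin.toAddMonoidHom (mulVec_surjective_of_rank h) y
  simpa [card_vec, ZMod.card] using this

/-- A row dependency `a H₀ + b H₁ = 0` has `b ≠ 0`, because the rows of `H₀` are independent. Each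
of the `2^(q+m)` pairs `(a, b)` then occurs with probability at most `2^(-n)`. -/
theorem pr_rank_fromRows_compl {H₀ : Mat q n} (hH : H₀.rank = q) :
    pr (unif Set.univ) {H₁ : Mat m n | (fromRows H₀ H₁).rank = q + m}ᶜ ≤
      (2 : ℝ) ^ (q + m) * ((2 : ℝ) ^ n)⁻¹ := by
  classical
  have h1 := pr_exists_le (Ω := Mat m n) (p := unif Set.univ) (fun _ => unif_nonneg _ _)
    (univ : Finset ((Fin q → ZMod 2) × (Fin m → ZMod 2)))
    (fun ab => {H₁ : Mat m n | ab.2 ≠ 0 ∧ ab.2 ᵥ* H₁ = -(ab.1 ᵥ* H₀)}) (κ := ((2 : ℝ) ^ n)⁻¹)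
    (fun ab _ => by
      by_cases hb : ab.2 = 0
      · simp [hb, pr]
      · simp only [ne_eq, hb, not_false_eq_true, true_and]
        exact (pr_vecMul_eq hb _).le)
  rw [card_univ, Fintype.card_prod, card_vec, card_vec, ← pow_add] at h1
  push_cast at h1
  refine (pr_mono (fun _ => unif_nonneg _ _) ?_).trans h1
  intro H₁ hH₁
  by_contra hcon
  refine hH₁ ?_
  have h2 := (rank_eq_card_iff (fromRows H₀ H₁)).2 fun z hz => ?_
  · simpa using h2
  rw [vecMul_fromRows] at hz
  have hb : z ∘ Sum.inr = 0 := by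
    by_contra hb
    exact hcon ⟨(z ∘ Sum.inl, z ∘ Sum.inr), mem_univ _, hb, (neg_eq_of_add_eq_zero_right hz).symm⟩
  rw [hb, zero_vecMul, add_zero] at hz
  have ha := (rank_eq_card_iff H₀).1 (by simpa using hH) _ hz
  ext i
  rcases i with i | i
  · exact congrFun ha i
  · exact congrFun hb i

theorem nonempty_rank_fromRows {H₀ : Mat q n} (hH : H₀.rank = q) (hqm : q + m < n) :
    {H₁ : Mat m n | (fromRows H₀ H₁).rank = q + m}.Nonempty := by
  by_contra hne
  have h1 := pr_rank_fromRows_compl (m := m) hH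
  have h2 : pr (unif (Set.univ : Set (Mat m n))) Set.univ = 1 := by
    simpa [pr] using sum_unif (Set.univ_nonempty (α := Mat m n))
  rw [Set.not_nonempty_iff_eq_empty.1 hne, Set.compl_empty, h2, ← div_eq_mul_inv,
    one_le_div (by positivity)] at h1
  exact absurd h1 (not_le.2 (pow_lt_pow_right₀ one_lt_two hqm))

theorem pr_rank_compl (k r : ℕ) :
    pr (unif Set.univ) {M : Mat k r | M.rank = k}ᶜ ≤ (2 : ℝ) ^ k * ((2 : ℝ) ^ r)⁻¹ := by
  -- An empty block `H₀` imposes nothing, so this is the rank estimate for a single matrix.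
  have h := pr_rank_fromRows_compl (q := 0) (m := k) (n := r) (H₀ := 0) (by simp)
  rw [zero_add] at h
  convert h using 5 with M
  have h1 := rank_eq_card_iff (fromRows (0 : Mat 0 r) M)
  have h2 := rank_eq_card_iff M
  simp only [Fintype.card_sum, Fintype.card_fin, zero_add] at h1 h2
  rw [h1, h2]
  constructor
  · intro h z hz
    rw [vecMul_fromRows, vecMul_zero, zero_add] at hz
    ext i
    rcases i with i | i
    · exact i.elim0
    · exact congrFun (h _ hz) i
  · intro h z hz
    have := h (Sum.elim 0 z) (by rw [sumElim_vecMul_fromRows]; simpa using hz)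
    ext i
    exact congrFun this (Sum.inr i)

end Linear

/-! ### Compressed secrets that a linear observation does not determine -/

section Decouple

variable {m k r : ℕ}

/-- Every value of `A s` is compatible with `B t = 0` and `U s + V t = 0`. -/
def Decouples (A B : Mat k r) (U V : Mat r r) : Prop :=
  ∀ σ : Fin k → ZMod 2, ∃ s t : Fin r → ZMod 2, A *ᵥ s = σ ∧ B *ᵥ t = 0 ∧ U *ᵥ s + V *ᵥ t = 0

theorem Decouples.exists_mul_eq {A B : Mat k r} {U V : Mat r r} (h : Decouples A B U V)
    (σ : Mat k m) : ∃ s t : Mat r m, A * s = σ ∧ B * t = 0 ∧ U * s + V * t = 0 := by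
  choose s t h1 h2 h3 using fun j => h fun i => σ i j
  refine ⟨of fun i j => s j i, of fun i j => t j i, ?_, ?_, ?_⟩ <;> ext i j
  · exact congrFun (h1 j) i
  · exact congrFun (h2 j) i
  · exact congrFun (h3 j) i

/-- Decoupling is the solvability of a block system in `(s, t)` with rows `(A, 0)`, `(0, B)`, `(U,
V)` and right-hand side `(σ, 0, 0)`. A row dependency can obstruct it only through its part `a`
against `σ`, so if all dependencies have `a = 0` every `σ` is attained. -/
theorem exists_of_not_decouples {A B : Mat k r} {U V : Mat r r} (h : ¬ Decouples A B U V) :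
    ∃ a : Fin k → ZMod 2, a ≠ 0 ∧ ∃ (b : Fin k → ZMod 2) (c : Fin r → ZMod 2),
      a ᵥ* A = c ᵥ* U ∧ b ᵥ* B = c ᵥ* V := by
  contrapose! h
  intro σ
  obtain ⟨x, hx⟩ := exists_mulVec_eq
    (fromRows (fromCols A 0) (fromRows (fromCols 0 B) (fromCols U V)))
    (Sum.elim σ (Sum.elim 0 0)) (by
      intro z hz
      rw [vecMul_fromRows, vecMul_fromRows, vecMul_fromCols, vecMul_fromCols, vecMul_fromCols,
        vecMul_zero, vecMul_zero] at hz
      have e1 : (z ∘ Sum.inl) ᵥ* A = (-((z ∘ Sum.inr) ∘ Sum.inr)) ᵥ* U := by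
        rw [neg_vecMul, eq_neg_iff_add_eq_zero]
        ext i
        simpa using congrFun hz (Sum.inl i)
      have e2 : ((z ∘ Sum.inr) ∘ Sum.inl) ᵥ* B = (-((z ∘ Sum.inr) ∘ Sum.inr)) ᵥ* V := by
        rw [neg_vecMul, eq_neg_iff_add_eq_zero]
        ext i
        simpa using congrFun hz (Sum.inr i)
      have h0 : z ∘ Sum.inl = 0 := by
        by_contra h0
        exact h _ h0 _ _ e1 e2
      simp only [dotProduct, Fintype.sum_sum_type, Sum.elim_inl, Sum.elim_inr, Pi.zero_apply,
        mul_zero, sum_const_zero, add_zero]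
      exact sum_eq_zero fun i _ => by rw [show z (Sum.inl i) = 0 from congrFun h0 i, zero_mul])
  rw [fromRows_mulVec, fromRows_mulVec, fromCols_mulVec, fromCols_mulVec, fromCols_mulVec] at hx
  refine ⟨x ∘ Sum.inl, x ∘ Sum.inr, ?_, ?_, ?_⟩ <;> ext i
  · simpa using congrFun hx (Sum.inl i)
  · simpa using congrFun hx (Sum.inr (Sum.inl i))
  · simpa using congrFun hx (Sum.inr (Sum.inr i))

theorem card_image_vecMul (U : Mat r r) :
    #(univ.image fun c : Fin r → ZMod 2 => c ᵥ* U) = 2 ^ U.rank := by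
  classical
  have h1 : U.rank = Module.finrank (ZMod 2) (LinearMap.range U.vecMulLinear) := by
    rw [range_vecMulLinear]
    exact rank_eq_finrank_span_row U
  have h2 := Module.card_eq_pow_finrank (K := ZMod 2) (V := LinearMap.range U.vecMulLinear)
  rw [ZMod.card] at h2
  rw [h1, ← h2]
  have : (LinearMap.range U.vecMulLinear : Set (Fin r → ZMod 2)).toFinset =
      univ.image fun c : Fin r → ZMod 2 => c ᵥ* U := by
    ext w; simp
  rw [← this, Set.toFinset_card]
  exact Fintype.card_congr (Equiv.refl _)

theorem card_ker_vecMul (V : Mat r r) :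
    #{c : Fin r → ZMod 2 | c ᵥ* V = 0} * 2 ^ V.rank = 2 ^ r := by
  classical
  have h1 : V.rank = Module.finrank (ZMod 2) (LinearMap.range V.vecMulLinear) := by
    rw [range_vecMulLinear]
    exact rank_eq_finrank_span_row V
  have h2 := Module.card_eq_pow_finrank (K := ZMod 2) (V := LinearMap.ker V.vecMulLinear)
  have h3 := V.vecMulLinear.finrank_range_add_finrank_ker
  have h4 : #{c : Fin r → ZMod 2 | c ᵥ* V = 0} = Fintype.card (LinearMap.ker V.vecMulLinear) := by
    rw [Fintype.card_subtype]
    simp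
  rw [h4, h2, h1, ZMod.card, ← pow_add, add_comm, h3, Module.finrank_fintype_fun_eq_card,
    Fintype.card_fin]

theorem card_mat (a b : ℕ) : Fintype.card (Mat a b) = 2 ^ (a * b) := by
  rw [Fintype.card_congr (of (m := Fin a) (n := Fin b) (α := ZMod 2)).symm]
  simp [ZMod.card, pow_mul']

variable {μ : Mat k r → ℝ} {κ : ℝ}

/-- Only the relation `a A = c U` is used. The union runs over pairs `(a, c U)` rather than `(a,
c)`, whence the factor `2 ^ U.rank`. -/
theorem pr_not_decouples_le_of_left (hμ : ∀ M, 0 ≤ μ M) (hμ1 : ∑ M, μ M = 1) (hκ : 0 ≤ κ)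
    (h : ∀ a ≠ 0, ∀ w, pr μ {M | a ᵥ* M = w} ≤ κ) (U V : Mat r r) :
    pr (fun x : Mat k r × Mat k r => μ x.1 * μ x.2) {x | ¬ Decouples x.1 x.2 U V} ≤
      2 ^ k * 2 ^ U.rank * κ := by
  classical
  have hp : ∀ x : Mat k r × Mat k r, 0 ≤ μ x.1 * μ x.2 := fun x => mul_nonneg (hμ _) (hμ _)
  have h1 := pr_exists_le hp ((univ : Finset (Fin k → ZMod 2)) ×ˢ
    (univ.image fun c : Fin r → ZMod 2 => c ᵥ* U))
    (fun i => {x | x.1 ∈ {M | i.1 ≠ 0 ∧ i.1 ᵥ* M = i.2} ∧ x.2 ∈ Set.univ}) (κ := κ) (by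
      intro i _
      rw [pr_prod]
      have h2 : pr μ Set.univ = 1 := by simpa [pr] using hμ1
      rw [h2, mul_one]
      by_cases hi : i.1 = 0
      · simpa [hi, pr] using hκ
      · simpa [hi] using h _ hi i.2)
  rw [card_product, card_image_vecMul, card_univ, card_vec] at h1
  push_cast at h1
  refine (pr_mono hp ?_).trans h1
  intro x hx
  obtain ⟨a, ha, b, c, h1, -⟩ := exists_of_not_decouples hx
  exact ⟨(a, c ᵥ* U), by simp, ⟨ha, h1⟩, Set.mem_univ _⟩

/-- If `b = 0`, then `c V = 0` and there are `2^(r - rank V)` choices of `c`; if `b ≠ 0`, both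
relations must hold, and the independence of `A` and `B` gives `κ * κ`. -/
theorem pr_not_decouples_le_of_right (hμ : ∀ M, 0 ≤ μ M) (hμ1 : ∑ M, μ M = 1) (hκ : 0 ≤ κ)
    (h : ∀ a ≠ 0, ∀ w, pr μ {M | a ᵥ* M = w} ≤ κ) (U V : Mat r r) :
    pr (fun x : Mat k r × Mat k r => μ x.1 * μ x.2) {x | ¬ Decouples x.1 x.2 U V} ≤
      2 ^ k * (2 ^ r / 2 ^ V.rank) * κ + 2 ^ k * 2 ^ k * 2 ^ r * (κ * κ) := by
  classical
  have hp : ∀ x : Mat k r × Mat k r, 0 ≤ μ x.1 * μ x.2 := fun x => mul_nonneg (hμ _) (hμ _)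
  have h1 := pr_exists_le hp ((univ : Finset (Fin k → ZMod 2)) ×ˢ
    ({c : Fin r → ZMod 2 | c ᵥ* V = 0} : Finset _))
    (fun i => {x | x.1 ∈ {M | i.1 ≠ 0 ∧ i.1 ᵥ* M = i.2 ᵥ* U} ∧ x.2 ∈ Set.univ}) (κ := κ) (by
      intro i _
      rw [pr_prod]
      have h2 : pr μ Set.univ = 1 := by simpa [pr] using hμ1
      rw [h2, mul_one]
      by_cases hi : i.1 = 0
      · simpa [hi, pr] using hκ
      · simpa [hi] using h _ hi (i.2 ᵥ* U))
  have h2 := pr_exists_le hp (univ : Finset (((Fin k → ZMod 2) × (Fin k → ZMod 2)) ×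
    (Fin r → ZMod 2)))
    (fun i => {x | x.1 ∈ {M | i.1.1 ≠ 0 ∧ i.1.1 ᵥ* M = i.2 ᵥ* U} ∧
      x.2 ∈ {M | i.1.2 ≠ 0 ∧ i.1.2 ᵥ* M = i.2 ᵥ* V}}) (κ := κ * κ) (by
      intro i _
      rw [pr_prod]
      refine mul_le_mul ?_ ?_ (pr_nonneg hμ _) hκ
      · by_cases hi : i.1.1 = 0
        · simpa [hi, pr] using hκ
        · simpa [hi] using h _ hi (i.2 ᵥ* U)
      · by_cases hi : i.1.2 = 0
        · simpa [hi, pr] using hκ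
        · simpa [hi] using h _ hi (i.2 ᵥ* V))
  have h3 : (#{c : Fin r → ZMod 2 | c ᵥ* V = 0} : ℝ) = 2 ^ r / 2 ^ V.rank := by
    rw [eq_div_iff (by positivity)]
    exact_mod_cast card_ker_vecMul V
  rw [card_product, card_univ, card_vec] at h1
  rw [card_univ, Fintype.card_prod, Fintype.card_prod, card_vec, card_vec] at h2
  push_cast [h3] at h1 h2
  refine (pr_mono hp ?_).trans ((pr_union_le hp _ _).trans (add_le_add h1 h2))
  intro x hx
  obtain ⟨a, ha, b, c, e1, e2⟩ := exists_of_not_decouples hx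
  by_cases hb : b = 0
  · left
    rw [hb, zero_vecMul] at e2
    exact ⟨(a, c), by simp [← e2], ⟨ha, e1⟩, Set.mem_univ _⟩
  · right
    exact ⟨((a, b), c), mem_univ _, ⟨ha, e1⟩, ⟨hb, e2⟩⟩

theorem nonempty_of_univ_or_rank (hkr : k ≤ r) {𝓜 : Set (Mat k r)}
    (h𝓜 : 𝓜 = Set.univ ∨ 𝓜 = {M | M.rank = k}) : 𝓜.Nonempty := by
  rcases h𝓜 with rfl | rfl
  · exact Set.univ_nonempty
  · refine ⟨of fun i j => if (j : ℕ) = i then 1 else 0, ?_⟩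
    have := (rank_eq_card_iff (of fun (i : Fin k) (j : Fin r) =>
      if (j : ℕ) = i then (1 : ZMod 2) else 0)).2 fun z hz => by
        ext i
        have := congrFun hz ⟨i, i.2.trans_le hkr⟩
        simpa [vecMul, dotProduct, Fin.val_inj] using this
    simpa using this

/-- A uniform `k × r` matrix with `k < r` is rank deficient with probability at most `1/2`, so
conditioning on full rank at most doubles `2^(-r)`. -/
theorem pr_unif_vecMul_le (hkr : k < r) {𝓜 : Set (Mat k r)}
    (h𝓜 : 𝓜 = Set.univ ∨ 𝓜 = {M | M.rank = k}) (a : Fin k → ZMod 2) (ha : a ≠ 0)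
    (w : Fin r → ZMod 2) : pr (unif 𝓜) {M | a ᵥ* M = w} ≤ 2 * ((2 : ℝ) ^ r)⁻¹ := by
  have h0 : (2 : ℝ) ^ k * ((2 : ℝ) ^ r)⁻¹ ≤ 1 / 2 := by
    rw [← div_eq_mul_inv, div_le_div_iff₀ (by positivity) (by positivity), one_mul, ← pow_succ]
    exact pow_le_pow_right₀ one_le_two hkr
  have h1 : pr (unif Set.univ) 𝓜ᶜ ≤ 1 / 2 := by
    rcases h𝓜 with rfl | rfl
    · simp [pr]
    · exact (pr_rank_compl k r).trans h0
  have h2 := pr_unif_le (by norm_num) h1 {M | a ᵥ* M = w}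
  rw [pr_vecMul_eq ha] at h2
  norm_num at h2 ⊢
  exact h2

/-- With `κ = 2 · 2^(-r)`, the exponents `k + rank U - r`, or `k - rank V` and `2k - r`, are all at
most `-rδ` since `k = r/2 - rδ`. The constant is `6 = 2 + 4` from the two terms of the second case.
-/
theorem pr_not_decouples_le {δ : ℝ} (hδ : 0 < δ) (hk : (k : ℝ) = r * (1 / 2 - δ)) (hr : 0 < r)
    {𝓜 : Set (Mat k r)} (h𝓜 : 𝓜 = Set.univ ∨ 𝓜 = {M | M.rank = k}) (U V : Mat r r)
    (hUV : (U.rank : ℝ) ≤ r / 2 ∨ (r : ℝ) / 2 < V.rank) :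
    pr (fun x : Mat k r × Mat k r => unif 𝓜 x.1 * unif 𝓜 x.2) {x | ¬ Decouples x.1 x.2 U V} ≤
      6 * (2 : ℝ) ^ (-(r * δ)) := by
  have hr' : (0 : ℝ) < r := by exact_mod_cast hr
  have hkr : k < r := by
    have : (k : ℝ) < r := by nlinarith
    exact_mod_cast this
  have h2 : (0 : ℝ) < 2 := two_pos
  have hrd : 0 < r * δ := by positivity
  have hκ := pr_unif_vecMul_le hkr h𝓜
  have hμ1 := sum_unif (nonempty_of_univ_or_rank hkr.le h𝓜)
  rcases hUV with h | h
  · refine (pr_not_decouples_le_of_left (unif_nonneg 𝓜) hμ1 (by positivity) hκ U V).trans ?_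
    have : (2 : ℝ) ^ k * 2 ^ U.rank * (2 * (2 ^ r)⁻¹) = 2 * (2 : ℝ) ^ ((k : ℝ) + U.rank - r) := by
      rw [Real.rpow_sub h2, Real.rpow_add h2]
      simp only [Real.rpow_natCast]
      field_simp
    rw [this]
    have : (2 : ℝ) ^ ((k : ℝ) + U.rank - r) ≤ (2 : ℝ) ^ (-(r * δ)) :=
      Real.rpow_le_rpow_of_exponent_le one_le_two (by rw [hk]; linarith)
    have h3 : (0 : ℝ) < (2 : ℝ) ^ (-(r * δ)) := by positivity
    linarith
  · refine (pr_not_decouples_le_of_right (unif_nonneg 𝓜) hμ1 (by positivity) hκ U V).trans ?_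
    have e1 : (2 : ℝ) ^ k * (2 ^ r / 2 ^ V.rank) * (2 * (2 ^ r)⁻¹) =
        2 * (2 : ℝ) ^ ((k : ℝ) - V.rank) := by
      rw [Real.rpow_sub h2]
      simp only [Real.rpow_natCast]
      field_simp
    have e2 : (2 : ℝ) ^ k * 2 ^ k * 2 ^ r * (2 * (2 ^ r)⁻¹ * (2 * (2 ^ r)⁻¹)) =
        4 * (2 : ℝ) ^ ((k : ℝ) + k - r) := by
      rw [Real.rpow_sub h2, Real.rpow_add h2]
      simp only [Real.rpow_natCast]
      field_simp
      norm_num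
    rw [e1, e2]
    have h3 : (2 : ℝ) ^ ((k : ℝ) - V.rank) ≤ (2 : ℝ) ^ (-(r * δ)) :=
      Real.rpow_le_rpow_of_exponent_le one_le_two (by rw [hk]; linarith)
    have h4 : (2 : ℝ) ^ ((k : ℝ) + k - r) ≤ (2 : ℝ) ^ (-(r * δ)) :=
      Real.rpow_le_rpow_of_exponent_le one_le_two (by rw [hk]; linarith)
    linarith

/-- For `(A, B)` in `G` the symmetries `e` fix the law and the observation and move `X` by any `τ`,
so all `2^(k m)` values of `X` are equally likely given `Y`. -/
theorem mul_pr_le_condEntropy_of_translations {Z β : Type} [Fintype Z] {pZ : Z → ℝ}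
    (hμ : ∀ M, 0 ≤ μ M) (hZ : ∀ z, 0 ≤ pZ z) (hZ1 : ∑ z, pZ z = 1)
    (X : Mat k r → Mat k r → Z → Mat k m) (Y : Mat k r → Mat k r → Z → β)
    (hY : ∀ A B z A' B' z', Y A' B' z' = Y A B z → A' = A ∧ B' = B)
    (G : Set (Mat k r × Mat k r))
    (hG : ∀ A B, (A, B) ∈ G → ∀ τ, ∃ e : Z ≃ Z, ∀ z, pZ (e z) = pZ z ∧
      X A B (e z) = X A B z + τ ∧ Y A B (e z) = Y A B z) :
    k * m * pr (fun x : Mat k r × Mat k r => μ x.1 * μ x.2) G ≤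
      condEntropy (fun ω : Mat k r × Mat k r × Z => μ ω.1 * μ ω.2.1 * pZ ω.2.2)
        (fun ω => X ω.1 ω.2.1 ω.2.2) (fun ω => Y ω.1 ω.2.1 ω.2.2) := by
  classical
  have hp : ∀ ω : Mat k r × Mat k r × Z, 0 ≤ μ ω.1 * μ ω.2.1 * pZ ω.2.2 :=
    fun ω => mul_nonneg (mul_nonneg (hμ _) (hμ _)) (hZ _)
  have h1 := mul_pr_le_condEntropy hp (fun ω => X ω.1 ω.2.1 ω.2.2) (fun ω => Y ω.1 ω.2.1 ω.2.2)
    {ω | (ω.1, ω.2.1) ∈ G} (k * m) (by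
      rintro ⟨A, B, z⟩ hAB
      have hshift : ∀ τ, pr (fun ω : Mat k r × Mat k r × Z => μ ω.1 * μ ω.2.1 * pZ ω.2.2)
          {ω | X ω.1 ω.2.1 ω.2.2 = X A B z + τ ∧ Y ω.1 ω.2.1 ω.2.2 = Y A B z} =
          pr (fun ω : Mat k r × Mat k r × Z => μ ω.1 * μ ω.2.1 * pZ ω.2.2)
          {ω | X ω.1 ω.2.1 ω.2.2 = X A B z ∧ Y ω.1 ω.2.1 ω.2.2 = Y A B z} := by
        intro τ
        obtain ⟨e, he⟩ := hG A B hAB τ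
        -- Since `Y` determines the matrices, the symmetry is applied over the single pair `(A, B)`
        -- and extended by the identity.
        rw [← pr_comp_equiv (Equiv.prodCongrRight fun A' => Equiv.prodCongrRight fun B' =>
          if A' = A ∧ B' = B then e else Equiv.refl Z)]
        have hE : ∀ A' B' z', μ A' * μ B' * pZ ((if A' = A ∧ B' = B then e else Equiv.refl Z) z') =
            μ A' * μ B' * pZ z' := by
          intro A' B' z'
          split_ifs
          · rw [(he z').1]
          · rfl
        have hEY : ∀ A' B' z', Y A' B' ((if A' = A ∧ B' = B then e else Equiv.refl Z) z') =
            Y A' B' z' := by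
          intro A' B' z'
          split_ifs with h
          · rw [h.1, h.2, (he z').2.2]
          · rfl
        congr 1
        · ext ⟨A', B', z'⟩
          exact hE A' B' z'
        · ext ⟨A', B', z'⟩
          simp only [Set.mem_preimage, Set.mem_ofPred_eq, Equiv.prodCongrRight_apply, hEY]
          refine and_congr_left fun h => ?_
          obtain ⟨rfl, rfl⟩ := hY _ _ _ _ _ _ h
          simp only [and_self, if_true]
          rw [(he z').2.1, add_left_inj]
      have hsum := sum_pr_fiber (fun ω : Mat k r × Mat k r × Z => μ ω.1 * μ ω.2.1 * pZ ω.2.2)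
        (fun ω => X ω.1 ω.2.1 ω.2.2) {ω | Y ω.1 ω.2.1 ω.2.2 = Y A B z}
      rw [← Equiv.sum_comp (Equiv.addLeft (X A B z))] at hsum
      simp only [Equiv.coe_addLeft, Set.mem_ofPred_eq, hshift, sum_const, card_univ,
        nsmul_eq_mul] at hsum
      have hc : (Fintype.card (Mat k m) : ℝ) = 2 ^ (k * m) := by
        exact_mod_cast card_mat k m
      rw [hc] at hsum
      exact hsum.le)
  have h2 : pr (fun ω : Mat k r × Mat k r × Z => μ ω.1 * μ ω.2.1 * pZ ω.2.2)
      {ω | (ω.1, ω.2.1) ∈ G} = pr (fun x : Mat k r × Mat k r => μ x.1 * μ x.2) G := by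
    simp only [pr_eq_sum, Fintype.sum_prod_type]
    refine sum_congr rfl fun A _ => sum_congr rfl fun B _ => ?_
    by_cases h : (A, B) ∈ G
    · simp [h, ← mul_sum, hZ1]
    · simp [h]
  rw [h2] at h1
  exact_mod_cast h1

end Decouple

/-! ### The entropy of the compressed secrets before the string transfers -/

section Ideal

variable {m n k r : ℕ}

/-- The probability, up to the factor `r`, that compression fails. -/
noncomputable def compressionLoss (r : ℕ) (δ : ℝ) : ℝ := 6 * r * (2 : ℝ) ^ (-(r * δ))

/-- Half of the exponential decay absorbs the linear factor. -/
theorem add_one_mul_exp_le {c : ℝ} (hc : 0 < c) (k : ℕ) :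
    (k + 1) * Real.exp (-(c * k)) ≤ (2 / c + 1) * Real.exp (-(c / 2 * k)) := by
  have h1 : Real.exp (-(c * k)) = Real.exp (-(c / 2 * k)) * Real.exp (-(c / 2 * k)) := by
    rw [← Real.exp_add]
    congr 1
    ring
  have h2 : ((k : ℝ) + 1) * Real.exp (-(c / 2 * k)) ≤ 2 / c + 1 := by
    rw [Real.exp_neg, ← div_eq_mul_inv, div_le_iff₀ (Real.exp_pos _)]
    have h3 := Real.add_one_le_exp (c / 2 * k)
    have h4 : (2 / c + 1) * (c / 2 * k + 1) = (k + 1) + (2 / c + c / 2 * k) := by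
      field_simp
      ring
    have h5 : 0 ≤ 2 / c + c / 2 * k := by positivity
    have h6 : (0 : ℝ) ≤ 2 / c + 1 := by positivity
    nlinarith
  rw [h1, ← mul_assoc]
  exact mul_le_mul_of_nonneg_right h2 (Real.exp_pos _).le

theorem expSmall_compressionLoss {δ : ℝ} (hδ : 0 < δ) :
    ExpSmall fun r => compressionLoss r δ := by
  have hc : 0 < Real.log 2 * δ := mul_pos (Real.log_pos one_lt_two) hδ
  refine ⟨6 * (2 / (Real.log 2 * δ) + 1), Real.log 2 * δ / 2, by positivity, by positivity,
    fun r => ?_⟩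
  change |compressionLoss r δ| ≤ _
  rw [compressionLoss, abs_of_nonneg (by positivity), Real.rpow_def_of_pos two_pos, mul_assoc,
    mul_assoc, show Real.log 2 * -(r * δ) = -(Real.log 2 * δ * r) by ring]
  refine mul_le_mul_of_nonneg_left (le_trans ?_ (add_one_mul_exp_le hc r)) (by norm_num)
  gcongr
  linarith

theorem le_mul_pr_decouples {δ : ℝ} (hδ : 0 < δ) (hk : (k : ℝ) = r * (1 / 2 - δ)) (m : ℕ)
    {𝓜 : Set (Mat k r)} (h𝓜 : 𝓜 = Set.univ ∨ 𝓜 = {M | M.rank = k}) (U V : Mat r r)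
    (hUV : (U.rank : ℝ) ≤ r / 2 ∨ (r : ℝ) / 2 < V.rank) :
    r * m * (1 / 2 - δ) - m * compressionLoss r δ ≤
      k * m * pr (fun x : Mat k r × Mat k r => unif 𝓜 x.1 * unif 𝓜 x.2)
        {x | Decouples x.1 x.2 U V} := by
  rcases Nat.eq_zero_or_pos r with rfl | hr
  · have : (k : ℝ) = 0 := by simpa using hk
    simp [this, compressionLoss]
  have hr' : (0 : ℝ) < r := by exact_mod_cast hr
  have hkr : (k : ℝ) ≤ r := by nlinarith
  have h1 := pr_not_decouples_le hδ hk hr h𝓜 U V hUV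
  have h2 := pr_add_pr_compl (fun x : Mat k r × Mat k r => unif 𝓜 x.1 * unif 𝓜 x.2)
    {x | Decouples x.1 x.2 U V}
  rw [Fintype.sum_prod_type] at h2
  simp only [← mul_sum, sum_unif (nonempty_of_univ_or_rank (Nat.cast_le.1 hkr) h𝓜), mul_one] at h2
  have h3 : 1 - 6 * (2 : ℝ) ^ (-(r * δ)) ≤
      pr (fun x : Mat k r × Mat k r => unif 𝓜 x.1 * unif 𝓜 x.2) {x | Decouples x.1 x.2 U V} := by
    have : {x : Mat k r × Mat k r | Decouples x.1 x.2 U V}ᶜ = {x | ¬ Decouples x.1 x.2 U V} := rfl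
    rw [this] at h2
    linarith
  calc r * m * (1 / 2 - δ) - m * compressionLoss r δ
      = k * m - r * (m * (6 * (2 : ℝ) ^ (-(r * δ)))) := by
        rw [hk, compressionLoss]; ring
    -- The loss is stated with `r`, which dominates `k`, so that it depends on `r` and `δ` only.
    _ ≤ k * m - k * (m * (6 * (2 : ℝ) ^ (-(r * δ)))) := by gcongr
    _ = k * m * (1 - 6 * (2 : ℝ) ^ (-(r * δ))) := by ring
    _ ≤ _ := by gcongr

theorem pr_prod_swap {Ω : Type} [Fintype Ω] (μ : Ω → ℝ) (P : Ω → Ω → Prop) :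
    pr (fun x : Ω × Ω => μ x.1 * μ x.2) {x | P x.2 x.1} =
      pr (fun x : Ω × Ω => μ x.1 * μ x.2) {x | P x.1 x.2} := by
  rw [← pr_comp_equiv (Equiv.prodComm Ω Ω)]
  congr 1
  ext x
  exact mul_comm _ _

/-- The hidden secret is now `M_t t`, and `V` is the matrix in front of `t`. Hence `V` takes the
first place in `Decouples`, and the hypothesis is the low-rank alternative. -/
theorem condEntropy_ideal_left {δ : ℝ} (hδ : 0 < δ) (hk : (k : ℝ) = r * (1 / 2 - δ)) (m : ℕ)
    {𝓜 : Set (Mat k r)} (h𝓜 : 𝓜 = Set.univ ∨ 𝓜 = {M | M.rank = k}) (U V : Mat r r)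
    (hV : (V.rank : ℝ) ≤ r / 2) :
    r * m * (1 / 2 - δ) - m * compressionLoss r δ ≤ condEntropy (idealProb (m := m) 𝓜)
      (fun ω => ω.2.1 * ω.2.2.2) (fun ω => (ω.1 * ω.2.2.1, idealView U V ω)) := by
  refine (le_mul_pr_decouples hδ hk m h𝓜 V U (.inl hV)).trans ?_
  rw [← pr_prod_swap (unif 𝓜) fun A B => Decouples A B V U]
  refine (mul_pr_le_condEntropy_of_translations (unif_nonneg 𝓜)
    (pZ := fun z : Mat r m × Mat r m => unif Set.univ z.1 * unif Set.univ z.2)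
    (fun z => mul_nonneg (unif_nonneg _ _) (unif_nonneg _ _)) ?_
    (fun _ B z => B * z.2) (fun A B z => (A * z.1, idealView U V (A, B, z))) ?_ _ ?_).trans
    (le_of_eq ?_)
  · rw [Fintype.sum_prod_type]
    simp only [← mul_sum, sum_unif Set.univ_nonempty, mul_one]
  · intro A B z A' B' z' h
    simp only [idealView, Prod.mk.injEq] at h
    exact h.2.2
  · intro A B hAB τ
    obtain ⟨t, s, h1, h2, h3⟩ := Decouples.exists_mul_eq hAB τ
    refine ⟨Equiv.addRight (s, t), fun z => ⟨by simp [unif_univ], ?_, ?_⟩⟩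
    · simp [Matrix.mul_add, h1]
    · simp only [idealView, Equiv.coe_addRight, Prod.fst_add, Prod.snd_add, Matrix.mul_add, h2,
        add_zero]
      rw [add_add_add_comm, add_comm (U * s), h3, add_zero]
  · congr 1
    ext ω
    simp only [idealProb]
    ring

theorem condEntropy_ideal_right {δ : ℝ} (hδ : 0 < δ) (hk : (k : ℝ) = r * (1 / 2 - δ)) (m : ℕ)
    {𝓜 : Set (Mat k r)} (h𝓜 : 𝓜 = Set.univ ∨ 𝓜 = {M | M.rank = k}) (U V : Mat r r)
    (hV : (r : ℝ) / 2 < V.rank) :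
    r * m * (1 / 2 - δ) - m * compressionLoss r δ ≤ condEntropy (idealProb (m := m) 𝓜)
      (fun ω => ω.1 * ω.2.2.1) (fun ω => (ω.2.1 * ω.2.2.2, idealView U V ω)) := by
  refine (le_mul_pr_decouples hδ hk m h𝓜 U V (.inr hV)).trans ?_
  refine (mul_pr_le_condEntropy_of_translations (unif_nonneg 𝓜)
    (pZ := fun z : Mat r m × Mat r m => unif Set.univ z.1 * unif Set.univ z.2)
    (fun z => mul_nonneg (unif_nonneg _ _) (unif_nonneg _ _)) ?_
    (fun A _ z => A * z.1) (fun A B z => (B * z.2, idealView U V (A, B, z))) ?_ _ ?_).trans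
    (le_of_eq ?_)
  · rw [Fintype.sum_prod_type]
    simp only [← mul_sum, sum_unif Set.univ_nonempty, mul_one]
  · intro A B z A' B' z' h
    simp only [idealView, Prod.mk.injEq] at h
    exact h.2.2
  · intro A B hAB τ
    obtain ⟨s, t, h1, h2, h3⟩ := Decouples.exists_mul_eq hAB τ
    refine ⟨Equiv.addRight (s, t), fun z => ⟨by simp [unif_univ], ?_, ?_⟩⟩
    · simp [Matrix.mul_add, h1]
    · simp only [idealView, Equiv.coe_addRight, Prod.fst_add, Prod.snd_add, Matrix.mul_add, h2,
        add_zero]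
      rw [add_add_add_comm, h3, add_zero]
  · congr 1
    ext ω
    simp only [idealProb]
    ring

/-- The strings `v_ℓ` as a function of `s`, `t` and `x`. -/
def requestedStrings (H : Mat r n) (u : Fin n → ZMod 2) (s t : Mat r m) (x : Mat n m) : Mat n m :=
  x + diagonal u * Hᵀ * (s + t)

theorem queryMatrix_eq (H : Mat r n) (u : Fin n → ZMod 2) :
    queryMatrix H u = H * (diagonal u * Hᵀ) := by
  rw [queryMatrix]
  congr 1
  ext l j
  simp [mul_comm]

theorem requested_eq {n₀ : ℕ} (H : Mat r n) (u : Fin n → ZMod 2) (ω : Execution r k m n n₀) :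
    ω.requested H u = requestedStrings H u ω.s ω.t ω.x := by
  ext l j
  rw [requestedStrings, Matrix.mul_assoc, Matrix.add_apply, diagonal_mul]
  simp only [Execution.requested, Execution.secret, Execution.y, of_apply]
  rcases (by decide : ∀ a : ZMod 2, a = 0 ∨ a = 1) (u l) with h | h <;> simp [h]

theorem mul_requested_eq {n₀ : ℕ} (H : Mat r n) (u : Fin n → ZMod 2)
    (ω : Execution r k m n n₀) (h : H * ω.x = ω.s) :
    H * ω.requested H u = (1 + queryMatrix H u) * ω.s + queryMatrix H u * ω.t := by
  rw [requested_eq, requestedStrings, queryMatrix_eq, Matrix.mul_add, h, ← Matrix.mul_assoc,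
    Matrix.mul_add, Matrix.add_mul, Matrix.one_mul]
  abel

/-- The law of `s`, `t`, `x`. -/
noncomputable def stringsProb (H : Mat r n) (z : Mat r m × Mat r m × Mat n m) : ℝ :=
  unif Set.univ z.1 * unif Set.univ z.2.1 * unif {x : Mat n m | H * x = z.1} z.2.2

theorem stringsProb_nonneg (H : Mat r n) (z : Mat r m × Mat r m × Mat n m) :
    0 ≤ stringsProb H z :=
  mul_nonneg (mul_nonneg (unif_nonneg _ _) (unif_nonneg _ _)) (unif_nonneg _ _)

theorem sum_stringsProb {H : Mat r n} (hH : H * Hᵀ = 1) :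
    ∑ z : Mat r m × Mat r m × Mat n m, stringsProb H z = 1 := by
  have h : ∀ s : Mat r m, ∑ x, unif {x : Mat n m | H * x = s} x = 1 := fun s =>
    sum_unif ⟨Hᵀ * s, by rw [Set.mem_ofPred_eq, ← Matrix.mul_assoc, hH, Matrix.one_mul]⟩
  simp only [stringsProb, Fintype.sum_prod_type, ← mul_sum, h, sum_unif Set.univ_nonempty, mul_one]

theorem stringsProb_add (H : Mat r n) (z : Mat r m × Mat r m × Mat n m) (s t : Mat r m)
    {x : Mat n m} (hx : H * x = s) : stringsProb H (z + (s, t, x)) = stringsProb H z := by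
  have hset : {x' : Mat n m | H * x' = z.1 + s} = (· + x) '' {x' : Mat n m | H * x' = z.1} := by
    ext x'
    simp [hx, Matrix.mul_add]
    rw [← sub_eq_add_neg, sub_eq_iff_eq_add]
  have hinj : Function.Injective fun x' : Mat n m => x' + x := add_left_injective x
  have hc : unif {x' : Mat n m | H * x' = z.1 + s} (z.2.2 + x) =
      unif {x' : Mat n m | H * x' = z.1} z.2.2 := by
    have hmem : z.2.2 + x ∈ {x' : Mat n m | H * x' = z.1 + s} ↔
        z.2.2 ∈ {x' : Mat n m | H * x' = z.1} := by
      simp [Matrix.mul_add, hx]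
    have hcard : {x' : Mat n m | H * x' = z.1 + s}.ncard =
        {x' : Mat n m | H * x' = z.1}.ncard := by
      rw [hset, Set.ncard_image_of_injective _ hinj]
    by_cases h : z.2.2 ∈ {x' : Mat n m | H * x' = z.1}
    · rw [unif_of_mem h, unif_of_mem (hmem.2 h), hcard]
    · rw [unif_of_notMem h, unif_of_notMem (mt hmem.1 h)]
  simp only [stringsProb, unif_univ, Prod.fst_add, Prod.snd_add, hc]

theorem requestedStrings_add (H : Mat r n) (u : Fin n → ZMod 2) (s t s' t' : Mat r m)
    (x : Mat n m) : requestedStrings H u (s + s') (t + t') (x + -(diagonal u * Hᵀ * (s' + t'))) =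
      requestedStrings H u s t x := by
  simp only [requestedStrings, Matrix.mul_add]
  abel

/-- When `(s, t)` is added to the secrets, `-(diagonal u * Hᵀ * (s + t))` must be added to `x` to
keep all requested strings. Under the ideal condition `U s + V t = 0` this shift also respects `H x
= s`, so the full vector `v` hides as much as `U s + V t`. -/
theorem mul_shift_eq (H : Mat r n) (u : Fin n → ZMod 2) {s t : Mat r m}
    (h : (1 + queryMatrix H u) * s + queryMatrix H u * t = 0) :
    H * -(diagonal u * Hᵀ * (s + t)) = s := by
  rw [Matrix.mul_neg, ← Matrix.mul_assoc, ← queryMatrix_eq, Matrix.mul_add, neg_eq_iff_add_eq_zero,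
    ← h, Matrix.add_mul, Matrix.one_mul]
  abel

theorem condEntropy_strings_left {δ : ℝ} (hδ : 0 < δ) (hk : (k : ℝ) = r * (1 / 2 - δ)) (m : ℕ)
    {𝓜 : Set (Mat k r)} (h𝓜 : 𝓜 = Set.univ ∨ 𝓜 = {M | M.rank = k}) {H : Mat r n}
    (hH : H * Hᵀ = 1) (u : Fin n → ZMod 2) (hV : ((queryMatrix H u).rank : ℝ) ≤ r / 2) :
    r * m * (1 / 2 - δ) - m * compressionLoss r δ ≤ condEntropy
      (fun ω : Mat k r × Mat k r × (Mat r m × Mat r m × Mat n m) =>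
        unif 𝓜 ω.1 * unif 𝓜 ω.2.1 * stringsProb H ω.2.2)
      (fun ω => ω.2.1 * ω.2.2.2.1)
      (fun ω => (ω.1 * ω.2.2.1, requestedStrings H u ω.2.2.1 ω.2.2.2.1 ω.2.2.2.2, ω.1, ω.2.1)) := by
  refine (le_mul_pr_decouples hδ hk m h𝓜 _ (1 + queryMatrix H u) (.inl hV)).trans ?_
  rw [← pr_prod_swap (unif 𝓜) fun A B =>
    Decouples A B (queryMatrix H u) (1 + queryMatrix H u)]
  refine mul_pr_le_condEntropy_of_translations (unif_nonneg 𝓜) (stringsProb_nonneg H)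
    (sum_stringsProb hH) (fun _ B z => B * z.2.1)
    (fun A B z => (A * z.1, requestedStrings H u z.1 z.2.1 z.2.2, A, B)) ?_ _ ?_
  · intro A B z A' B' z' h
    simp only [Prod.mk.injEq] at h
    exact h.2.2
  · intro A B hAB τ
    obtain ⟨t, s, h1, h2, h3⟩ := Decouples.exists_mul_eq hAB τ
    refine ⟨Equiv.addRight (s, t, -(diagonal u * Hᵀ * (s + t))), fun z => ⟨?_, ?_, ?_⟩⟩
    · exact stringsProb_add H z s t (mul_shift_eq H u (by rw [add_comm, h3]))
    · simp [Matrix.mul_add, h1]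
    · simp only [Equiv.coe_addRight, Prod.fst_add, Prod.snd_add, requestedStrings_add,
        Matrix.mul_add A, h2, add_zero]

theorem condEntropy_strings_right {δ : ℝ} (hδ : 0 < δ) (hk : (k : ℝ) = r * (1 / 2 - δ)) (m : ℕ)
    {𝓜 : Set (Mat k r)} (h𝓜 : 𝓜 = Set.univ ∨ 𝓜 = {M | M.rank = k}) {H : Mat r n}
    (hH : H * Hᵀ = 1) (u : Fin n → ZMod 2) (hV : (r : ℝ) / 2 < (queryMatrix H u).rank) :
    r * m * (1 / 2 - δ) - m * compressionLoss r δ ≤ condEntropy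
      (fun ω : Mat k r × Mat k r × (Mat r m × Mat r m × Mat n m) =>
        unif 𝓜 ω.1 * unif 𝓜 ω.2.1 * stringsProb H ω.2.2)
      (fun ω => ω.1 * ω.2.2.1)
      (fun ω => (ω.2.1 * ω.2.2.2.1, requestedStrings H u ω.2.2.1 ω.2.2.2.1 ω.2.2.2.2,
        ω.1, ω.2.1)) := by
  refine (le_mul_pr_decouples hδ hk m h𝓜 (1 + queryMatrix H u) _ (.inr hV)).trans ?_
  refine mul_pr_le_condEntropy_of_translations (unif_nonneg 𝓜) (stringsProb_nonneg H)
    (sum_stringsProb hH) (fun A _ z => A * z.1)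
    (fun A B z => (B * z.2.1, requestedStrings H u z.1 z.2.1 z.2.2, A, B)) ?_ _ ?_
  · intro A B z A' B' z' h
    simp only [Prod.mk.injEq] at h
    exact h.2.2
  · intro A B hAB τ
    obtain ⟨s, t, h1, h2, h3⟩ := Decouples.exists_mul_eq hAB τ
    refine ⟨Equiv.addRight (s, t, -(diagonal u * Hᵀ * (s + t))), fun z => ⟨?_, ?_, ?_⟩⟩
    · exact stringsProb_add H z s t (mul_shift_eq H u h3)
    · simp [Matrix.mul_add, h1]
    · simp only [Equiv.coe_addRight, Prod.fst_add, Prod.snd_add, requestedStrings_add,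
        Matrix.mul_add B, h2, add_zero]

end Ideal

/-! ### Privacy amplification by a random matrix, given a syndrome -/

theorem sum_prod_pi {ι κ : Type} [Fintype ι] [DecidableEq ι] [Fintype κ] (f : ι → κ → ℝ) :
    ∑ e : ι → κ, ∏ j, f j (e j) = ∏ j, ∑ b, f j b := by
  rw [prod_univ_sum, Fintype.piFinset_univ]

theorem sum_mul_log_le_log_sum {ι : Type} [Fintype ι] {p x : ι → ℝ} (hp : ∀ i, 0 ≤ p i)
    (hp1 : ∑ i, p i = 1) (hx : ∀ i, 0 < x i) :
    ∑ i, p i * Real.log (x i) ≤ Real.log (∑ i, p i * x i) := by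
  set M := ∑ i, p i * x i with hM
  have hM0 : 0 < M := by
    obtain ⟨i, hi⟩ : ∃ i, p i ≠ 0 := by
      by_contra! h
      simp [h] at hp1
    exact sum_pos' (fun i _ => mul_nonneg (hp i) (hx i).le)
      ⟨i, mem_univ i, mul_pos ((hp i).lt_of_ne hi.symm) (hx i)⟩
  have h : ∀ i, p i * Real.log (x i) ≤ p i * Real.log M + (p i * x i / M - p i) := by
    intro i
    have h1 := Real.log_le_sub_one_of_pos (div_pos (hx i) hM0)
    rw [Real.log_div (hx i).ne' hM0.ne'] at h1
    have h2 := mul_le_mul_of_nonneg_left h1 (hp i)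
    have h3 : p i * (x i / M - 1) = p i * x i / M - p i := by ring
    rw [h3] at h2
    linarith
  refine (sum_le_sum fun i _ => h i).trans ?_
  rw [sum_add_distrib, sum_sub_distrib, ← sum_mul, ← sum_div, hp1, ← hM, div_self hM0.ne']
  simp

/-- By subadditivity of the power, `s log (1 + z) = log ((1 + z)^s) ≤ log (1 + z^s) ≤ z^s`. -/
theorem log_one_add_le_rpow {z s : ℝ} (hz : 0 ≤ z) (hs : 0 < s) (hs1 : s ≤ 1) :
    Real.log (1 + z) ≤ z ^ s / s := by
  rw [le_div_iff₀ hs, mul_comm, ← Real.log_rpow (by positivity)]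
  have h1 := Real.rpow_add_le_add_rpow zero_le_one hz hs.le hs1
  rw [Real.one_rpow] at h1
  refine (Real.log_le_log (by positivity) h1).trans ?_
  have := Real.log_le_sub_one_of_pos (show 0 < 1 + z ^ s by positivity)
  linarith

section Hash

variable {m n q : ℕ}

/-- The likelihood ratio, given the syndrome `H₀ e`, between the hash `h e` of a string `e` of law
proportional to `L` and a uniform string. -/
noncomputable def hashRatio (H₀ : Mat q n) (h : Mat m n) (L : (Fin n → ZMod 2) → ℝ)
    (e : Fin n → ZMod 2) : ℝ :=
  2 ^ m * pr L {e' | H₀ *ᵥ e' = H₀ *ᵥ e ∧ h *ᵥ e' = h *ᵥ e} / pr L {e' | H₀ *ᵥ e' = H₀ *ᵥ e}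

/-- The divergence from uniform, in bits, of the hash `h e` given the syndrome `H₀ e`. -/
noncomputable def hashDivergence (H₀ : Mat q n) (h : Mat m n) (L : (Fin n → ZMod 2) → ℝ) : ℝ :=
  ∑ e, L e * Real.logb 2 (hashRatio H₀ h L e)

variable {H₀ : Mat q n} {h : Mat m n} {L : (Fin n → ZMod 2) → ℝ}

theorem pr_pos (hL : ∀ e, 0 < L e) {S : Set (Fin n → ZMod 2)} {e : Fin n → ZMod 2}
    (he : e ∈ S) : 0 < pr L S :=
  (hL e).trans_le (le_pr (fun e => (hL e).le) he)

theorem hashRatio_pos (hL : ∀ e, 0 < L e) (e : Fin n → ZMod 2) : 0 < hashRatio H₀ h L e :=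
  div_pos (mul_pos (by positivity) (pr_pos hL (e := e) ⟨rfl, rfl⟩)) (pr_pos hL (e := e) rfl)

theorem pr_const_mul {Ω : Type} [Fintype Ω] (c : ℝ) (p : Ω → ℝ) (S : Set Ω) :
    pr (fun ω => c * p ω) S = c * pr p S := by
  classical
  simp only [pr_eq_sum, mul_sum, mul_ite, mul_zero]

theorem hashRatio_const_mul {c : ℝ} (hc : c ≠ 0) (e : Fin n → ZMod 2) :
    hashRatio H₀ h (fun e => c * L e) e = hashRatio H₀ h L e := by
  rw [hashRatio, hashRatio, pr_const_mul, pr_const_mul, mul_left_comm, mul_div_mul_left _ _ hc]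

theorem hashRatio_comp_add (x e : Fin n → ZMod 2) :
    hashRatio H₀ h (fun e => L (e + x)) e = hashRatio H₀ h L (e + x) := by
  have h1 : ∀ S : Set (Fin n → ZMod 2), pr L S =
      pr (fun e => L (e + x)) ((Equiv.addRight x) ⁻¹' S) := fun S =>
    (pr_comp_equiv (Equiv.addRight x) L S).symm
  rw [hashRatio, hashRatio, h1, h1]
  simp [mulVec_add]

theorem hashDivergence_comp_add (x : Fin n → ZMod 2) :
    ∑ e, L (e + x) * Real.logb 2 (hashRatio H₀ h (fun e => L (e + x)) e) =
      hashDivergence H₀ h L := by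
  simp only [hashRatio_comp_add]
  exact Equiv.sum_comp (Equiv.addRight x) fun e => L e * Real.logb 2 (hashRatio H₀ h L e)

/-- Gibbs' inequality: the inverse ratio has mean at most one. Nonnegativity is what later allows
Bob's choice of an erasure pattern to be bounded by a sum over patterns. -/
theorem hashDivergence_nonneg (hL : ∀ e, 0 < L e) (hL1 : ∑ e, L e = 1) :
    0 ≤ hashDivergence H₀ h L := by
  have hL0 : ∀ e, 0 ≤ L e := fun e => (hL e).le
  have h1 : ∑ e, L e * (hashRatio H₀ h L e)⁻¹ ≤ 1 := by
    calc ∑ e, L e * (hashRatio H₀ h L e)⁻¹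
        = ∑ e, L e * (fun y : (Fin q → ZMod 2) × (Fin m → ZMod 2) =>
            (2 ^ m * pr L {e | (H₀ *ᵥ e, h *ᵥ e) = y} / pr L {e | H₀ *ᵥ e = y.1})⁻¹)
            (H₀ *ᵥ e, h *ᵥ e) := by
          simp only [hashRatio, Prod.mk.injEq]
      _ = ∑ y : (Fin q → ZMod 2) × (Fin m → ZMod 2), pr L {e | (H₀ *ᵥ e, h *ᵥ e) = y} *
            (2 ^ m * pr L {e | (H₀ *ᵥ e, h *ᵥ e) = y} / pr L {e | H₀ *ᵥ e = y.1})⁻¹ :=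
          sum_mul_comp_eq_sum_pr L (fun e => (H₀ *ᵥ e, h *ᵥ e))
            fun y : (Fin q → ZMod 2) × (Fin m → ZMod 2) =>
            (2 ^ m * pr L {e | (H₀ *ᵥ e, h *ᵥ e) = y} / pr L {e | H₀ *ᵥ e = y.1})⁻¹
      _ ≤ ∑ y : (Fin q → ZMod 2) × (Fin m → ZMod 2), (2 ^ m)⁻¹ * pr L {e | H₀ *ᵥ e = y.1} := by
          refine sum_le_sum fun y _ => ?_
          have h2 := pr_nonneg hL0 {e | H₀ *ᵥ e = y.1}
          rcases (pr_nonneg hL0 {e | (H₀ *ᵥ e, h *ᵥ e) = y}).eq_or_lt with h0 | h0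
          · rw [← h0, zero_mul]
            positivity
          · refine le_of_eq ?_
            rw [inv_div]
            field_simp
      _ = ∑ y, pr L {e | H₀ *ᵥ e = y} := by
          rw [Fintype.sum_prod_type]
          refine sum_congr rfl fun y _ => ?_
          simp only
          rw [sum_const, card_univ, card_vec, nsmul_eq_mul]
          push_cast
          rw [mul_inv_cancel_left₀ (by positivity)]
      _ = 1 := by
          have := sum_mul_comp_eq_sum_pr L (fun e => H₀ *ᵥ e) fun _ => 1
          simp only [mul_one] at this
          rw [← this, hL1]
  have h2 : -∑ e, L e * Real.log (hashRatio H₀ h L e) ≤ 0 := by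
    rw [← sum_neg_distrib]
    have : ∀ e, -(L e * Real.log (hashRatio H₀ h L e)) ≤
        L e * (hashRatio H₀ h L e)⁻¹ - L e := by
      intro e
      rw [← mul_neg, ← Real.log_inv, ← mul_sub_one]
      exact mul_le_mul_of_nonneg_left
        (Real.log_le_sub_one_of_pos (inv_pos.2 (hashRatio_pos hL e))) (hL0 e)
    refine (sum_le_sum fun e _ => this e).trans ?_
    rw [sum_sub_distrib, hL1]
    linarith
  have h3 : hashDivergence H₀ h L =
      (∑ e, L e * Real.log (hashRatio H₀ h L e)) / Real.log 2 := by
    rw [hashDivergence, sum_div]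
    exact sum_congr rfl fun e _ => by rw [Real.logb, mul_div_assoc]
  rw [h3]
  exact div_nonneg (by linarith) (Real.log_nonneg one_le_two)

/-- Each `e' ≠ e` collides with `e` under the hash with probability at most `(1 - θ)⁻¹ 2^(-m) ≤ (1 +
2θ) 2^(-m)`, where `θ ≤ 1/2` bounds rank deficiency; `e` itself always collides and yields the last
term. -/
theorem sum_unif_mul_hashRatio_le (hH : H₀.rank = q) (hqm : q + m < n) (hL : ∀ e, 0 < L e)
    (e : Fin n → ZMod 2) :
    ∑ h, unif {h : Mat m n | (fromRows H₀ h).rank = q + m} h * hashRatio H₀ h L e ≤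
      1 + 2 * ((2 : ℝ) ^ (q + m) * ((2 : ℝ) ^ n)⁻¹) + 2 ^ m * L e / pr L {e' | H₀ *ᵥ e' = H₀ *ᵥ e} := by
  classical
  set θ : ℝ := (2 : ℝ) ^ (q + m) * ((2 : ℝ) ^ n)⁻¹ with hθ
  set S := {h : Mat m n | (fromRows H₀ h).rank = q + m}
  have hL0 : ∀ e, 0 ≤ L e := fun e => (hL e).le
  have hθ0 : 0 < θ := by positivity
  have hθ1 : θ ≤ 1 / 2 := by
    rw [hθ, ← div_eq_mul_inv, div_le_div_iff₀ (by positivity) (by positivity), one_mul, ← pow_succ]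
    exact pow_le_pow_right₀ one_le_two hqm
  have hν : 0 < pr L {e' | H₀ *ᵥ e' = H₀ *ᵥ e} := pr_pos hL (e := e) rfl
  have hcol : ∀ e', e' ≠ e → pr (unif S) {h | h *ᵥ e' = h *ᵥ e} ≤ (1 + 2 * θ) * ((2 : ℝ) ^ m)⁻¹ := by
    intro e' he'
    have h1 := pr_unif_le (S := S) (θ := θ) (by linarith) (pr_rank_fromRows_compl hH)
      {h | h *ᵥ e' = h *ᵥ e}
    have h2 : {h : Mat m n | h *ᵥ e' = h *ᵥ e} = {h | h *ᵥ (e' - e) = 0} := by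
      ext h
      simp [mulVec_sub, sub_eq_zero]
    rw [h2, pr_mulVec_eq (sub_ne_zero.2 he')] at h1
    rw [h2]
    refine h1.trans (mul_le_mul_of_nonneg_right ?_ (by positivity))
    rw [inv_le_iff_one_le_mul₀ (by linarith)]
    nlinarith
  have hself : pr (unif S) {h | h *ᵥ e = h *ᵥ e} ≤ 1 := by
    have hne : S.Nonempty := nonempty_rank_fromRows hH hqm
    have : {h : Mat m n | h *ᵥ e = h *ᵥ e} = Set.univ := by ext; simp
    rw [this]
    exact le_of_eq (by simpa [pr] using sum_unif hne)
  have hswap : ∑ h, unif S h * pr L {e' | H₀ *ᵥ e' = H₀ *ᵥ e ∧ h *ᵥ e' = h *ᵥ e} =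
      ∑ e', if H₀ *ᵥ e' = H₀ *ᵥ e then L e' * pr (unif S) {h | h *ᵥ e' = h *ᵥ e} else 0 := by
    simp only [pr_eq_sum, mul_sum, Set.mem_ofPred_eq]
    rw [sum_comm]
    refine sum_congr rfl fun e' _ => ?_
    by_cases h1 : H₀ *ᵥ e' = H₀ *ᵥ e
    · simp [h1, mul_comm]
    · simp [h1]
  have hmass : ∑ h, unif S h * pr L {e' | H₀ *ᵥ e' = H₀ *ᵥ e ∧ h *ᵥ e' = h *ᵥ e} ≤
      L e + (1 + 2 * θ) * ((2 : ℝ) ^ m)⁻¹ * pr L {e' | H₀ *ᵥ e' = H₀ *ᵥ e} := by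
    rw [hswap]
    have h1 : ∀ e', (if H₀ *ᵥ e' = H₀ *ᵥ e then L e' * pr (unif S) {h | h *ᵥ e' = h *ᵥ e} else 0) ≤
        (if e' = e then L e' else 0) + (1 + 2 * θ) * ((2 : ℝ) ^ m)⁻¹ *
          (if H₀ *ᵥ e' = H₀ *ᵥ e then L e' else 0) := by
      intro e'
      have hLe := hL0 e'
      by_cases h2 : e' = e
      · subst h2
        rw [if_pos rfl, if_pos rfl, if_pos rfl]
        have h3 : L e' * pr (unif S) {h | h *ᵥ e' = h *ᵥ e'} ≤ L e' := by
          exact mul_le_of_le_one_right hLe hself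
        have h4 : 0 ≤ (1 + 2 * θ) * ((2 : ℝ) ^ m)⁻¹ * L e' := by positivity
        exact le_add_of_le_of_nonneg h3 h4
      · by_cases h3 : H₀ *ᵥ e' = H₀ *ᵥ e
        · simp only [h3, if_true, h2, if_false, zero_add]
          rw [mul_comm]
          exact mul_le_mul_of_nonneg_right (hcol e' h2) hLe
        · simp [h3, h2]
    refine (sum_le_sum fun e' _ => h1 e').trans ?_
    rw [sum_add_distrib, ← mul_sum, pr_eq_sum]
    simp only [sum_ite_eq', mem_univ, if_true, Set.mem_ofPred_eq]
    exact le_of_eq (by congr!)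
  calc ∑ h, unif S h * hashRatio H₀ h L e
      = 2 ^ m / pr L {e' | H₀ *ᵥ e' = H₀ *ᵥ e} *
          ∑ h, unif S h * pr L {e' | H₀ *ᵥ e' = H₀ *ᵥ e ∧ h *ᵥ e' = h *ᵥ e} := by
        rw [mul_sum]
        refine sum_congr rfl fun h _ => ?_
        rw [hashRatio]
        ring
    _ ≤ 2 ^ m / pr L {e' | H₀ *ᵥ e' = H₀ *ᵥ e} *
          (L e + (1 + 2 * θ) * ((2 : ℝ) ^ m)⁻¹ * pr L {e' | H₀ *ᵥ e' = H₀ *ᵥ e}) :=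
        mul_le_mul_of_nonneg_left hmass (by positivity)
    _ = _ := by
        field_simp
        ring

/-- Each of the `2^q` syndromes contributes at most `2^(-q)`. -/
theorem sum_div_pr_syndrome_le (H₀ : Mat q n) (L : (Fin n → ZMod 2) → ℝ) :
    ∑ e, L e * (((2 : ℝ) ^ q)⁻¹ / pr L {e' | H₀ *ᵥ e' = H₀ *ᵥ e}) ≤ 1 := by
  have h1 := sum_mul_comp_eq_sum_pr L (fun e => H₀ *ᵥ e)
    fun y => ((2 : ℝ) ^ q)⁻¹ / pr L {e' | H₀ *ᵥ e' = y}
  rw [h1]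
  have h2 : ∀ y : Fin q → ZMod 2, pr L {e | H₀ *ᵥ e = y} *
      (((2 : ℝ) ^ q)⁻¹ / pr L {e' | H₀ *ᵥ e' = y}) ≤ ((2 : ℝ) ^ q)⁻¹ := by
    intro y
    rw [← mul_div_assoc, mul_comm, mul_div_assoc]
    exact mul_le_of_le_one_right (by positivity) (div_self_le_one _)
  refine (sum_le_sum fun y _ => h2 y).trans ?_
  rw [sum_const, card_univ, card_vec, nsmul_eq_mul]
  push_cast
  rw [mul_inv_cancel₀ (by positivity)]

/-- Jensen's inequality moves the average over `h` inside the logarithm. Improbable syndromes and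
likely strings are then separated with the free weight `l`; the former have bounded mean and the
latter are measured by a moment of order `1 + s`. -/
theorem sum_unif_mul_hashDivergence_le (hH : H₀.rank = q) (hqm : q + m < n) (hL : ∀ e, 0 < L e)
    (hL1 : ∑ e, L e = 1) {s l : ℝ} (hs : 0 < s) (hs1 : s ≤ 1) (hl : 0 < l) :
    ∑ h, unif {h : Mat m n | (fromRows H₀ h).rank = q + m} h * hashDivergence H₀ h L ≤
      (2 * ((2 : ℝ) ^ (q + m) * ((2 : ℝ) ^ n)⁻¹) + l⁻¹ +
        l ^ s / s * (((2 : ℝ) ^ (q + m)) ^ s * ∑ e, L e ^ (1 + s))) / Real.log 2 := by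
  set θ : ℝ := (2 : ℝ) ^ (q + m) * ((2 : ℝ) ^ n)⁻¹ with hθ
  set S := {h : Mat m n | (fromRows H₀ h).rank = q + m} with hS
  have hθ0 : 0 < θ := by positivity
  have hlog2 : 0 < Real.log 2 := Real.log_pos one_lt_two
  have hL0 : ∀ e, 0 ≤ L e := fun e => (hL e).le
  have hS1 : ∑ h, unif S h = 1 := sum_unif (nonempty_rank_fromRows hH hqm)
  have hpt : ∀ e, ∑ h, unif S h * Real.log (hashRatio H₀ h L e) ≤
      2 * θ + l⁻¹ * (((2 : ℝ) ^ q)⁻¹ / pr L {e' | H₀ *ᵥ e' = H₀ *ᵥ e}) +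
        l ^ s / s * (((2 : ℝ) ^ (q + m)) ^ s * L e ^ s) := by
    intro e
    have hν : 0 < pr L {e' | H₀ *ᵥ e' = H₀ *ᵥ e} := pr_pos hL (e := e) rfl
    set Y := ((2 : ℝ) ^ q)⁻¹ / pr L {e' | H₀ *ᵥ e' = H₀ *ᵥ e} with hY
    set X := (2 : ℝ) ^ (q + m) * L e with hX
    have hY0 : 0 < Y := by positivity
    have hX0 : 0 < X := mul_pos (by positivity) (hL e)
    have hXY : 2 ^ m * L e / pr L {e' | H₀ *ᵥ e' = H₀ *ᵥ e} = X * Y := by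
      rw [hX, hY, pow_add]
      field_simp
    have hr := sum_unif_mul_hashRatio_le hH hqm hL e
    rw [← hS, ← hθ, hXY] at hr
    have hpos : 0 < ∑ h, unif S h * hashRatio H₀ h L e := by
      have : ∃ h, unif S h ≠ 0 := by
        by_contra! hcon
        simp [hcon] at hS1
      obtain ⟨h, hh⟩ := this
      exact sum_pos' (fun h _ => mul_nonneg (unif_nonneg _ _) (hashRatio_pos hL e).le)
        ⟨h, mem_univ h, mul_pos ((unif_nonneg S h).lt_of_ne hh.symm) (hashRatio_pos hL e)⟩
    refine (sum_mul_log_le_log_sum (unif_nonneg S) hS1 fun h => hashRatio_pos hL e).trans ?_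
    -- `1 + X Y ≤ (1 + l X)(1 + Y / l)`, where `X` depends on the likelihood of `e` and `Y` on that
    -- of its syndrome.
    have hle : ∑ h, unif S h * hashRatio H₀ h L e ≤
        (1 + 2 * θ) * ((1 + l * X) * (1 + l⁻¹ * Y)) := by
      refine hr.trans ?_
      have e1 : (1 + l * X) * (1 + l⁻¹ * Y) = 1 + X * Y + (l * X + l⁻¹ * Y) := by
        field_simp
        ring
      rw [e1]
      have e2 : 0 < l * X + l⁻¹ * Y := by positivity
      have e3 : 0 < X * Y := by positivity
      nlinarith
    refine (Real.log_le_log hpos hle).trans ?_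
    rw [Real.log_mul (by positivity) (by positivity), Real.log_mul (by positivity) (by positivity)]
    have b1 := Real.log_le_sub_one_of_pos (show 0 < 1 + 2 * θ by positivity)
    have b2 := Real.log_le_sub_one_of_pos (show 0 < 1 + l⁻¹ * Y by positivity)
    have b3 := log_one_add_le_rpow (show 0 ≤ l * X by positivity) hs hs1
    rw [Real.mul_rpow hl.le hX0.le, hX, Real.mul_rpow (by positivity) (hL0 e)] at b3
    rw [mul_div_right_comm] at b3
    linarith
  have hexp : ∑ h, unif S h * hashDivergence H₀ h L =
      (∑ e, L e * ∑ h, unif S h * Real.log (hashRatio H₀ h L e)) / Real.log 2 := by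
    simp only [hashDivergence, mul_sum, sum_div]
    rw [sum_comm]
    refine sum_congr rfl fun e _ => sum_congr rfl fun h _ => ?_
    rw [Real.logb]
    ring
  rw [hexp]
  refine div_le_div_of_nonneg_right ?_ hlog2.le
  refine (sum_le_sum fun e _ => mul_le_mul_of_nonneg_left (hpt e) (hL0 e)).trans ?_
  have h1 := sum_div_pr_syndrome_le H₀ L
  have h2 : ∑ e, L e * (2 * θ + l⁻¹ * (((2 : ℝ) ^ q)⁻¹ / pr L {e' | H₀ *ᵥ e' = H₀ *ᵥ e}) +
        l ^ s / s * (((2 : ℝ) ^ (q + m)) ^ s * L e ^ s)) =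
      2 * θ * ∑ e, L e + l⁻¹ * ∑ e, L e * (((2 : ℝ) ^ q)⁻¹ / pr L {e' | H₀ *ᵥ e' = H₀ *ᵥ e}) +
        l ^ s / s * (((2 : ℝ) ^ (q + m)) ^ s * ∑ e, L e ^ (1 + s)) := by
    simp only [mul_sum]
    rw [← sum_add_distrib, ← sum_add_distrib]
    refine sum_congr rfl fun e _ => ?_
    rw [Real.rpow_add (hL e), Real.rpow_one]
    ring
  rw [h2, hL1]
  have h3 := mul_le_mul_of_nonneg_left h1 (inv_pos.2 hl).le
  linarith

end Hash

/-! ### One run of `P₀` -/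

section Run

variable {n₀ m q : ℕ} {φ : ℝ}

/-- The probability that the noise of the channel takes the value `x`. -/
noncomputable def chan (φ : ℝ) (x : ZMod 2) : ℝ := if x = 0 then 1 - φ else φ

/-- The likelihood of the bit `β` when the pair `w` is received. -/
noncomputable def pairWeight (φ : ℝ) (w : Fin 2 → ZMod 2) (β : ZMod 2) : ℝ :=
  ∏ b, chan φ (w b - β)

/-- The likelihood of the string `e` when the pairs `v` are received. -/
noncomputable def stringWeight {n : ℕ} (φ : ℝ) (v : Fin n → Fin 2 → ZMod 2)
    (e : Fin n → ZMod 2) : ℝ :=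
  ∏ j, pairWeight φ (v j) (e j)

/-- Twice the probability that the pair `w` is received. -/
noncomputable def pairMass (φ : ℝ) (w : Fin 2 → ZMod 2) : ℝ := ∑ β, pairWeight φ w β

theorem chan_pos (h0 : 0 < φ) (h1 : φ < 1) (x : ZMod 2) : 0 < chan φ x := by
  unfold chan
  split_ifs <;> linarith

theorem pairWeight_pos (h0 : 0 < φ) (h1 : φ < 1) (w : Fin 2 → ZMod 2) (β : ZMod 2) :
    0 < pairWeight φ w β :=
  prod_pos fun _ _ => chan_pos h0 h1 _

theorem stringWeight_pos {n : ℕ} (h0 : 0 < φ) (h1 : φ < 1) (v : Fin n → Fin 2 → ZMod 2)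
    (e : Fin n → ZMod 2) : 0 < stringWeight φ v e :=
  prod_pos fun _ _ => pairWeight_pos h0 h1 _ _

theorem pairMass_pos (h0 : 0 < φ) (h1 : φ < 1) (w : Fin 2 → ZMod 2) : 0 < pairMass φ w :=
  sum_pos (fun _ _ => pairWeight_pos h0 h1 _ _) univ_nonempty

theorem sum_zmod_two (f : ZMod 2 → ℝ) : ∑ x, f x = f 0 + f 1 := Fin.sum_univ_two f

theorem prod_zmod_two (f : ZMod 2 → ℝ) (b : ZMod 2) : ∏ x, f x = f b * f (b + 1) := by
  have h : ∏ x, f x = f 0 * f 1 := Fin.prod_univ_two f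
  rcases (by decide : ∀ a : ZMod 2, a = 0 ∨ a = 1) b with rfl | rfl
  · simpa using h
  · rw [h, mul_comm, show (1 : ZMod 2) + 1 = 0 by decide]

theorem sum_chan (φ : ℝ) (β : ZMod 2) : ∑ x, chan φ (x - β) = 1 := by
  refine (Equiv.sum_comp (Equiv.subRight β) (chan φ)).trans ?_
  rw [sum_zmod_two]
  simp [chan]

theorem sum_pairMass (φ : ℝ) : ∑ w, pairMass φ w = 2 := by
  simp only [pairMass, pairWeight]
  rw [sum_comm]
  have : ∀ β : ZMod 2, ∑ w : Fin 2 → ZMod 2, ∏ b, chan φ (w b - β) = 1 := fun β => by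
    rw [sum_prod_pi fun _ x => chan φ (x - β)]
    simp [sum_chan]
  simp only [this, sum_const, card_univ, ZMod.card]
  norm_num

theorem sum_stringWeight {n : ℕ} (φ : ℝ) (v : Fin n → Fin 2 → ZMod 2) :
    ∑ e, stringWeight φ v e = ∏ j, pairMass φ (v j) :=
  sum_prod_pi fun j x => pairWeight φ (v j) x

/-- The positions of Bob's two sets after Alice's permutations. -/
def positions (π : P0Strategy n₀ m) (h : Mat m n₀) (σ : ZMod 2 → Equiv.Perm (Fin n₀))
    (w : Fin (2 * n₀) → Fin 2 → ZMod 2) : ZMod 2 × Fin n₀ ≃ Fin (2 * n₀) :=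
  (Equiv.prodCongrRight σ).trans (π h w)

/-- A run is determined by Bob's data, the two strings of bits of Alice on his sets, and
the codewords. -/
def runEquiv (π : P0Strategy n₀ m) :
    Mat m n₀ × (ZMod 2 → Equiv.Perm (Fin n₀)) × (Fin (2 * n₀) → Fin 2 → ZMod 2) ×
      (ZMod 2 → Fin n₀ → ZMod 2) × (ZMod 2 → Fin n₀ → ZMod 2) ≃ P0Run n₀ m where
  toFun x :=
    { bits := fun i => x.2.2.2.1 ((positions π x.1 x.2.1 x.2.2.1).symm i).1
        ((positions π x.1 x.2.1 x.2.2.1).symm i).2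
      noise := fun i b => x.2.2.1 i b - x.2.2.2.1 ((positions π x.1 x.2.1 x.2.2.1).symm i).1
        ((positions π x.1 x.2.1 x.2.2.1).symm i).2
      perm := x.2.1
      hash := x.1
      codeword := x.2.2.2.2 }
  invFun ρ := (ρ.hash, ρ.perm, ρ.received,
    fun a j => ρ.bits (positions π ρ.hash ρ.perm ρ.received (a, j)), ρ.codeword)
  left_inv := by
    rintro ⟨h, σ, w, r, c⟩
    have hw : P0Run.received (m := m) (n₀ := n₀)
        { bits := fun i => r ((positions π h σ w).symm i).1 ((positions π h σ w).symm i).2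
          noise := fun i b => w i b -
            r ((positions π h σ w).symm i).1 ((positions π h σ w).symm i).2
          perm := σ
          hash := h
          codeword := c } = w := by
      ext i b
      simp [P0Run.received]
    simp only [hw, Equiv.symm_apply_apply]
  right_inv := by
    intro ρ
    ext i <;> simp [P0Run.received]

section Coordinates

variable (π : P0Strategy n₀ m) (h : Mat m n₀) (σ : ZMod 2 → Equiv.Perm (Fin n₀))
  (w : Fin (2 * n₀) → Fin 2 → ZMod 2) (r c : ZMod 2 → Fin n₀ → ZMod 2)

theorem runEquiv_received : (runEquiv π (h, σ, w, r, c)).received = w :=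
  congrArg (fun x => x.2.2.1) ((runEquiv π).symm_apply_apply (h, σ, w, r, c))

theorem runEquiv_bits (a : ZMod 2) (j : Fin n₀) :
    (runEquiv π (h, σ, w, r, c)).bits (positions π h σ w (a, j)) = r a j := by
  simp [runEquiv]

theorem runEquiv_view :
    (runEquiv π (h, σ, w, r, c)).view π = (h, w, σ, c + r) := by
  rw [P0Run.view, runEquiv_received]
  refine Prod.ext rfl (Prod.ext rfl (Prod.ext rfl ?_))
  ext a j
  change c a j + (runEquiv π (h, σ, w, r, c)).bits
    (π h (runEquiv π (h, σ, w, r, c)).received (a, σ a j)) = _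
  rw [runEquiv_received]
  exact congrArg (c a j + ·) (runEquiv_bits π h σ w r c a j)

theorem p0Prob_runEquiv (H₀ : Mat q n₀) (sec : ZMod 2 → Fin m → ZMod 2) :
    p0Prob φ H₀ sec (runEquiv π (h, σ, w, r, c)) =
      ((2 : ℝ) ^ (2 * n₀))⁻¹ * unif Set.univ σ *
        unif {H₁ : Mat m n₀ | (fromRows H₀ H₁).rank = q + m} h *
        ∏ a, (stringWeight φ (fun j => w (positions π h σ w (a, j))) (r a) *
          unif {c : Fin n₀ → ZMod 2 | H₀ *ᵥ c = 0 ∧ h *ᵥ c = sec a} (c a)) := by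
  have h1 : (∏ i, ∏ b, if (runEquiv π (h, σ, w, r, c)).noise i b = 0 then 1 - φ else φ) =
      ∏ a, stringWeight φ (fun j => w (positions π h σ w (a, j))) (r a) := by
    rw [← (positions π h σ w).prod_comp, Fintype.prod_prod_type]
    refine prod_congr rfl fun a _ => prod_congr rfl fun j _ => prod_congr rfl fun b _ => ?_
    simp [runEquiv, chan]
  rw [p0Prob, h1, unif_univ, card_vec, prod_mul_distrib]
  push_cast
  simp only [runEquiv, Equiv.coe_fn_mk]
  ring

end Coordinates

theorem sum_runEquiv (π : P0Strategy n₀ m) (f : P0Run n₀ m → ℝ) :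
    ∑ ρ, f ρ = ∑ h, ∑ σ, ∑ w, ∑ r, ∑ c, f (runEquiv π (h, σ, w, r, c)) := by
  rw [← (runEquiv π).sum_comp]
  simp only [Fintype.sum_prod_type]

theorem sum_unif_codeword {H₀ : Mat q n₀} {h : Mat m n₀}
    (hh : (fromRows H₀ h).rank = q + m) (z : Fin m → ZMod 2) :
    ∑ c, unif {c : Fin n₀ → ZMod 2 | H₀ *ᵥ c = 0 ∧ h *ᵥ c = z} c = 1 := by
  refine sum_unif ?_
  obtain ⟨c, hc⟩ := mulVec_surjective_of_rank (M := fromRows H₀ h) (by simpa using hh) (Sum.elim 0 z)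
  simp only [fromRows_mulVec] at hc
  exact ⟨c, funext fun i => congrFun hc (Sum.inl i), funext fun i => congrFun hc (Sum.inr i)⟩

/-- The received pairs on Bob's set for the secret `a`, in Alice's order. -/
def heldPairs (π : P0Strategy n₀ m) (a : ZMod 2) (h : Mat m n₀)
    (σ : ZMod 2 → Equiv.Perm (Fin n₀)) (w : Fin (2 * n₀) → Fin 2 → ZMod 2) :
    Fin n₀ → Fin 2 → ZMod 2 :=
  fun j => w (positions π h σ w (a, j))

theorem prod_heldPairs (π : P0Strategy n₀ m) (h : Mat m n₀) (σ : ZMod 2 → Equiv.Perm (Fin n₀))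
    (w : Fin (2 * n₀) → Fin 2 → ZMod 2) (f : (Fin 2 → ZMod 2) → ℝ) :
    ∏ a, ∏ j, f (heldPairs π a h σ w j) = ∏ i, f (w i) := by
  rw [← (positions π h σ w).prod_comp, Fintype.prod_prod_type]
  rfl

/-- The expectation of a function of what Bob sees and of the bits for the secret `a`. -/
theorem sum_p0Prob_mul (π : P0Strategy n₀ m) (H₀ : Mat q n₀) (sec : ZMod 2 → Fin m → ZMod 2)
    (a : ZMod 2) (F : P0Run n₀ m → ℝ)
    (f : Mat m n₀ → (ZMod 2 → Equiv.Perm (Fin n₀)) → (Fin (2 * n₀) → Fin 2 → ZMod 2) →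
      (Fin n₀ → ZMod 2) → ℝ)
    (hF : ∀ h σ w r c, F (runEquiv π (h, σ, w, r, c)) = f h σ w (r a)) :
    ∑ ρ, p0Prob φ H₀ sec ρ * F ρ =
      ∑ h, unif {H₁ : Mat m n₀ | (fromRows H₀ H₁).rank = q + m} h * ∑ σ, unif Set.univ σ *
        ∑ w, ((2 : ℝ) ^ (2 * n₀))⁻¹ * ((∏ j, pairMass φ (heldPairs π (a + 1) h σ w j)) *
          ∑ e, stringWeight φ (heldPairs π a h σ w) e * f h σ w e) := by
  rw [sum_runEquiv π]
  refine sum_congr rfl fun h _ => ?_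
  by_cases hh : h ∈ {H₁ : Mat m n₀ | (fromRows H₀ H₁).rank = q + m}
  swap
  · simp [p0Prob_runEquiv, unif_of_notMem hh]
  rw [mul_sum]
  refine sum_congr rfl fun σ _ => ?_
  rw [mul_sum, mul_sum]
  refine sum_congr rfl fun w _ => ?_
  have h1 : ∀ r c : ZMod 2 → Fin n₀ → ZMod 2,
      p0Prob φ H₀ sec (runEquiv π (h, σ, w, r, c)) * F (runEquiv π (h, σ, w, r, c)) =
      ((2 : ℝ) ^ (2 * n₀))⁻¹ * unif Set.univ σ *
        unif {H₁ : Mat m n₀ | (fromRows H₀ H₁).rank = q + m} h *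
        ((∏ x, stringWeight φ (heldPairs π x h σ w) (r x)) * f h σ w (r a) *
          ∏ x, unif {c : Fin n₀ → ZMod 2 | H₀ *ᵥ c = 0 ∧ h *ᵥ c = sec x} (c x)) := by
    intro r c
    have e : ∀ x, (fun j => w (positions π h σ w (x, j))) = heldPairs π x h σ w := fun _ => rfl
    rw [p0Prob_runEquiv, hF, prod_mul_distrib]
    simp only [e]
    ring
  -- Attaching `f` to the factor of the secret `a` lets the sum over both strings split as a product
  -- of two sums.
  have h2 : ∀ r : ZMod 2 → Fin n₀ → ZMod 2,
      (∏ x, stringWeight φ (heldPairs π x h σ w) (r x)) * f h σ w (r a) =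
      ∏ x, (stringWeight φ (heldPairs π x h σ w) (r x) * if x = a then f h σ w (r x) else 1) := by
    intro r
    rw [prod_mul_distrib, prod_ite_eq' univ a fun x => f h σ w (r x), if_pos (mem_univ a)]
  simp only [h1, ← mul_sum]
  rw [sum_prod_pi fun x c => unif {c : Fin n₀ → ZMod 2 | H₀ *ᵥ c = 0 ∧ h *ᵥ c = sec x} c]
  simp only [sum_unif_codeword hh, prod_const_one, mul_one, h2]
  rw [sum_prod_pi fun x e => stringWeight φ (heldPairs π x h σ w) e *
    if x = a then f h σ w e else 1, prod_zmod_two _ a]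
  have h3 : a + 1 ≠ a := by simp
  simp only [if_true, h3, if_false, mul_one, sum_stringWeight]
  ring

theorem sum_prod_pairMass (φ : ℝ) (N : ℕ) : ∑ w : Fin N → Fin 2 → ZMod 2,
    ((2 : ℝ) ^ N)⁻¹ * ∏ i, pairMass φ (w i) = 1 := by
  rw [← mul_sum, sum_prod_pi fun _ x => pairMass φ x]
  simp [sum_pairMass]

theorem sum_p0Prob {H₀ : Mat q n₀}
    (hne : {H₁ : Mat m n₀ | (fromRows H₀ H₁).rank = q + m}.Nonempty)
    (sec : ZMod 2 → Fin m → ZMod 2) : ∑ ρ, p0Prob φ H₀ sec ρ = 1 := by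
  -- The law of a run does not involve the strategy, so any strategy provides coordinates for the
  -- sum.
  have h := sum_p0Prob_mul (φ := φ) (fun _ _ => finProdFinEquiv) H₀ sec 0 (fun _ => 1)
    (fun _ _ _ _ => 1) fun _ _ _ _ _ => rfl
  simp only [mul_one] at h
  rw [h]
  have h1 : ∀ (h : Mat m n₀) σ, ∑ w, ((2 : ℝ) ^ (2 * n₀))⁻¹ *
      ((∏ j, pairMass φ (heldPairs (fun _ _ => finProdFinEquiv) (0 + 1) h σ w j)) *
        ∑ e, stringWeight φ (heldPairs (fun _ _ => finProdFinEquiv) 0 h σ w) e) = 1 := by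
    intro h σ
    rw [← sum_prod_pairMass φ (2 * n₀)]
    refine sum_congr rfl fun w _ => ?_
    rw [sum_stringWeight, ← prod_heldPairs (fun _ _ => finProdFinEquiv) h σ w (pairMass φ),
      prod_zmod_two _ (0 : ZMod 2)]
    ring
  simp only [h1, mul_one, sum_unif Set.univ_nonempty, sum_unif hne]

theorem p0Prob_nonneg (h0 : 0 < φ) (h1 : φ < 1) (H₀ : Mat q n₀) (sec : ZMod 2 → Fin m → ZMod 2)
    (ρ : P0Run n₀ m) : 0 ≤ p0Prob φ H₀ sec ρ := by
  refine mul_nonneg (mul_nonneg (mul_nonneg (mul_nonneg (unif_nonneg _ _) ?_) (unif_nonneg _ _))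
    (unif_nonneg _ _)) (prod_nonneg fun _ _ => unif_nonneg _ _)
  exact prod_nonneg fun i _ => prod_nonneg fun b _ => by split_ifs <;> linarith

/-- The likelihood ratio by which Bob's view of a run in which he asks for the secret `a + 1`
depends on the secret `a`. -/
noncomputable def runRatio (φ : ℝ) (H₀ : Mat q n₀) (π : P0Strategy n₀ m) (a : ZMod 2)
    (ρ : P0Run n₀ m) : ℝ :=
  hashRatio H₀ ρ.hash (stringWeight φ (heldPairs π a ρ.hash ρ.perm ρ.received))
    fun j => ρ.bits (positions π ρ.hash ρ.perm ρ.received (a, j))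

theorem runRatio_runEquiv (H₀ : Mat q n₀) (π : P0Strategy n₀ m) (a : ZMod 2) (h : Mat m n₀)
    (σ : ZMod 2 → Equiv.Perm (Fin n₀)) (w : Fin (2 * n₀) → Fin 2 → ZMod 2)
    (r c : ZMod 2 → Fin n₀ → ZMod 2) :
    runRatio φ H₀ π a (runEquiv π (h, σ, w, r, c)) =
      hashRatio H₀ h (stringWeight φ (heldPairs π a h σ w)) (r a) := by
  rw [runRatio, runEquiv_received]
  congr 1
  ext j
  exact runEquiv_bits π h σ w r c a j

/-- The law of the view of Bob in a run in which the secret `a + 1` is `z`, when the secret `a`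
is replaced by a uniform string. -/
noncomputable def simProb (φ : ℝ) (H₀ : Mat q n₀) (π : P0Strategy n₀ m) (a : ZMod 2)
    (z : Fin m → ZMod 2)
    (W : Mat m n₀ × (Fin (2 * n₀) → Fin 2 → ZMod 2) × (ZMod 2 → Equiv.Perm (Fin n₀)) ×
      (ZMod 2 → Fin n₀ → ZMod 2)) : ℝ :=
  ((2 : ℝ) ^ (2 * n₀))⁻¹ * unif Set.univ W.2.2.1 *
    unif {H₁ : Mat m n₀ | (fromRows H₀ H₁).rank = q + m} W.1 *
    ∏ x, if x = a then 2 ^ q / 2 ^ n₀ *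
      pr (stringWeight φ (heldPairs π x W.1 W.2.2.1 W.2.1)) {e | H₀ *ᵥ e = H₀ *ᵥ W.2.2.2 x}
    else ∑ e, stringWeight φ (heldPairs π x W.1 W.2.2.1 W.2.1) e *
      unif {c : Fin n₀ → ZMod 2 | H₀ *ᵥ c = 0 ∧ W.1 *ᵥ c = z} (W.2.2.2 x - e)

theorem ncard_codeword {H₀ : Mat q n₀} {h : Mat m n₀}
    (hh : (fromRows H₀ h).rank = q + m) (z : Fin m → ZMod 2) :
    ({c : Fin n₀ → ZMod 2 | H₀ *ᵥ c = 0 ∧ h *ᵥ c = z}.ncard : ℝ)⁻¹ =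
      2 ^ q * 2 ^ m / 2 ^ n₀ := by
  have h1 := ncard_mulVec_eq (by simpa using hh) (Sum.elim (0 : Fin q → ZMod 2) z)
  have h2 : {x | fromRows H₀ h *ᵥ x = Sum.elim (0 : Fin q → ZMod 2) z} =
      {c : Fin n₀ → ZMod 2 | H₀ *ᵥ c = 0 ∧ h *ᵥ c = z} := by
    ext c
    simp only [fromRows_mulVec, Set.mem_ofPred_eq]
    constructor
    · intro hc
      exact ⟨funext fun i => congrFun hc (Sum.inl i), funext fun i => congrFun hc (Sum.inr i)⟩
    · rintro ⟨h1, h2⟩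
      rw [h1, h2]
  rw [h2, Fintype.card_sum, Fintype.card_fin, Fintype.card_fin] at h1
  rw [inv_eq_iff_eq_inv, inv_div, eq_div_iff (by positivity), ← pow_add]
  exact_mod_cast h1

/-- Given the message `x`, the possible `e` have syndrome `H₀ x` and hash `h x - z`. The ratio is
constant on this class, and dividing by it replaces the mass of the class by `2^(-m)` times the mass
of the whole syndrome class, so `z` disappears. -/
theorem sum_stringWeight_div_hashRatio_le {H₀ : Mat q n₀} {h : Mat m n₀}
    (hh : (fromRows H₀ h).rank = q + m) {L : (Fin n₀ → ZMod 2) → ℝ} (hL : ∀ e, 0 < L e)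
    (z : Fin m → ZMod 2) (x : Fin n₀ → ZMod 2) :
    ∑ e, L e * unif {c : Fin n₀ → ZMod 2 | H₀ *ᵥ c = 0 ∧ h *ᵥ c = z} (x - e) /
      hashRatio H₀ h L e ≤ 2 ^ q / 2 ^ n₀ * pr L {e | H₀ *ᵥ e = H₀ *ᵥ x} := by
  classical
  set N₀ := pr L {e | H₀ *ᵥ e = H₀ *ᵥ x}
  set N₁ := pr L {e | H₀ *ᵥ e = H₀ *ᵥ x ∧ h *ᵥ e = h *ᵥ x - z} with hN₁
  have hN₀ : 0 ≤ N₀ := pr_nonneg (fun e => (hL e).le) _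
  have h1 : ∀ e, L e * unif {c : Fin n₀ → ZMod 2 | H₀ *ᵥ c = 0 ∧ h *ᵥ c = z} (x - e) /
      hashRatio H₀ h L e = (if e ∈ {e | H₀ *ᵥ e = H₀ *ᵥ x ∧ h *ᵥ e = h *ᵥ x - z} then L e else 0) *
        (2 ^ q / 2 ^ n₀ * N₀ / N₁) := by
    intro e
    have hiff : x - e ∈ {c : Fin n₀ → ZMod 2 | H₀ *ᵥ c = 0 ∧ h *ᵥ c = z} ↔
        e ∈ {e | H₀ *ᵥ e = H₀ *ᵥ x ∧ h *ᵥ e = h *ᵥ x - z} := by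
      simp only [Set.mem_ofPred_eq, mulVec_sub]
      constructor
      · rintro ⟨h1, h2⟩
        exact ⟨(sub_eq_zero.1 h1).symm, by rw [← h2]; abel⟩
      · rintro ⟨h1, h2⟩
        exact ⟨by rw [h1, sub_self], by rw [h2]; abel⟩
    by_cases he : e ∈ {e | H₀ *ᵥ e = H₀ *ᵥ x ∧ h *ᵥ e = h *ᵥ x - z}
    · rw [if_pos he, unif_of_mem (hiff.2 he), ncard_codeword hh]
      have : hashRatio H₀ h L e = 2 ^ m * N₁ / N₀ := by
        rw [hashRatio, he.1, he.2]
      have hN₀' : 0 < N₀ := pr_pos hL (e := x) rfl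
      have hN₁' : 0 < N₁ := pr_pos hL he
      rw [this]
      field_simp
    · rw [if_neg he, unif_of_notMem (mt hiff.1 he)]
      simp
  simp only [h1]
  rw [← sum_mul, ← pr_eq_sum, ← hN₁, mul_div_assoc', mul_div_right_comm]
  refine (mul_le_of_le_one_left (by positivity) (div_self_le_one N₁))

/-- Once the view is fixed, the codewords are determined by the bits and the mass factors over the
two secrets. Division by the ratio removes the secret `a` from its factor; the other factor is kept.
-/
theorem pr_view_le_simProb (h0 : 0 < φ) (h1 : φ < 1) (H₀ : Mat q n₀) (π : P0Strategy n₀ m)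
    (a : ZMod 2) (sec : ZMod 2 → Fin m → ZMod 2) (W) :
    pr (fun ρ => p0Prob φ H₀ sec ρ / runRatio φ H₀ π a ρ) {ρ | ρ.view π = W} ≤
      simProb φ H₀ π a (sec (a + 1)) W := by
  classical
  obtain ⟨h, w, σ, g⟩ := W
  have e1 : pr (fun ρ => p0Prob φ H₀ sec ρ / runRatio φ H₀ π a ρ) {ρ | ρ.view π = (h, w, σ, g)} =
      ∑ r, p0Prob φ H₀ sec (runEquiv π (h, σ, w, r, g - r)) /
        runRatio φ H₀ π a (runEquiv π (h, σ, w, r, g - r)) := by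
    rw [pr_eq_sum, sum_runEquiv π]
    simp only [Set.mem_ofPred_eq, runEquiv_view, Prod.mk.injEq, ← eq_sub_iff_add_eq]
    rw [sum_eq_single h (fun h' _ hne => by simp [hne]) (by simp),
      sum_eq_single σ (fun σ' _ hne => by simp [hne]) (by simp),
      sum_eq_single w (fun w' _ hne => by simp [hne]) (by simp)]
    refine sum_congr rfl fun r _ => ?_
    simp
  rw [e1]
  by_cases hh : h ∈ {H₁ : Mat m n₀ | (fromRows H₀ H₁).rank = q + m}
  swap
  · simp [p0Prob_runEquiv, simProb, unif_of_notMem hh]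
  have e2 : ∀ r, p0Prob φ H₀ sec (runEquiv π (h, σ, w, r, g - r)) /
        runRatio φ H₀ π a (runEquiv π (h, σ, w, r, g - r)) =
      ((2 : ℝ) ^ (2 * n₀))⁻¹ * unif Set.univ σ *
        unif {H₁ : Mat m n₀ | (fromRows H₀ H₁).rank = q + m} h *
        ∏ x, (stringWeight φ (heldPairs π x h σ w) (r x) *
          unif {c : Fin n₀ → ZMod 2 | H₀ *ᵥ c = 0 ∧ h *ᵥ c = sec x} (g x - r x) /
          (if x = a then hashRatio H₀ h (stringWeight φ (heldPairs π x h σ w)) (r x) else 1)) := by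
    intro r
    rw [p0Prob_runEquiv, runRatio_runEquiv, mul_div_assoc, prod_div_distrib,
      prod_ite_eq' univ a fun x => hashRatio H₀ h (stringWeight φ (heldPairs π x h σ w)) (r x),
      if_pos (mem_univ a)]
    rfl
  simp only [e2, ← mul_sum]
  rw [sum_prod_pi fun x e => stringWeight φ (heldPairs π x h σ w) e *
          unif {c : Fin n₀ → ZMod 2 | H₀ *ᵥ c = 0 ∧ h *ᵥ c = sec x} (g x - e) /
          (if x = a then hashRatio H₀ h (stringWeight φ (heldPairs π x h σ w)) e else 1), simProb]
  refine mul_le_mul_of_nonneg_left ?_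
    (mul_nonneg (mul_nonneg (by positivity) (unif_nonneg _ _)) (unif_nonneg _ _))
  have hL := fun x => stringWeight_pos h0 h1 (heldPairs π x h σ w)
  refine prod_le_prod (fun x _ => sum_nonneg fun e _ => ?_) fun x _ => ?_
  · refine div_nonneg (mul_nonneg (hL x e).le (unif_nonneg _ _)) ?_
    split_ifs
    exacts [(hashRatio_pos (hL x) e).le, zero_le_one]
  · by_cases hx : x = a
    · simp only [hx, if_true]
      exact sum_stringWeight_div_hashRatio_le hh (hL a) _ _
    · have := (by decide : ∀ a x : ZMod 2, x ≠ a → x = a + 1) a x hx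
      subst this
      simp only [hx, if_false, div_one, le_refl]

theorem simProb_nonneg (h0 : 0 < φ) (h1 : φ < 1) (H₀ : Mat q n₀) (π : P0Strategy n₀ m)
    (a : ZMod 2) (z : Fin m → ZMod 2) (W) : 0 ≤ simProb φ H₀ π a z W := by
  refine mul_nonneg (mul_nonneg (mul_nonneg (by positivity) (unif_nonneg _ _)) (unif_nonneg _ _))
    (prod_nonneg fun x _ => ?_)
  have hL := fun e => (stringWeight_pos h0 h1 (heldPairs π x W.1 W.2.2.1 W.2.1) e).le
  split_ifs
  · exact mul_nonneg (by positivity) (pr_nonneg hL _)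
  · exact sum_nonneg fun e _ => mul_nonneg (hL e) (unif_nonneg _ _)

/-- Every `e` is counted once for each of the `2^(n₀ - q)` strings with its syndrome. -/
theorem sum_pr_syndrome {H₀ : Mat q n₀} (hH : H₀.rank = q) (L : (Fin n₀ → ZMod 2) → ℝ) :
    ∑ x, (2 : ℝ) ^ q / 2 ^ n₀ * pr L {e | H₀ *ᵥ e = H₀ *ᵥ x} = ∑ e, L e := by
  classical
  rw [← mul_sum]
  simp only [pr_eq_sum]
  rw [sum_comm, mul_sum]
  refine sum_congr rfl fun e _ => ?_
  have h1 := ncard_mulVec_eq (by simpa using hH) (H₀ *ᵥ e)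
  have h2 : ∑ x, (if e ∈ {e | H₀ *ᵥ e = H₀ *ᵥ x} then L e else 0) =
      ({x | H₀ *ᵥ x = H₀ *ᵥ e}.ncard : ℝ) * L e := by
    rw [← sum_ite_mem_one, sum_mul]
    refine sum_congr rfl fun x _ => ?_
    simp only [Set.mem_ofPred_eq, eq_comm (a := H₀ *ᵥ x), ite_mul, one_mul, zero_mul]
  have h3 : ({x | H₀ *ᵥ x = H₀ *ᵥ e}.ncard : ℝ) * 2 ^ q = 2 ^ n₀ := by
    rw [Fintype.card_fin] at h1
    exact_mod_cast h1
  rw [h2, ← h3]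
  have : ({x | H₀ *ᵥ x = H₀ *ᵥ e}.ncard : ℝ) ≠ 0 := by
    intro h0
    rw [h0, zero_mul] at h3
    exact absurd h3.symm (by positivity)
  field_simp

theorem sum_simProb_le (H₀ : Mat q n₀) (hH : H₀.rank = q)
    (hne : {H₁ : Mat m n₀ | (fromRows H₀ H₁).rank = q + m}.Nonempty) (π : P0Strategy n₀ m)
    (a : ZMod 2) (z : Fin m → ZMod 2) : ∑ W, simProb φ H₀ π a z W ≤ 1 := by
  refine le_of_eq ?_
  simp only [Fintype.sum_prod_type]
  have h1 : ∀ (h : Mat m n₀) w σ, ∑ g, simProb φ H₀ π a z (h, w, σ, g) =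
      unif {H₁ : Mat m n₀ | (fromRows H₀ H₁).rank = q + m} h *
        (unif Set.univ σ * (((2 : ℝ) ^ (2 * n₀))⁻¹ * ∏ i, pairMass φ (w i))) := by
    intro h w σ
    by_cases hh : h ∈ {H₁ : Mat m n₀ | (fromRows H₀ H₁).rank = q + m}
    swap
    · simp [simProb, unif_of_notMem hh]
    simp only [simProb, ← mul_sum]
    rw [sum_prod_pi fun x g => if x = a then 2 ^ q / 2 ^ n₀ *
      pr (stringWeight φ (heldPairs π x h σ w)) {e | H₀ *ᵥ e = H₀ *ᵥ g}
      else ∑ e, stringWeight φ (heldPairs π x h σ w) e *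
        unif {c : Fin n₀ → ZMod 2 | H₀ *ᵥ c = 0 ∧ h *ᵥ c = z} (g - e)]
    have h2 : ∀ x, ∑ g, (if x = a then 2 ^ q / 2 ^ n₀ *
        pr (stringWeight φ (heldPairs π x h σ w)) {e | H₀ *ᵥ e = H₀ *ᵥ g}
      else ∑ e, stringWeight φ (heldPairs π x h σ w) e *
        unif {c : Fin n₀ → ZMod 2 | H₀ *ᵥ c = 0 ∧ h *ᵥ c = z} (g - e)) =
      ∏ j, pairMass φ (heldPairs π x h σ w j) := by
      intro x
      rw [← sum_stringWeight]
      by_cases hx : x = a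
      · simp only [hx, if_true]
        exact sum_pr_syndrome hH _
      · simp only [hx, if_false]
        rw [sum_comm]
        refine sum_congr rfl fun e _ => ?_
        have h3 := Equiv.sum_comp (Equiv.subRight e)
          (unif {c : Fin n₀ → ZMod 2 | H₀ *ᵥ c = 0 ∧ h *ᵥ c = z})
        rw [sum_unif_codeword hh] at h3
        simp only [Equiv.subRight_apply] at h3
        rw [← mul_sum, h3, mul_one]
    simp only [h2]
    rw [prod_heldPairs]
    ring
  have h2 := sum_prod_pairMass φ (2 * n₀)
  rw [← mul_sum] at h2
  simp only [h1, ← mul_sum, ← sum_mul, sum_unif Set.univ_nonempty, one_mul, h2, sum_unif hne]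

end Run

/-! ### The expected leakage of one run of `P₀` -/

section NoiseLaw

variable {n m q : ℕ}

/-- The law of the noise on a string whose erased positions are those in `A`, when the other
positions are flipped with probability `η`. -/
noncomputable def noiseLaw (η : ℝ) (A : Finset (Fin n)) (e : Fin n → ZMod 2) : ℝ :=
  ∏ j, if j ∈ A then 1 / 2 else chan η (e j)

theorem noiseLaw_pos {η : ℝ} (h0 : 0 < η) (h1 : η < 1) (A : Finset (Fin n))
    (e : Fin n → ZMod 2) : 0 < noiseLaw η A e :=
  prod_pos fun j _ => by
    split_ifs
    exacts [by norm_num, chan_pos h0 h1 _]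

theorem sum_noiseLaw (η : ℝ) (A : Finset (Fin n)) : ∑ e, noiseLaw η A e = 1 := by
  simp only [noiseLaw]
  rw [sum_prod_pi fun j x => if j ∈ A then (1 / 2 : ℝ) else chan η x]
  refine prod_eq_one fun j _ => ?_
  split_ifs
  · simp [ZMod.card]
  · simpa using sum_chan η 0

/-- The power sum of a bit of bias `η`. -/
noncomputable def powerSum (η s : ℝ) : ℝ := η ^ (1 + s) + (1 - η) ^ (1 + s)

theorem powerSum_pos {η s : ℝ} (h0 : 0 < η) (h1 : η < 1) : 0 < powerSum η s :=
  add_pos (Real.rpow_pos_of_pos h0 _) (Real.rpow_pos_of_pos (sub_pos.2 h1) _)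

theorem two_mul_half_rpow (s : ℝ) : 2 * (1 / 2 : ℝ) ^ (1 + s) = (1 / 2) ^ s := by
  rw [Real.rpow_add (by norm_num), Real.rpow_one]
  ring

/-- Convexity of `t ↦ t^(1+s)`: the uniform bit has the least power sum, so erasures only decrease
the leakage bound. -/
theorem half_rpow_le_powerSum {η s : ℝ} (h0 : 0 < η) (h1 : η < 1) (hs : 0 < s) :
    (1 / 2 : ℝ) ^ s ≤ powerSum η s := by
  have := (convexOn_rpow (show 1 ≤ 1 + s by linarith)).2 (Set.mem_Ici.2 h0.le)
    (Set.mem_Ici.2 (sub_nonneg.2 h1.le)) (show (0 : ℝ) ≤ 1 / 2 by norm_num)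
    (show (0 : ℝ) ≤ 1 / 2 by norm_num) (by norm_num)
  simp only [smul_eq_mul] at this
  rw [← two_mul_half_rpow, powerSum]
  rw [show 1 / 2 * η + 1 / 2 * (1 - η) = 1 / 2 by ring] at this
  linarith

theorem sum_noiseLaw_rpow {η : ℝ} (h0 : 0 < η) (h1 : η < 1) (A : Finset (Fin n)) (s : ℝ) :
    ∑ e, noiseLaw η A e ^ (1 + s) = ((1 / 2 : ℝ) ^ s) ^ #A * powerSum η s ^ (n - #A) := by
  have e1 : ∀ e, noiseLaw η A e ^ (1 + s) =
      ∏ j, (if j ∈ A then (1 / 2 : ℝ) ^ (1 + s) else chan η (e j) ^ (1 + s)) := by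
    intro e
    rw [noiseLaw, ← Real.finsetProd_rpow _ _ fun j _ => ?_]
    · exact prod_congr rfl fun j _ => by split_ifs <;> rfl
    · split_ifs
      exacts [by norm_num, (chan_pos h0 h1 _).le]
  simp only [e1]
  rw [sum_prod_pi fun j x => if j ∈ A then (1 / 2 : ℝ) ^ (1 + s) else chan η x ^ (1 + s)]
  have e2 : ∀ j, ∑ x, (if j ∈ A then (1 / 2 : ℝ) ^ (1 + s) else chan η x ^ (1 + s)) =
      if j ∈ A then (1 / 2 : ℝ) ^ s else powerSum η s := by
    intro j
    split_ifs
    · rw [sum_const, card_univ, ZMod.card, nsmul_eq_mul, Nat.cast_ofNat, two_mul_half_rpow]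
    · rw [sum_zmod_two]
      simp [chan, powerSum, add_comm]
  simp only [e2]
  rw [prod_ite, prod_const, prod_const]
  congr 2
  · simp
  · rw [filter_not, card_sdiff_of_subset (filter_subset _ _)]
    simp

theorem exists_perm_filter_eq {A B : Finset (Fin n)} (h : #A = #B) :
    ∃ τ : Equiv.Perm (Fin n), ∀ j, τ j ∈ A ↔ j ∈ B := by
  let f : {j // j ∈ B} ≃ {j // j ∈ A} := Fintype.equivOfCardEq (by simp [h])
  refine ⟨f.extendSubtype, fun j => ⟨fun hj => ?_, fun hj => f.extendSubtype_mem j hj⟩⟩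
  by_contra hB
  exact f.extendSubtype_not_mem j hB hj

/-- A permutation carrying `B` to `A` is absorbed by the uniform law of `σ`, so after averaging only
the cardinality matters. -/
theorem sum_perm_filter_eq {A B : Finset (Fin n)} (h : #A = #B) (a : ZMod 2)
    (D : Finset (Fin n) → ℝ) :
    ∑ σ : ZMod 2 → Equiv.Perm (Fin n), unif Set.univ σ * D {j | σ a j ∈ A} =
      ∑ σ : ZMod 2 → Equiv.Perm (Fin n), unif Set.univ σ * D {j | σ a j ∈ B} := by
  obtain ⟨τ, hτ⟩ := exists_perm_filter_eq h
  rw [← Equiv.sum_comp (Equiv.mulLeft fun _ : ZMod 2 => τ)]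
  refine sum_congr rfl fun σ _ => ?_
  simp [unif_univ, hτ]

end NoiseLaw

/-! ### Erasures and the leakage of the secret not requested -/

section Leakage

variable {n₀ m q : ℕ} {φ : ℝ}

/-- The crossover probability of a bit that is not erased. -/
noncomputable def residualNoise (φ : ℝ) : ℝ := φ ^ 2 / (1 - 2 * φ * (1 - φ))

theorem erasure_lt_one (h0 : 0 < φ) (h1 : φ < 1 / 2) : 0 < 1 - 2 * φ * (1 - φ) := by nlinarith

theorem residualNoise_pos (h0 : 0 < φ) (h1 : φ < 1 / 2) : 0 < residualNoise φ :=
  div_pos (by positivity) (erasure_lt_one h0 h1)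

theorem residualNoise_lt_one (h0 : 0 < φ) (h1 : φ < 1 / 2) : residualNoise φ < 1 := by
  rw [residualNoise, div_lt_one (erasure_lt_one h0 h1)]
  nlinarith

theorem pairMass_eq (φ : ℝ) (w : Fin 2 → ZMod 2) :
    pairMass φ w = if w 0 ≠ w 1 then 2 * φ * (1 - φ) else 1 - 2 * φ * (1 - φ) := by
  simp only [pairMass, pairWeight, Fin.prod_univ_two, sum_zmod_two, chan]
  rcases (by decide : ∀ a : ZMod 2, a = 0 ∨ a = 1) (w 0) with h | h <;>
  rcases (by decide : ∀ a : ZMod 2, a = 0 ∨ a = 1) (w 1) with h' | h' <;>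
  simp [h, h'] <;> ring

/-- Bayes' rule for one position: after two different bits Alice's bit is uniform, and after two
equal bits it differs from them with probability `φ²/(1 - 2φ(1-φ))`. -/
theorem pairWeight_eq (h0 : 0 < φ) (h1 : φ < 1 / 2) (w : Fin 2 → ZMod 2) (β : ZMod 2) :
    pairWeight φ w β =
      pairMass φ w * if w 0 ≠ w 1 then 1 / 2 else chan (residualNoise φ) (β + w 0) := by
  have := (erasure_lt_one h0 h1).ne'
  have h11 : (1 : ZMod 2) + 1 = 0 := by decide
  rw [pairMass_eq]
  simp only [pairWeight, Fin.prod_univ_two, chan, residualNoise]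
  generalize hd : 1 - 2 * φ * (1 - φ) = d at *
  have e1 : d * (φ ^ 2 / d) = φ * φ := by field_simp
  have e2 : d * (1 - φ ^ 2 / d) = (1 - φ) * (1 - φ) := by
    rw [mul_sub, mul_one, mul_div_cancel₀ _ this]
    linear_combination -hd
  rcases (by decide : ∀ a : ZMod 2, a = 0 ∨ a = 1) (w 0) with h | h <;>
  rcases (by decide : ∀ a : ZMod 2, a = 0 ∨ a = 1) (w 1) with h' | h' <;>
  rcases (by decide : ∀ a : ZMod 2, a = 0 ∨ a = 1) β with hb | hb <;>
  simp only [h, h', hb, h11, sub_self, sub_zero, zero_sub, add_zero, zero_add, if_true,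
    ne_eq, not_true_eq_false, if_false, zero_ne_one, one_ne_zero, not_false_eq_true,
    neg_eq_zero, e1, e2] <;> ring

open Classical in
/-- The erased positions. -/
noncomputable def erasedSet {n : ℕ} (v : Fin n → Fin 2 → ZMod 2) : Finset (Fin n) :=
  {j | v j 0 ≠ v j 1}

theorem mem_erasedSet {n : ℕ} {v : Fin n → Fin 2 → ZMod 2} {j : Fin n} :
    j ∈ erasedSet v ↔ v j 0 ≠ v j 1 := by
  simp [erasedSet]

theorem stringWeight_eq {n : ℕ} (h0 : 0 < φ) (h1 : φ < 1 / 2) (v : Fin n → Fin 2 → ZMod 2)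
    (e : Fin n → ZMod 2) : stringWeight φ v e =
      (∏ j, pairMass φ (v j)) * noiseLaw (residualNoise φ) (erasedSet v) (e + fun j => v j 0) := by
  rw [stringWeight, noiseLaw, ← prod_mul_distrib]
  refine prod_congr rfl fun j _ => ?_
  rw [pairWeight_eq h0 h1]
  simp [erasedSet]

/-- The posterior of Alice's bits is a multiple of a translate of `noiseLaw`, and the ratio is
invariant under scaling and compatible with translation. -/
theorem sum_stringWeight_mul_logb (h0 : 0 < φ) (h1 : φ < 1 / 2) (H₀ : Mat q n₀) (h : Mat m n₀)
    (v : Fin n₀ → Fin 2 → ZMod 2) :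
    ∑ e, stringWeight φ v e * Real.logb 2 (hashRatio H₀ h (stringWeight φ v) e) =
      (∏ j, pairMass φ (v j)) *
        hashDivergence H₀ h (noiseLaw (residualNoise φ) (erasedSet v)) := by
  have hM : ∏ j, pairMass φ (v j) ≠ 0 :=
    (prod_pos fun j _ => pairMass_pos h0 (by linarith) _).ne'
  have e1 : stringWeight φ v = fun e => (∏ j, pairMass φ (v j)) *
      (fun e => noiseLaw (residualNoise φ) (erasedSet v) (e + fun j => v j 0)) e :=
    funext fun e => stringWeight_eq h0 h1 v e
  rw [← hashDivergence_comp_add fun j => v j 0, mul_sum]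
  refine sum_congr rfl fun e _ => ?_
  rw [e1, hashRatio_const_mul hM]
  ring

/-- The number of erasures. -/
noncomputable def erasures (w : Fin (2 * n₀) → Fin 2 → ZMod 2) : ℕ := #(erasedSet w)

theorem ncard_erased (w : Fin (2 * n₀) → Fin 2 → ZMod 2) (f : Fin n₀ → Fin (2 * n₀)) :
    {j | Erased w (f j)}.ncard = #(erasedSet fun j => w (f j)) := by
  classical
  rw [← Set.ncard_coe_finset]
  congr 1
  ext j
  simp [Erased, erasedSet]

theorem erasures_le (π : P0Strategy n₀ m) {b : ZMod 2} (hπ : π.AsksFor b) (h : Mat m n₀)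
    (w : Fin (2 * n₀) → Fin 2 → ZMod 2) :
    erasures w ≤ 2 * #(erasedSet fun j => w (π h w (b + 1, j))) := by
  classical
  have h1 := hπ h w
  rw [ncard_erased, ncard_erased] at h1
  have h2 : erasures w = ∑ a, #(erasedSet fun j => w (π h w (a, j))) := by
    have hc : ∀ {n : ℕ} (v : Fin n → Fin 2 → ZMod 2),
        #(erasedSet v) = ∑ j, if v j 0 ≠ v j 1 then 1 else 0 := by
      intro n v
      rw [erasedSet, card_filter]
    rw [erasures, hc, ← (π h w).sum_comp, Fintype.sum_prod_type]
    exact sum_congr rfl fun a _ => (hc _).symm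
  have h3 : ∀ f : ZMod 2 → ℕ, ∑ a, f a = f b + f (b + 1) := by
    intro f
    have h : ∑ x, f x = f 0 + f 1 := Fin.sum_univ_two f
    rcases (by decide : ∀ a : ZMod 2, a = 0 ∨ a = 1) b with rfl | rfl
    · simpa using h
    · rw [h, add_comm, show (1 : ZMod 2) + 1 = 0 by decide]
  rw [h2, h3]
  omega

/-- The positions are erased independently with probability `2φ(1-φ)`; this is the generating
function of the number of erasures. -/
theorem sum_pow_erasures (φ ρ : ℝ) (n₀ : ℕ) :
    ∑ w : Fin (2 * n₀) → Fin 2 → ZMod 2,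
      ((2 : ℝ) ^ (2 * n₀))⁻¹ * (∏ i, pairMass φ (w i)) * ρ ^ erasures w =
      (1 - 2 * φ * (1 - φ) + 2 * φ * (1 - φ) * ρ) ^ (2 * n₀) := by
  classical
  have h1 : ∀ w : Fin (2 * n₀) → Fin 2 → ZMod 2,
      ((2 : ℝ) ^ (2 * n₀))⁻¹ * (∏ i, pairMass φ (w i)) * ρ ^ erasures w =
      ∏ i, (2⁻¹ * pairMass φ (w i) * if w i 0 ≠ w i 1 then ρ else 1) := by
    intro w
    rw [prod_mul_distrib, prod_mul_distrib, prod_const, card_univ, Fintype.card_fin, inv_pow,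
      prod_ite, prod_const_one, mul_one, prod_const, erasures, erasedSet]
  simp only [h1]
  rw [sum_prod_pi fun _ x => 2⁻¹ * pairMass φ x * if x 0 ≠ x 1 then ρ else 1, prod_const,
    card_univ, Fintype.card_fin]
  congr 1
  rw [← (finTwoArrowEquiv (ZMod 2)).symm.sum_comp, Fintype.sum_prod_type]
  simp only [pairMass_eq, finTwoArrowEquiv_symm_apply, sum_zmod_two]
  simp
  ring

theorem sum_p0Prob_mul_logb_eq (h0 : 0 < φ) (h1 : φ < 1 / 2) (π : P0Strategy n₀ m)
    (H₀ : Mat q n₀) (sec : ZMod 2 → Fin m → ZMod 2) (a : ZMod 2) :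
    ∑ ρ, p0Prob φ H₀ sec ρ * Real.logb 2 (runRatio φ H₀ π a ρ) =
      ∑ h, unif {H₁ : Mat m n₀ | (fromRows H₀ H₁).rank = q + m} h *
        ∑ w : Fin (2 * n₀) → Fin 2 → ZMod 2, ((2 : ℝ) ^ (2 * n₀))⁻¹ *
          (∏ i, pairMass φ (w i)) * ∑ σ : ZMod 2 → Equiv.Perm (Fin n₀), unif Set.univ σ *
          hashDivergence H₀ h (noiseLaw (residualNoise φ)
            {j | σ a j ∈ erasedSet fun j => w (π h w (a, j))}) := by
  rw [sum_p0Prob_mul π H₀ sec a _ (fun h σ w e => Real.logb 2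
    (hashRatio H₀ h (stringWeight φ (heldPairs π a h σ w)) e))
    (fun h σ w r c => by rw [runRatio_runEquiv])]
  refine sum_congr rfl fun h _ => congrArg _ ?_
  simp only [sum_stringWeight_mul_logb h0 h1, mul_sum]
  rw [sum_comm]
  refine sum_congr rfl fun w _ => sum_congr rfl fun σ _ => ?_
  rw [← prod_heldPairs π h σ w, prod_zmod_two _ a]
  have : erasedSet (heldPairs π a h σ w) =
      ({j | σ a j ∈ erasedSet fun j => w (π h w (a, j))} : Finset _) := by
    ext j
    rw [mem_filter_univ, mem_erasedSet, mem_erasedSet]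
    rfl
  rw [this]
  ring

/-- Each erasure in the set gains a factor at most `1`; as the set holds at least half of all `t`
erasures, each of these is credited with its square root. -/
theorem rpow_mul_powerSum_le {η s : ℝ} (h0 : 0 < η) (h1 : η < 1) (hs : 0 < s) {e t n : ℕ}
    (he : e ≤ n) (ht : t ≤ 2 * e) :
    ((1 / 2 : ℝ) ^ s) ^ e * powerSum η s ^ (n - e) ≤
      powerSum η s ^ n * √((1 / 2 : ℝ) ^ s / powerSum η s) ^ t := by
  have hg := powerSum_pos (s := s) h0 h1
  have hκ : (0 : ℝ) < (1 / 2 : ℝ) ^ s := by positivity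
  have h2 : √((1 / 2 : ℝ) ^ s / powerSum η s) ≤ 1 := by
    rw [Real.sqrt_le_one, div_le_one hg]
    exact half_rpow_le_powerSum h0 h1 hs
  have h3 : ((1 / 2 : ℝ) ^ s / powerSum η s) ^ e = √((1 / 2 : ℝ) ^ s / powerSum η s) ^ (2 * e) := by
    rw [pow_mul, Real.sq_sqrt (by positivity)]
  calc ((1 / 2 : ℝ) ^ s) ^ e * powerSum η s ^ (n - e)
      = powerSum η s ^ n * ((1 / 2 : ℝ) ^ s / powerSum η s) ^ e := by
        rw [← Nat.sub_add_cancel he, pow_add, Nat.add_sub_cancel, div_pow]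
        field_simp
    _ ≤ _ := by
        rw [h3]
        exact mul_le_mul_of_nonneg_left (pow_le_pow_of_le_one (Real.sqrt_nonneg _) h2 ht)
          (by positivity)

/-- The expected leakage in one run of `P₀` about the secret that Bob does not ask for. -/
theorem sum_p0Prob_mul_logb_le (h0 : 0 < φ) (h1 : φ < 1 / 2) {π : P0Strategy n₀ m} {b : ZMod 2}
    (hπ : π.AsksFor b) {H₀ : Mat q n₀} (hH : H₀.rank = q) (hqm : q + m < n₀)
    (sec : ZMod 2 → Fin m → ZMod 2) {s l : ℝ} (hs : 0 < s) (hs1 : s ≤ 1) (hl : 0 < l) :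
    ∑ ρ, p0Prob φ H₀ sec ρ * Real.logb 2 (runRatio φ H₀ π (b + 1) ρ) ≤
      (n₀ + 1) * ((2 * ((2 : ℝ) ^ (q + m) * ((2 : ℝ) ^ n₀)⁻¹) + l⁻¹ +
        l ^ s / s * (((2 : ℝ) ^ (q + m)) ^ s * (powerSum (residualNoise φ) s ^ n₀ *
          (1 - 2 * φ * (1 - φ) + 2 * φ * (1 - φ) *
            √((1 / 2 : ℝ) ^ s / powerSum (residualNoise φ) s)) ^ (2 * n₀)))) / Real.log 2) := by
  classical
  set η := residualNoise φ
  set g := powerSum η s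
  set ρ := √((1 / 2 : ℝ) ^ s / g)
  set P : (Fin (2 * n₀) → Fin 2 → ZMod 2) → ℝ := fun w =>
    ((2 : ℝ) ^ (2 * n₀))⁻¹ * (∏ i, pairMass φ (w i)) with hPdef
  set S := {H₁ : Mat m n₀ | (fromRows H₀ H₁).rank = q + m}
  have hη0 : 0 < η := residualNoise_pos h0 h1
  have hη1 : η < 1 := residualNoise_lt_one h0 h1
  have hg : 0 < g := powerSum_pos hη0 hη1
  have hlog2 : 0 < Real.log 2 := Real.log_pos one_lt_two
  have hP0 : ∀ w, 0 ≤ P w := fun w =>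
    mul_nonneg (by positivity) (prod_nonneg fun i _ => (pairMass_pos h0 (by linarith) _).le)
  have hP1 : ∑ w, P w = 1 := sum_prod_pairMass φ (2 * n₀)
  -- A reference set of each size, independent of Bob's choices.
  let C : ℕ → Finset (Fin n₀) := fun e => {j | (j : ℕ) < e}
  have hC : ∀ e ≤ n₀, #(C e) = e := by
    intro e he
    simp [C, Fin.card_filter_val_lt, he]
  have hD0 : ∀ h A, 0 ≤ hashDivergence H₀ h (noiseLaw η A) (m := m) := fun h A =>
    hashDivergence_nonneg (noiseLaw_pos hη0 hη1 A) (sum_noiseLaw η A)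
  let B : (Fin (2 * n₀) → Fin 2 → ZMod 2) → ℝ := fun w =>
    (2 * ((2 : ℝ) ^ (q + m) * ((2 : ℝ) ^ n₀)⁻¹) + l⁻¹ +
      l ^ s / s * (((2 : ℝ) ^ (q + m)) ^ s * (g ^ n₀ * ρ ^ erasures w))) / Real.log 2
  have hB0 : ∀ w, 0 ≤ B w := fun w => by positivity
  have hDB : ∀ w, ∀ e ∈ range (n₀ + 1), ∀ σ : ZMod 2 → Equiv.Perm (Fin n₀),
      erasures w ≤ 2 * e → ∑ h, unif S h *
        hashDivergence H₀ h (noiseLaw η {j | σ (b + 1) j ∈ C e}) ≤ B w := by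
    intro w e he σ hw
    have he' : e ≤ n₀ := Nat.lt_succ_iff.1 (mem_range.1 he)
    refine (sum_unif_mul_hashDivergence_le hH hqm (noiseLaw_pos hη0 hη1 _) (sum_noiseLaw η _)
      hs hs1 hl).trans ?_
    have hcard : #({j | σ (b + 1) j ∈ C e} : Finset (Fin n₀)) = e := by
      have : ({j | σ (b + 1) j ∈ C e} : Finset (Fin n₀)) =
          (C e).map (σ (b + 1)).symm.toEmbedding := by
        ext j
        simp [mem_map_equiv]
      rw [this, card_map, hC e he']
    rw [sum_noiseLaw_rpow hη0 hη1, hcard]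
    have := rpow_mul_powerSum_le hη0 hη1 hs he' hw
    simp only [B]
    gcongr
  rw [sum_p0Prob_mul_logb_eq h0 h1]
  -- Bob's erased set depends on `h`. The average over `σ` replaces it by the reference set of the
  -- same size, and this size is replaced by a sum over all `e` with `2e` at least the number of
  -- erasures. Nothing but the divergence then depends on `h`, so the average over `h` moves inside,
  -- at the cost of a factor `n₀ + 1`.
  calc ∑ h, unif S h * ∑ w, P w * ∑ σ : ZMod 2 → Equiv.Perm (Fin n₀), unif Set.univ σ *
          hashDivergence H₀ h (noiseLaw η
            {j | σ (b + 1) j ∈ erasedSet fun j => w (π h w (b + 1, j))})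
      ≤ ∑ h, unif S h * ∑ w, P w * ∑ e ∈ range (n₀ + 1), if erasures w ≤ 2 * e then
          ∑ σ : ZMod 2 → Equiv.Perm (Fin n₀), unif Set.univ σ *
          hashDivergence H₀ h (noiseLaw η {j | σ (b + 1) j ∈ C e}) else 0 := by
        refine sum_le_sum fun h _ => mul_le_mul_of_nonneg_left (sum_le_sum fun w _ =>
          mul_le_mul_of_nonneg_left ?_ (hP0 w)) (unif_nonneg S h)
        set A₀ := erasedSet fun j => w (π h w (b + 1, j))
        have hA : #A₀ ≤ n₀ := by simpa using card_le_univ A₀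
        have hw : erasures w ≤ 2 * #A₀ := erasures_le π hπ h w
        rw [sum_perm_filter_eq (hC _ hA).symm (b + 1) fun A => hashDivergence H₀ h (noiseLaw η A)]
        refine le_trans (le_of_eq ?_) (single_le_sum (fun e _ => ?_)
          (mem_range.2 (Nat.lt_succ_of_le hA)))
        · rw [if_pos hw]
        · split_ifs
          · exact sum_nonneg fun σ _ => mul_nonneg (unif_nonneg _ _) (hD0 _ _)
          · exact le_rfl
    _ = ∑ w, P w * ∑ e ∈ range (n₀ + 1), if erasures w ≤ 2 * e then
          ∑ σ : ZMod 2 → Equiv.Perm (Fin n₀), unif Set.univ σ * ∑ h, unif S h *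
          hashDivergence H₀ h (noiseLaw η {j | σ (b + 1) j ∈ C e}) else 0 := by
        simp only [mul_sum]
        rw [sum_comm]
        refine sum_congr rfl fun w _ => ?_
        rw [sum_comm]
        refine sum_congr rfl fun e _ => ?_
        split_ifs
        · simp only [mul_sum]
          rw [sum_comm]
          exact sum_congr rfl fun σ _ => sum_congr rfl fun h _ => by ring
        · simp
    _ ≤ ∑ w, P w * ∑ e ∈ range (n₀ + 1), B w := by
        refine sum_le_sum fun w _ => mul_le_mul_of_nonneg_left (sum_le_sum fun e he => ?_) (hP0 w)
        split_ifs with hw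
        · refine (sum_le_sum fun σ _ => mul_le_mul_of_nonneg_left (hDB w e he σ hw)
            (unif_nonneg _ _)).trans ?_
          rw [← sum_mul, sum_unif Set.univ_nonempty, one_mul]
        · exact hB0 w
    _ = (n₀ + 1) * ∑ w, P w * B w := by
        simp only [sum_const, card_range, nsmul_eq_mul, mul_sum]
        push_cast
        exact sum_congr rfl fun w _ => by ring
    _ = (n₀ + 1) * ((2 * ((2 : ℝ) ^ (q + m) * ((2 : ℝ) ^ n₀)⁻¹) + l⁻¹ +
        l ^ s / s * (((2 : ℝ) ^ (q + m)) ^ s * (g ^ n₀ *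
          (1 - 2 * φ * (1 - φ) + 2 * φ * (1 - φ) * ρ) ^ (2 * n₀)))) / Real.log 2) := by
        congr 1
        rw [← sum_pow_erasures φ ρ n₀]
        have : ∀ w, P w * B w = (2 * ((2 : ℝ) ^ (q + m) * ((2 : ℝ) ^ n₀)⁻¹) + l⁻¹) / Real.log 2 *
            P w + l ^ s / s * (((2 : ℝ) ^ (q + m)) ^ s * g ^ n₀) / Real.log 2 *
              (P w * ρ ^ erasures w) := fun w => by
          simp only [B]
          ring
        simp only [this]
        rw [sum_add_distrib, ← mul_sum _ P, hP1, ← mul_sum _ fun w => P w * ρ ^ erasures w]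
        ring

end Leakage

/-! ### The leakage is exponentially small below capacity -/

section Exponent

variable {φ : ℝ}

/-- The limit rate, in bits per position, of the syndrome and the secret. -/
noncomputable def rateBound (φ ε : ℝ) : ℝ :=
  1 - (1 - 2 * φ * (1 - φ)) * (1 - binEnt (residualNoise φ)) - ε

/-- The base of the exponential bound on the leakage. -/
noncomputable def leakageBase (φ ε s : ℝ) : ℝ :=
  (2 : ℝ) ^ (s * rateBound φ ε) * powerSum (residualNoise φ) s *
    (1 - 2 * φ * (1 - φ) + 2 * φ * (1 - φ) *
      √((1 / 2 : ℝ) ^ s / powerSum (residualNoise φ) s)) ^ 2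

theorem hasDerivAt_powerSum {η : ℝ} (h0 : 0 < η) (h1 : η < 1) :
    HasDerivAt (powerSum η) (-Real.binEntropy η) 0 := by
  have e1 : HasDerivAt (fun s : ℝ => 1 + s) 1 0 := (hasDerivAt_id (0 : ℝ)).const_add 1
  have h := (e1.const_rpow h0).add (e1.const_rpow (sub_pos.2 h1))
  simp only [add_zero, Real.rpow_one, mul_one] at h
  refine (show HasDerivAt (powerSum η) _ 0 from h).congr_deriv ?_
  rw [Real.binEntropy_eq_negMulLog_add_negMulLog_one_sub, Real.negMulLog, Real.negMulLog]
  ring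

/-- With `p = 2φ(1-φ)`, the logarithmic derivative in bits is `R - h(η) + p (h(η) - 1)`: the square
root and the square cancel. The rate `R = 1 - (1-p)(1-h(η)) - ε` leaves exactly `-ε`. -/
theorem hasDerivAt_leakageBase (h0 : 0 < φ) (h1 : φ < 1 / 2) (ε : ℝ) :
    HasDerivAt (leakageBase φ ε) (-(ε * Real.log 2)) 0 := by
  set η := residualNoise φ with hη
  set p := 2 * φ * (1 - φ)
  have hg := hasDerivAt_powerSum (residualNoise_pos h0 h1) (residualNoise_lt_one h0 h1)
  have hg0 : powerSum η 0 = 1 := by simp [powerSum]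
  have hr : HasDerivAt (fun s : ℝ => (2 : ℝ) ^ (s * rateBound φ ε))
      (Real.log 2 * rateBound φ ε) 0 := by
    have := ((hasDerivAt_id (0 : ℝ)).mul_const (rateBound φ ε)).const_rpow two_pos
    simpa using this
  have hκ : HasDerivAt (fun s : ℝ => (1 / 2 : ℝ) ^ s) (-Real.log 2) 0 := by
    have := (hasDerivAt_id (0 : ℝ)).const_rpow (show (0 : ℝ) < 1 / 2 by norm_num)
    simpa using this
  have hq := hκ.div hg (by rw [hg0]; exact one_ne_zero)
  have hsq := hq.sqrt (by simp [hg0, ← hη])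
  have hmix := ((hsq.const_mul p).const_add (1 - p)).pow 2
  have := (hr.mul hg).mul hmix
  refine this.congr_deriv ?_
  simp only [Pi.div_apply, Pi.mul_apply, ← hη, hg0, zero_mul, Real.rpow_zero, div_one, mul_one,
    Real.sqrt_one, one_pow, Pi.pow_apply]
  rw [rateBound, binEnt]
  have hL := (Real.log_pos one_lt_two).ne'
  field_simp
  norm_num
  ring

theorem leakageBase_pos (h0 : 0 < φ) (h1 : φ < 1 / 2) (ε s : ℝ) : 0 < leakageBase φ ε s := by
  have e1 := erasure_lt_one h0 h1
  have e2 := powerSum_pos (s := s) (residualNoise_pos h0 h1) (residualNoise_lt_one h0 h1)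
  have e3 : 0 ≤ 2 * φ * (1 - φ) := by nlinarith
  unfold leakageBase
  positivity

theorem exists_leakageBase_lt_one (h0 : 0 < φ) (h1 : φ < 1 / 2) {ε : ℝ} (hε : 0 < ε) :
    ∃ s, 0 < s ∧ s ≤ 1 ∧ leakageBase φ ε s < 1 := by
  have h := (hasDerivAt_leakageBase h0 h1 ε).tendsto_slope
  have hL := Real.log_pos one_lt_two
  have h2 : ∀ᶠ s in 𝓝[≠] (0 : ℝ), slope (leakageBase φ ε) 0 s < 0 :=
    h.eventually_lt_const (by nlinarith)
  have h3 : ∀ᶠ s in 𝓝[>] (0 : ℝ), slope (leakageBase φ ε) 0 s < 0 :=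
    h2.filter_mono (nhdsWithin_mono _ fun x hx => (Set.mem_Ioi.1 hx).ne')
  have h4 : ∀ᶠ s in 𝓝[>] (0 : ℝ), s ∈ Set.Ioc (0 : ℝ) 1 := Ioc_mem_nhdsGT one_pos
  obtain ⟨s, hs, hs'⟩ := (h3.and h4).exists
  refine ⟨s, hs'.1, hs'.2, ?_⟩
  have h5 : leakageBase φ ε 0 = 1 := by simp [leakageBase, powerSum]
  rw [slope_def_field, h5, sub_zero, div_neg_iff] at hs
  rcases hs with hs | hs
  · linarith [hs'.1, hs.2]
  · linarith [hs.1]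

theorem binEnt_le_one (η : ℝ) : binEnt η ≤ 1 :=
  div_le_one_of_le₀ Real.binEntropy_le_log_two (Real.log_nonneg one_le_two)

theorem rateBound_le (h0 : 0 < φ) (h1 : φ < 1 / 2) (ε : ℝ) : rateBound φ ε ≤ 1 - ε := by
  have e1 := erasure_lt_one h0 h1
  have e2 := binEnt_le_one (residualNoise φ)
  unfold rateBound
  nlinarith

/-- The syndrome costs `n₀ - k₀ = n₀ (1 - R₀)` bits, so `R₀` cancels from the total number of
revealed bits. A positive `m` excludes `n₀ = 0`, where the rate is a default value. -/
theorem add_le_rateBound {n₀ k₀ m : ℕ} {ε : ℝ} (hm : 0 < m) (hk : k₀ ≤ n₀)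
    (h : (m : ℝ) ≤ n₀ * ((k₀ : ℝ) / n₀ -
      (1 - 2 * φ * (1 - φ)) * (1 - binEnt (φ ^ 2 / (1 - 2 * φ * (1 - φ)))) - ε)) :
    ((n₀ - k₀ + m : ℕ) : ℝ) ≤ n₀ * rateBound φ ε ∧ 0 < n₀ := by
  have hn : 0 < n₀ := by
    rcases Nat.eq_zero_or_pos n₀ with rfl | hn
    · rw [Nat.cast_zero, zero_mul] at h
      exact absurd (Nat.cast_pos.2 hm) (not_lt.2 h)
    · exact hn
  have hn' : (0 : ℝ) < n₀ := Nat.cast_pos.2 hn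
  refine ⟨?_, hn⟩
  push_cast [hk]
  rw [rateBound, residualNoise]
  have e : (n₀ : ℝ) * ((k₀ : ℝ) / n₀ - (1 - 2 * φ * (1 - φ)) *
      (1 - binEnt (φ ^ 2 / (1 - 2 * φ * (1 - φ)))) - ε) = k₀ + n₀ * (-((1 - 2 * φ * (1 - φ)) *
      (1 - binEnt (φ ^ 2 / (1 - 2 * φ * (1 - φ))))) - ε) := by
    field_simp
    ring
  rw [e] at h
  linarith

theorem exists_leakage_bound (h0 : 0 < φ) (h1 : φ < 1 / 2) {ε : ℝ} (hε : 0 < ε) :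
    ∃ C c : ℝ, 0 < C ∧ 0 < c ∧ ∀ (n₀ m q : ℕ) (H₀ : Mat q n₀), H₀.rank = q → 0 < n₀ →
      ((q + m : ℕ) : ℝ) ≤ n₀ * rateBound φ ε → q + m < n₀ ∧
      ∀ (π : P0Strategy n₀ m) (b : ZMod 2) (sec : ZMod 2 → Fin m → ZMod 2), π.AsksFor b →
        ∑ ρ, p0Prob φ H₀ sec ρ * Real.logb 2 (runRatio φ H₀ π (b + 1) ρ) ≤
          C * Real.exp (-(c * m)) := by
  obtain ⟨s, hs, hs1, hΓ⟩ := exists_leakageBase_lt_one h0 h1 hε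
  set Γ := leakageBase φ ε s with hΓdef
  have hΓ0 : 0 < Γ := leakageBase_pos h0 h1 ε s
  have hlog2 : 0 < Real.log 2 := Real.log_pos one_lt_two
  -- With `l = γ^(-n₀)` both `l⁻¹` and `l Γ^n₀` equal `γ^n₀`, which balances the terms of the
  -- leakage bound.
  set γ := √Γ with hγ
  have hγ0 : 0 < γ := Real.sqrt_pos.2 hΓ0
  have hγ1 : γ < 1 := by rw [hγ, Real.sqrt_lt' one_pos]; simpa using hΓ
  have hγΓ : γ * γ = Γ := Real.mul_self_sqrt hΓ0.le
  -- The term `2^(-ε)` accounts for rank deficiency of the matrix with blocks `H₀`, `H₁`.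
  set ζ := max γ ((2 : ℝ) ^ (-ε)) with hζ
  have hζ0 : 0 < ζ := lt_max_of_lt_left hγ0
  have hζ1 : ζ < 1 := max_lt hγ1 (Real.rpow_lt_one_of_one_lt_of_neg one_lt_two (by linarith))
  set c := -Real.log ζ
  have hc : 0 < c := neg_pos.2 (Real.log_neg hζ0 hζ1)
  set C := (2 + 1 + 1 / s) / Real.log 2
  have hC : 0 < C := by positivity
  refine ⟨C * (2 / c + 1), c / 2, by positivity, by positivity, ?_⟩
  intro n₀ m q H₀ hH hn hrate
  have hn' : (0 : ℝ) < n₀ := Nat.cast_pos.2 hn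
  have hrε := mul_le_mul_of_nonneg_left (rateBound_le h0 h1 ε) hn'.le
  have hqm : q + m < n₀ := by
    have : ((q + m : ℕ) : ℝ) < n₀ := by nlinarith
    exact_mod_cast this
  refine ⟨hqm, fun π b sec hπ => ?_⟩
  set l : ℝ := (γ ^ n₀)⁻¹ with hl
  have hγn : 0 < γ ^ n₀ := by positivity
  have hl0 : 0 < l := inv_pos.2 hγn
  have hl1 : 1 ≤ l := (one_le_inv₀ hγn).2 (pow_le_one₀ hγ0.le hγ1.le)
  have hζn : γ ^ n₀ ≤ ζ ^ n₀ := pow_le_pow_left₀ hγ0.le (le_max_left _ _) _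
  have b1 : (2 : ℝ) ^ (q + m) * ((2 : ℝ) ^ n₀)⁻¹ ≤ ζ ^ n₀ := by
    calc (2 : ℝ) ^ (q + m) * ((2 : ℝ) ^ n₀)⁻¹ = (2 : ℝ) ^ (((q + m : ℕ) : ℝ) - n₀) := by
          rw [Real.rpow_sub two_pos, Real.rpow_natCast, Real.rpow_natCast, div_eq_mul_inv]
      _ ≤ (2 : ℝ) ^ (-ε * n₀) :=
          Real.rpow_le_rpow_of_exponent_le one_le_two (by linarith)
      _ = ((2 : ℝ) ^ (-ε)) ^ n₀ := by rw [Real.rpow_mul two_pos.le, Real.rpow_natCast]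
      _ ≤ ζ ^ n₀ := pow_le_pow_left₀ (by positivity) (le_max_right _ _) _
  have b2 : l⁻¹ ≤ ζ ^ n₀ := by rwa [hl, inv_inv]
  have hmix : 0 ≤ 1 - 2 * φ * (1 - φ) + 2 * φ * (1 - φ) *
      √((1 / 2 : ℝ) ^ s / powerSum (residualNoise φ) s) := by
    have e1 := erasure_lt_one h0 h1
    have e3 : 0 ≤ 2 * φ * (1 - φ) := by nlinarith
    positivity
  have hg := powerSum_pos (s := s) (residualNoise_pos h0 h1) (residualNoise_lt_one h0 h1)
  have b3 : ((2 : ℝ) ^ (q + m)) ^ s * (powerSum (residualNoise φ) s ^ n₀ *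
      (1 - 2 * φ * (1 - φ) + 2 * φ * (1 - φ) *
        √((1 / 2 : ℝ) ^ s / powerSum (residualNoise φ) s)) ^ (2 * n₀)) ≤ Γ ^ n₀ := by
    have e1 : ((2 : ℝ) ^ (q + m)) ^ s ≤ ((2 : ℝ) ^ (s * rateBound φ ε)) ^ n₀ := by
      rw [← Real.rpow_natCast, ← Real.rpow_mul two_pos.le, ← Real.rpow_natCast,
        ← Real.rpow_mul two_pos.le]
      refine Real.rpow_le_rpow_of_exponent_le one_le_two ?_
      have := mul_le_mul_of_nonneg_left hrate hs.le
      linarith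
    rw [hΓdef, leakageBase, mul_pow, mul_pow, pow_mul, ← mul_assoc]
    refine mul_le_mul_of_nonneg_right (mul_le_mul_of_nonneg_right e1 ?_) ?_ <;> positivity
  have b4 : l ^ s / s * Γ ^ n₀ ≤ 1 / s * ζ ^ n₀ := by
    have e1 : l ^ s ≤ l := by
      simpa using Real.rpow_le_rpow_of_exponent_le hl1 hs1
    calc l ^ s / s * Γ ^ n₀ ≤ l / s * Γ ^ n₀ := by gcongr
      _ = 1 / s * γ ^ n₀ := by
          rw [← hγΓ, mul_pow, hl]
          field_simp
      _ ≤ _ := by gcongr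
  refine (sum_p0Prob_mul_logb_le h0 h1 hπ hH hqm sec hs hs1 hl0).trans ?_
  calc _ ≤ ((n₀ : ℝ) + 1) * ((2 * ζ ^ n₀ + ζ ^ n₀ + 1 / s * ζ ^ n₀) / Real.log 2) := by
        refine mul_le_mul_of_nonneg_left (div_le_div_of_nonneg_right (add_le_add (add_le_add
          (mul_le_mul_of_nonneg_left b1 two_pos.le) b2) (le_trans ?_ b4)) hlog2.le) (by positivity)
        exact mul_le_mul_of_nonneg_left b3 (by positivity)
    _ = C * ((n₀ + 1) * Real.exp (-(c * n₀))) := by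
        have : Real.exp (-(c * n₀)) = ζ ^ n₀ := by
          rw [show -(c * (n₀ : ℝ)) = Real.log ζ * n₀ by simp only [c]; ring,
            ← Real.rpow_def_of_pos hζ0, Real.rpow_natCast]
        rw [this]
        simp only [C]
        ring
    _ ≤ C * ((2 / c + 1) * Real.exp (-(c / 2 * n₀))) :=
        mul_le_mul_of_nonneg_left (add_one_mul_exp_le hc n₀) hC.le
    -- Decay in `n₀` implies decay in `m`, since `m ≤ n₀`.
    _ ≤ C * (2 / c + 1) * Real.exp (-(c / 2 * m)) := by
        rw [← mul_assoc]
        refine mul_le_mul_of_nonneg_left (Real.exp_le_exp.2 ?_) (by positivity)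
        have : (m : ℝ) ≤ n₀ := by exact_mod_cast (by omega : m ≤ n₀)
        have := mul_le_mul_of_nonneg_left this (half_pos hc).le
        linarith

end Exponent

/-! ### The `n` runs of `P₀` in the protocol -/

section Protocol

variable {ι κ : Type} [Fintype ι] [DecidableEq ι] [Fintype κ]

theorem pr_pi (f : ι → κ → ℝ) (A : ι → Set κ) :
    pr (fun ρ : ι → κ => ∏ l, f l (ρ l)) {ρ | ∀ l, ρ l ∈ A l} = ∏ l, pr (f l) (A l) := by
  classical
  simp only [pr_eq_sum]
  rw [← sum_prod_pi fun l x => if x ∈ A l then f l x else 0]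
  refine sum_congr rfl fun ρ _ => ?_
  by_cases h : ρ ∈ {ρ : ι → κ | ∀ l, ρ l ∈ A l}
  · rw [if_pos h]
    exact prod_congr rfl fun l _ => (if_pos (h l)).symm
  · rw [if_neg h]
    obtain ⟨l, hl⟩ := not_forall.1 h
    exact (prod_eq_zero (mem_univ l) (if_neg hl)).symm

theorem sum_prod_mul_sum (p f : ι → κ → ℝ) (hp : ∀ l, ∑ x, p l x = 1) :
    ∑ ρ : ι → κ, (∏ l, p l (ρ l)) * ∑ l, f l (ρ l) = ∑ l, ∑ x, p l x * f l x := by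
  simp only [mul_sum]
  rw [sum_comm]
  refine sum_congr rfl fun j _ => ?_
  have h1 : ∀ ρ : ι → κ, (∏ l, p l (ρ l)) * f j (ρ j) =
      ∏ l, (p l (ρ l) * if l = j then f l (ρ l) else 1) := by
    intro ρ
    rw [prod_mul_distrib, prod_ite_eq' univ j fun l => f l (ρ l), if_pos (mem_univ j)]
  simp only [h1]
  rw [sum_prod_pi fun l x => p l x * if l = j then f l x else 1,
    prod_eq_single j (fun l _ hl => by simp [hl, hp]) (by simp)]
  simp

variable {r k m n n₀ q : ℕ} {φ : ℝ}

/-- The random choices that precede the runs of `P₀`. -/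
abbrev Base (r k m n : ℕ) : Type := Mat k r × Mat k r × (Mat r m × Mat r m × Mat n m)

/-- An execution consists of the choices that precede the runs, and the runs. -/
def executionEquiv (r k m n n₀ : ℕ) :
    Base r k m n × (Fin n → P0Run n₀ m) ≃ Execution r k m n n₀ where
  toFun x := ⟨x.1.1, x.1.2.1, x.1.2.2.1, x.1.2.2.2.1, x.1.2.2.2.2, x.2⟩
  invFun ω := ((ω.Ms, ω.Mt, ω.s, ω.t, ω.x), ω.run)
  left_inv _ := rfl
  right_inv _ := rfl

/-- The law of the choices that precede the runs. -/
noncomputable def baseProb (H : Mat r n) (𝓜 : Set (Mat k r)) (β : Base r k m n) : ℝ :=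
  unif 𝓜 β.1 * unif 𝓜 β.2.1 * stringsProb H β.2.2

theorem baseProb_nonneg (H : Mat r n) (𝓜 : Set (Mat k r)) (β : Base r k m n) :
    0 ≤ baseProb H 𝓜 β :=
  mul_nonneg (mul_nonneg (unif_nonneg _ _) (unif_nonneg _ _)) (stringsProb_nonneg _ _)

theorem sum_baseProb {H : Mat r n} (hH : H * Hᵀ = 1) {𝓜 : Set (Mat k r)} (h𝓜 : 𝓜.Nonempty) :
    ∑ β : Base r k m n, baseProb H 𝓜 β = 1 := by
  have h := sum_stringsProb (m := m) hH
  simp only [baseProb]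
  rw [Fintype.sum_prod_type]
  simp only [Fintype.sum_prod_type (α₁ := Mat k r), ← mul_sum, h, mul_one, sum_unif h𝓜]

/-- The secrets of the `ℓ`-th run. -/
def Base.secret (H : Mat r n) (β : Base r k m n) (l : Fin n) : ZMod 2 → Fin m → ZMod 2 :=
  fun a => if a = 0 then β.2.2.2.2 l else (β.2.2.2.2 + Hᵀ * (β.2.2.1 + β.2.2.2.1)) l

/-- The law of the runs. -/
noncomputable def runsProb (φ : ℝ) (H₀ : Mat q n₀) (H : Mat r n) (β : Base r k m n)
    (ρ : Fin n → P0Run n₀ m) : ℝ :=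
  ∏ l, p0Prob φ H₀ (β.secret H l) (ρ l)

theorem prob_executionEquiv (H₀ : Mat q n₀) (H : Mat r n) (𝓜 : Set (Mat k r)) :
    Execution.prob φ H₀ H 𝓜 ∘ executionEquiv r k m n n₀ =
      fun x => baseProb H 𝓜 x.1 * runsProb φ H₀ H x.1 x.2 := by
  ext x
  change unif 𝓜 x.1.1 * unif 𝓜 x.1.2.1 * unif Set.univ x.1.2.2.1 * unif Set.univ x.1.2.2.2.1 *
    unif {y : Mat n m | H * y = x.1.2.2.1} x.1.2.2.2.2 * runsProb φ H₀ H x.1 x.2 = _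
  rw [baseProb, stringsProb]
  ring

theorem prob_nonneg (h0 : 0 < φ) (h1 : φ < 1) (H₀ : Mat q n₀) (H : Mat r n) (𝓜 : Set (Mat k r))
    (ω : Execution r k m n n₀) : 0 ≤ Execution.prob φ H₀ H 𝓜 ω := by
  obtain ⟨x, rfl⟩ := (executionEquiv r k m n n₀).surjective ω
  have := congrFun (prob_executionEquiv (φ := φ) H₀ H 𝓜) x
  simp only [Function.comp_apply] at this
  rw [this]
  exact mul_nonneg (baseProb_nonneg _ _ _) (prod_nonneg fun l _ => p0Prob_nonneg h0 h1 _ _ _)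

/-- What Bob knows before he sees the runs, if he is given the requested strings and `S`. -/
def Base.known {α : Type} (H : Mat r n) (u : Fin n → ZMod 2) (S : Base r k m n → α)
    (β : Base r k m n) : α × Mat n m × Mat k r × Mat k r :=
  (S β, requestedStrings H u β.2.2.1 β.2.2.2.1 β.2.2.2.2, β.1, β.2.1)

theorem requestedStrings_apply (H : Mat r n) (u : Fin n → ZMod 2) (β : Base r k m n)
    (l : Fin n) :
    requestedStrings H u β.2.2.1 β.2.2.2.1 β.2.2.2.2 l = β.secret H l (u l) := by
  -- The requested strings do not depend on the runs, so trivial runs are filled in.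
  have h := requested_eq (n₀ := 0) H u ⟨β.1, β.2.1, β.2.2.1, β.2.2.2.1, β.2.2.2.2, fun _ =>
    ⟨0, 0, 1, 0, 0⟩⟩
  exact (congrFun h l).symm

/-- The runs of `P₀` reveal little beyond the requested strings. -/
theorem condEntropy_base_sub_le {α : Type} [Fintype α] (h0 : 0 < φ) (h1 : φ < 1) {H₀ : Mat q n₀}
    (hH₀ : H₀.rank = q) (hqm : q + m < n₀) {H : Mat r n} (hH : H * Hᵀ = 1) {𝓜 : Set (Mat k r)}
    (h𝓜 : 𝓜.Nonempty) (u : Fin n → ZMod 2) (π : Fin n → P0Strategy n₀ m)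
    (X S : Base r k m n → α) {c : ℝ}
    (hc : ∀ l sec, ∑ ρ, p0Prob φ H₀ sec ρ * Real.logb 2 (runRatio φ H₀ (π l) (u l + 1) ρ) ≤ c) :
    condEntropy (baseProb H 𝓜) X (Base.known H u S) - n * c ≤
      condEntropy (Execution.prob φ H₀ H 𝓜)
        (fun ω : Execution r k m n n₀ => X ((executionEquiv r k m n n₀).symm ω).1)
        (fun ω => (S ((executionEquiv r k m n n₀).symm ω).1, ω.view H u π)) := by
  have hne := nonempty_rank_fromRows (m := m) hH₀ hqm
  have hratio : ∀ l (ρ : P0Run n₀ m), 0 < runRatio φ H₀ (π l) (u l + 1) ρ := fun l ρ =>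
    hashRatio_pos (stringWeight_pos h0 h1 _) _
  have huu : ∀ l, u l + 1 + 1 = u l := fun l => (by decide : ∀ a : ZMod 2, a + 1 + 1 = a) (u l)
  -- The simulator of each run needs only the requested string, which is part of the prior
  -- knowledge; the secret it replaces has index `u l + 1`. Ratios and simulators multiply over the
  -- runs.
  have hmain := condEntropy_sub_le_condEntropy_prod (p := baseProb H 𝓜)
    (K := runsProb φ H₀ H) X (Base.known H u S) (fun ρ l => (ρ l).view (π l))
    (fun _ ρ => ∏ l, runRatio φ H₀ (π l) (u l + 1) (ρ l))
    (fun y W => ∏ l, simProb φ H₀ (π l) (u l + 1) (y.2.1 l) (W l))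
    (baseProb_nonneg H 𝓜) (sum_baseProb hH h𝓜)
    (fun β ρ => prod_nonneg fun l _ => p0Prob_nonneg h0 h1 _ _ _)
    (fun β _ => by
      simp only [runsProb]
      rw [sum_prod_pi fun l x => p0Prob φ H₀ (β.secret H l) x]
      exact prod_eq_one fun l _ => sum_p0Prob hne _)
    (fun _ ρ => prod_pos fun l _ => hratio l _)
    (fun y W => prod_nonneg fun l _ => simProb_nonneg h0 h1 _ _ _ _ _)
    (fun y => by
      rw [sum_prod_pi fun l x => simProb φ H₀ (π l) (u l + 1) (y.2.1 l) x]
      exact prod_le_one (fun l _ => sum_nonneg fun W _ => simProb_nonneg h0 h1 _ _ _ _ _)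
        fun l _ => sum_simProb_le H₀ hH₀ hne _ _ _)
    (fun β _ W => by
      simp only [runsProb, ← prod_div_distrib]
      have e : {ρ : Fin n → P0Run n₀ m | (fun l => (ρ l).view (π l)) = W} =
          {ρ | ∀ l, ρ l ∈ {x : P0Run n₀ m | x.view (π l) = W l}} := by
        ext ρ
        exact funext_iff
      rw [e, pr_pi fun l x => p0Prob φ H₀ (β.secret H l) x / runRatio φ H₀ (π l) (u l + 1) x]
      refine prod_le_prod (fun l _ => pr_nonneg (fun x =>
        div_nonneg (p0Prob_nonneg h0 h1 _ _ _) (hratio l x).le) _) fun l _ => ?_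
      have := pr_view_le_simProb h0 h1 H₀ (π l) (u l + 1) (β.secret H l) (W l)
      rw [huu, ← requestedStrings_apply H u] at this
      exact this)
  have hleak : ∑ β : Base r k m n, baseProb H 𝓜 β * ∑ ρ, runsProb φ H₀ H β ρ *
      Real.logb 2 (∏ l, runRatio φ H₀ (π l) (u l + 1) (ρ l)) ≤ n * c := by
    have hβ : ∀ β : Base r k m n, ∑ ρ, runsProb φ H₀ H β ρ *
        Real.logb 2 (∏ l, runRatio φ H₀ (π l) (u l + 1) (ρ l)) ≤ n * c := by
      intro β
      simp only [Real.logb_prod _ _ fun l _ => (hratio l _).ne', runsProb]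
      rw [sum_prod_mul_sum (fun l => p0Prob φ H₀ (β.secret H l))
        (fun l x => Real.logb 2 (runRatio φ H₀ (π l) (u l + 1) x)) fun l => sum_p0Prob hne _]
      refine (sum_le_sum fun l _ => hc l _).trans (le_of_eq ?_)
      simp
    refine (sum_le_sum fun β _ => mul_le_mul_of_nonneg_left (hβ β) (baseProb_nonneg H 𝓜 β)).trans
      (le_of_eq ?_)
    rw [← sum_mul, sum_baseProb hH h𝓜, one_mul]
  refine le_trans (by linarith) (hmain.trans (le_of_eq ?_))
  rw [← condEntropy_comp_equiv (executionEquiv r k m n n₀), prob_executionEquiv]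
  refine condEntropy_congr_right fun x x' => ?_
  simp only [Function.comp_apply, Equiv.symm_apply_apply, Base.known, Execution.view,
    requested_eq, Prod.mk.injEq]
  simp only [executionEquiv, Equiv.coe_fn_mk]
  tauto

end Protocol

end OT

/-! ### The two parts of the proposition assembled -/

theorem mainTheorem1 :
    ∃ f₁ : ℕ → ℝ → ℝ, (∀ δ : ℝ, 0 < δ → OT.ExpSmall fun r => f₁ r δ) ∧
      -- Bob learns exactly `U s + V t`, for arbitrary `U`, `V`
      (∀ (r k m : ℕ) (δ : ℝ), 0 < δ → (k : ℝ) = r * (1 / 2 - δ) →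
        ∀ 𝓜 : Set (OT.Mat k r), (𝓜 = Set.univ ∨ 𝓜 = {M | M.rank = k}) →
        ∀ U V : OT.Mat r r,
          ((V.rank : ℝ) ≤ r / 2 →
            r * m * (1 / 2 - δ) - m * f₁ r δ ≤
              OT.condEntropy (OT.idealProb (m := m) 𝓜)
                (fun ω => ω.2.1 * ω.2.2.2)
                (fun ω => (ω.1 * ω.2.2.1, OT.idealView U V ω))) ∧
          ((r : ℝ) / 2 < V.rank →
            r * m * (1 / 2 - δ) - m * f₁ r δ ≤
              OT.condEntropy (OT.idealProb (m := m) 𝓜)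
                (fun ω => ω.1 * ω.2.2.1)
                (fun ω => (ω.2.1 * ω.2.2.2, OT.idealView U V ω)))) ∧
      -- the actual protocol
      ∀ φ : ℝ, 0 < φ → φ < 1 / 2 →
        ∃ f₀ : ℝ → ℕ → ℝ, (∀ ε : ℝ, 0 < ε → OT.ExpSmall (f₀ ε)) ∧
          ∀ (ε : ℝ), 0 < ε →
          ∀ (n₀ k₀ m : ℕ) (H₀ : OT.Mat (n₀ - k₀) n₀), k₀ ≤ n₀ → H₀.rank = n₀ - k₀ →
          (m : ℝ) ≤ n₀ * ((k₀ : ℝ) / n₀ -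
            (1 - 2 * φ * (1 - φ)) * (1 - OT.binEnt (φ ^ 2 / (1 - 2 * φ * (1 - φ)))) - ε) →
          ∀ (r n k : ℕ) (δ : ℝ), 0 < δ → (k : ℝ) = r * (1 / 2 - δ) →
          ∀ 𝓜 : Set (OT.Mat k r), (𝓜 = Set.univ ∨ 𝓜 = {M | M.rank = k}) →
          ∀ H : OT.Mat r n, H * H.transpose = 1 →
          ∀ (u : Fin n → ZMod 2) (π : Fin n → OT.P0Strategy n₀ m), (∀ l, (π l).AsksFor (u l)) →
            (∀ ω : OT.Execution r k m n n₀, H * ω.x = ω.s →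
              H * ω.requested H u =
                (1 + OT.queryMatrix H u) * ω.s + OT.queryMatrix H u * ω.t) ∧
            (((OT.queryMatrix H u).rank : ℝ) ≤ r / 2 →
              r * m * (1 / 2 - δ) - m * f₁ r δ - n * f₀ ε m ≤
                OT.condEntropy (OT.Execution.prob φ H₀ H 𝓜)
                  (fun ω => ω.tTilde) (fun ω => (ω.sTilde, ω.view H u π))) ∧
            ((r : ℝ) / 2 < (OT.queryMatrix H u).rank →
              r * m * (1 / 2 - δ) - m * f₁ r δ - n * f₀ ε m ≤
                OT.condEntropy (OT.Execution.prob φ H₀ H 𝓜)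
                  (fun ω => ω.sTilde) (fun ω => (ω.tTilde, ω.view H u π))) := by
  refine ⟨OT.compressionLoss, fun δ hδ => OT.expSmall_compressionLoss hδ,
    fun r k m δ hδ hk 𝓜 h𝓜 U V => ⟨OT.condEntropy_ideal_left hδ hk m h𝓜 U V,
      OT.condEntropy_ideal_right hδ hk m h𝓜 U V⟩, fun φ h0 h1 => ?_⟩
  choose! C c hC hc hleak using fun (ε : ℝ) (hε : 0 < ε) => OT.exists_leakage_bound h0 h1 hε
  refine ⟨fun ε m => C ε * Real.exp (-(c ε * m)), fun ε hε => ⟨C ε, c ε, hC ε hε, hc ε hε,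
    fun m => (abs_of_pos (mul_pos (hC ε hε) (Real.exp_pos _))).le⟩, ?_⟩
  intro ε hε n₀ k₀ m H₀ hk₀ hH₀ hm r n k δ hδ hk 𝓜 h𝓜 H hH u π hπ
  have hp := OT.prob_nonneg (m := m) h0 (h1.trans (by norm_num)) H₀ H 𝓜
  refine ⟨OT.mul_requested_eq H u, ?_⟩
  -- For `m = 0` the rate condition does not force `n₀ > 0`, but the lower bound is nonpositive and
  -- entropy is nonnegative.
  rcases Nat.eq_zero_or_pos m with rfl | hm0
  · have h2 : (r : ℝ) * (0 : ℕ) * (1 / 2 - δ) - (0 : ℕ) * OT.compressionLoss r δ -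
        n * (C ε * Real.exp (-(c ε * (0 : ℕ)))) ≤ 0 := by
      have : 0 ≤ (n : ℝ) * (C ε * Real.exp (-(c ε * (0 : ℕ)))) :=
        mul_nonneg (Nat.cast_nonneg n) (mul_pos (hC ε hε) (Real.exp_pos _)).le
      simp only [Nat.cast_zero, mul_zero, zero_mul, sub_zero] at this ⊢
      linarith
    exact ⟨fun _ => h2.trans (OT.condEntropy_nonneg hp _ _),
      fun _ => h2.trans (OT.condEntropy_nonneg hp _ _)⟩
  obtain ⟨hrate, hn₀⟩ := OT.add_le_rateBound hm0 hk₀ hm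
  obtain ⟨hqm, hbound⟩ := hleak ε hε n₀ m (n₀ - k₀) H₀ hH₀ hn₀ hrate
  have hkr : k ≤ r := by
    rcases Nat.eq_zero_or_pos r with rfl | hr
    · have : (k : ℝ) = 0 := by simpa using hk
      exact (Nat.cast_eq_zero.1 this).le
    · have hr' : (0 : ℝ) < r := Nat.cast_pos.2 hr
      have : (k : ℝ) ≤ r := by nlinarith
      exact_mod_cast this
  have hne := OT.nonempty_of_univ_or_rank hkr h𝓜
  have hφ : φ < 1 := h1.trans (by norm_num)
  constructor
  · intro hV
    exact (sub_le_sub_right (OT.condEntropy_strings_left hδ hk m h𝓜 hH u hV) _).trans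
      (OT.condEntropy_base_sub_le h0 hφ hH₀ hqm hH hne u π (fun β => β.2.1 * β.2.2.2.1)
        (fun β => β.1 * β.2.2.1) fun l sec => hbound (π l) (u l) sec (hπ l))
  · intro hV
    exact (sub_le_sub_right (OT.condEntropy_strings_right hδ hk m h𝓜 hH u hV) _).trans
      (OT.condEntropy_base_sub_le h0 hφ hH₀ hqm hH hne u π (fun β => β.1 * β.2.2.1)
        (fun β => β.2.1 * β.2.2.2.1) fun l sec => hbound (π l) (u l) sec (hπ l))
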